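/- **Notation.** Let $f$ be a cusp form for $\mathrm{SL}_2(\mathbb Z)$ which is either holomorphic of weight $k$, with $f(z)=\sum_{n>0}\hat f(n)e^{2\pi i n z}$, or an even Maass form (then $k=0$) with Laplace eigenvalue $\frac14+r^2$ and $f(z)=\sum_{n>0}\hat f(n)W_r(nz)$, $W_r(x+iy)=2\sqrt y\,K_{ir}(2\pi y)\cos(2\pi x)$. For a Dirichlet character $\chi$ let $L(s,f\times\chi)$ be the entire continuation of $\sum_{n\ge1}\hat f(n)\chi(n)n^{-s-(k-1)/2}$, and put $\tau(\chi)=\sum_{j \bmod q}\chi(j)e^{2\pi i j/q}$. Let $$n(t)=\begin{pmatrix}1&t\\0&1\end{pmatrix},\quad a(t)=\begin{pmatrix}e^{t/2}&0\\0&e^{-t/2}\end{pmatrix},\quad K(\theta)=\begin{pmatrix}\cos\theta&\sin\theta\\-\sin\theta&\cos\theta\end{pmatrix},\quad \tilde f\begin{pmatrix}a&b\\c&d\end{pmatrix}=(ci+d)^{-k}f\Big(\frac{ai+b}{ci+d}\Big),$$ and let $\partial_1,\partial_2,\partial_3$ be the derivatives at $t=0$ along right translation by $n(t)$, $a(t)$,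 $K(t)$. Put $g=\tilde f$ if $f$ is holomorphic, or if $f$ is Maass and $\chi(-1)=1$; put $g=\partial_1\tilde f$ if $f$ is Maass and $\chi(-1)=-1$. For a character $\chi$ modulo $q$ let $$S_{\chi}(l,t)=\sum_{j=0}^{q-1}\chi(j)\,\partial_2^l g\big(n(j/q)a(t)\big).$$ **Model.** Programs run on a random access machine with exact arithmetic and unit cost for $+,-,\times,/$, $\exp$, $\log$ (for $|\arg z|<\pi$), real and imaginary parts, comparisons, memory accesses, evaluation of $\chi(n)$ and evaluation of $\partial^\beta\tilde f$ at a given point $n(x)a(t)K(\theta)$, with $\partial^\beta=\partial_1^{\beta_1}\partial_2^{\beta_2}\partial_3^{\beta_3}$. A program may call another one as a subroutine. It may use Gaussian rational literals and the following constants, which do not depend on $q$: $s$, the parameter $k$ (resp. $r$), and the number $\Gamma(s+\frac{k-1}2)^{-1}$ (resp. $\big(\Gamma(\frac{s+\delta+ir}2)\Gamma(\frac{s+\delta-ir}2)\big)^{-1}$ with $\chi(-1)=(-1)^\delta$, $\delta\in\{0,1\}$). Here $0$ stands for the inverse at a pole of the Gamma function. **Statement.** For every primitive $\chi$, the continuation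 $L(\cdot,f\times\chi)$ exists. Let $s\in\mathbb C$, and in the Maass case fix also the parity $\chi(-1)=(-1)^\delta$ of the characters considered. There are $A,B$ depending only on $f$, $s$ (and $\delta$) such that for all $\gamma>0$ and $0<\epsilon\le1$, with $X=(1+\gamma)/\epsilon$, there are a positive integer $N'\le AX$ and a real $T\le AX^B$ with the following property. Let $P_0,P_1,P_2,\dots$ be programs. Then there is a program $Q$ such that for every $q\ge1$, every primitive Dirichlet character $\chi$ modulo $q$ (of the given parity, in the Maass case) and all real $C,D$: if for each $0\le l\le N'$ and each real $|t|\le T(1+\log q)$ the program $P_l$ on input $(q,t)$ computes $S_\chi(l,t)$ in at most $D$ operations, up to an error of at most $$C\,q^{-\gamma-\epsilon-\max(0,\,1-2\operatorname{Re}s)},$$ then $Q$ on input $q$ computes $\tau(\chi)\,L(s,f\times\overline{\chi})$ in at most $AX^B\,D\,q^{\epsilon}$ operations, up to an error of at most $AX^B(1+C)\,q^{-\gamma}$. -/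

import Mathlib

open UpperHalfPlane
open scoped MatrixGroups Real

noncomputable section

namespace TwistedL

/-! ### Lie derivatives on `SL(2, ℝ)` and the lift of a form -/

/-- `n(t)`. -/
def nMat (t : ℝ) : SL(2, ℝ) := ⟨!![1, t; 0, 1], by simp [Matrix.det_fin_two]⟩

/-- `a(y)`. -/
def aMat (y : ℝ) : SL(2, ℝ) :=
  ⟨!![Real.exp (y / 2), 0; 0, Real.exp (-(y / 2))], by
    simp [Matrix.det_fin_two, ← Real.exp_add]⟩

/-- `K(θ)`. -/
def kMat (θ : ℝ) : SL(2, ℝ) :=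
  ⟨!![Real.cos θ, Real.sin θ; -Real.sin θ, Real.cos θ], by
    have := Real.cos_sq_add_sin_sq θ
    simp [Matrix.det_fin_two]
    nlinarith⟩

/-- `∂₁`: derivative along right translation by `n(t)`. -/
def partial1 (g : SL(2, ℝ) → ℂ) (x : SL(2, ℝ)) : ℂ := deriv (fun t : ℝ => g (x * nMat t)) 0

/-- `∂₂`: derivative along right translation by `a(t)`. -/
def partial2 (g : SL(2, ℝ) → ℂ) (x : SL(2, ℝ)) : ℂ := deriv (fun t : ℝ => g (x * aMat t)) 0

/-- `∂₃`: derivative along right translation by `K(t)`. -/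
def partial3 (g : SL(2, ℝ) → ℂ) (x : SL(2, ℝ)) : ℂ := deriv (fun t : ℝ => g (x * kMat t)) 0

/-- `∂^β = ∂₁^{β₁} ∂₂^{β₂} ∂₃^{β₃}`. -/
def partialPow (b : ℕ × ℕ × ℕ) (g : SL(2, ℝ) → ℂ) : SL(2, ℝ) → ℂ :=
  partial1^[b.1] (partial2^[b.2.1] (partial3^[b.2.2] g))

/-- The lift of a form of weight `k`: `(c i + d)^{-k} f ((a i + b) / (c i + d))`. -/
def lift (k : ℤ) (f : ℍ → ℂ) (g : SL(2, ℝ)) : ℂ :=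
  (((g 1 0 : ℝ) : ℂ) * Complex.I + ((g 1 1 : ℝ) : ℂ)) ^ (-k) * f (g • UpperHalfPlane.I)

/-! ### Even Maass cusp forms for `SL(2, ℤ)` -/

/-- `f` is an even Maass cusp form for `SL(2, ℤ)` with Laplace eigenvalue `1/4 + r²`. -/
structure IsEvenMaassCuspForm (r : ℂ) (f : ℍ → ℂ) : Prop where
  smooth : ContDiffOn ℝ (⊤ : ℕ∞) (fun z : ℂ => f (ofComplex z)) {z : ℂ | 0 < z.im}
  invariant : ∀ (γ : SL(2, ℤ)) (z : ℍ), f (γ • z) = f z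
  eigen : ∀ z : ℍ,
    -((z.im : ℂ) ^ 2 * Laplacian.laplacian (fun w : ℂ => f (ofComplex w)) (z : ℂ))
      = (1 / 4 + r ^ 2) * f z
  moderate : ∃ (C : ℝ) (N : ℕ), ∀ z : ℍ, 1 ≤ z.im → ‖f z‖ ≤ C * z.im ^ N
  cuspidal : ∀ y : ℝ, 0 < y → ∫ x in (0 : ℝ)..1, f (ofComplex (x + y * Complex.I)) = 0
  even : ∀ x y : ℝ, 0 < y → f (ofComplex (-x + y * Complex.I)) = f (ofComplex (x + y * Complex.I))

/-- The Bessel function `K_{ir}(y) = ∫_0^∞ exp(-y cosh t) cos(r t) dt`, for `y > 0`. -/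
def besselK (r : ℂ) (y : ℝ) : ℂ :=
  ∫ t in Set.Ioi (0 : ℝ), (Real.exp (-(y * Real.cosh t)) : ℂ) * Complex.cos (r * t)

/-- `W_r(x + i y) = 2 √y K_{ir}(2 π y) cos(2 π x)`. -/
def whittaker (r : ℂ) (x y : ℝ) : ℂ :=
  2 * (Real.sqrt y : ℂ) * besselK r (2 * π * y) * (Real.cos (2 * π * x) : ℂ)

/-- `a` is the sequence of coefficients in the expansion `f(z) = ∑_{n > 0} a(n) W_r(n z)`. -/
def IsMaassCoeff (r : ℂ) (f : ℍ → ℂ) (a : ℕ → ℂ) : Prop :=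
  a 0 = 0 ∧ ∀ z : ℍ, HasSum (fun n : ℕ+ => a n * whittaker r (n * z.re) (n * z.im)) (f z)

open Classical in
/-- The Fourier coefficients of an even Maass cusp form (every such form has a unique
expansion as in `IsMaassCoeff`). -/
def maassCoeff (r : ℂ) (f : ℍ → ℂ) : ℕ → ℂ :=
  if h : ∃ a, IsMaassCoeff r f a then h.choose else 0

/-! ### Twisted `L`-functions -/

/-- `L` is the entire continuation of `∑_{n ≥ 1} a(n) χ(n) n^{-(s + (k - 1)/2)}`. -/
def IsTwistedL (a : ℕ → ℂ) (k : ℤ) {q : ℕ} (χ : DirichletCharacter ℂ q) (L : ℂ → ℂ) : Prop :=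
  Differentiable ℂ L ∧ ∃ σ : ℝ, ∀ s : ℂ, σ < s.re →
    HasSum (fun n : ℕ+ => a n * χ ((n : ℕ) : ZMod q) / ((n : ℕ) : ℂ) ^ (s + ((k : ℂ) - 1) / 2))
      (L s)

open Classical in
/-- `L(s, f × χ)` for all complex `s`, where `a` are the Fourier coefficients of `f` and `k` is its
weight. By the identity theorem there is at most one `L` as in `IsTwistedL`. -/
def twistedL (a : ℕ → ℂ) (k : ℤ) {q : ℕ} (χ : DirichletCharacter ℂ q) : ℂ → ℂ :=
  if h : ∃ L, IsTwistedL a k χ L then h.choose else 0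

/-- The Gauss sum `τ(χ) = ∑_{k mod q} χ(k) e(k/q)`. -/
def tau {q : ℕ} [NeZero q] (χ : DirichletCharacter ℂ q) : ℂ := gaussSum χ ZMod.stdAddChar

/-! ### The real-number model of computation

Programs act on a memory `ℕ → ℂ`, with exact arithmetic. Each elementary operation has unit cost.
Literals are Gaussian rationals, so no infinite amount of information can be hidden in a program. -/

inductive BinOp
  | add | sub | mul | div

inductive UnOp
  | re | im | exp | log

inductive Prog
  /-- `m[d] := a + b i` -/
  | lit (d : ℕ) (a b : ℚ)
  /-- `m[d] :=` the `i`-th fixed constant of the problem -/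
  | const (d : ℕ) (i : Fin 3)
  /-- `m[d] := m[a] ∘ m[b]` -/
  | bin (o : BinOp) (d a b : ℕ)
  /-- `m[d] := o(m[a])` -/
  | un (o : UnOp) (d a : ℕ)
  /-- `m[d] := m[m[a]]` -/
  | load (d a : ℕ)
  /-- `m[m[d]] := m[a]` -/
  | store (d a : ℕ)
  /-- `m[d] := χ(m[a])` -/
  | char (d a : ℕ)
  /-- `m[d] := ∂^β f̃ (n(m[x]) a(m[t]) K(m[θ]))` -/
  | form (d : ℕ) (b : ℕ × ℕ × ℕ) (x t θ : ℕ)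
  /-- run one program after the other -/
  | seq (p p' : Prog)
  /-- `if Re m[a] ≤ Re m[b] then p else p'` -/
  | ite (a b : ℕ) (p p' : Prog)
  /-- `while Re m[a] ≤ Re m[b] do p` -/
  | loop (a b : ℕ) (p : Prog)
  /-- `m[d] := p(m[args])`: procedure call, run with a fresh memory -/
  | call (d : ℕ) (p : Prog) (args : List ℕ)

/-- The data that a program has access to: the modulus and the character, the lifted form, and
finitely many fixed constants. -/
structure Env where
  q : ℕ
  χ : DirichletCharacter ℂ q
  F : SL(2, ℝ) → ℂ
  c : Fin 3 → ℂ

def BinOp.eval : BinOp → ℂ → ℂ → ℂ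
  | .add, z, w => z + w
  | .sub, z, w => z - w
  | .mul, z, w => z * w
  | .div, z, w => z / w

/-- Division by zero is not permitted. -/
def BinOp.Ok : BinOp → ℂ → Prop
  | .div, w => w ≠ 0
  | _, _ => True

def UnOp.eval : UnOp → ℂ → ℂ
  | .re, z => (z.re : ℂ)
  | .im, z => (z.im : ℂ)
  | .exp, z => Complex.exp z
  | .log, z => Complex.log z

/-- Logarithms are permitted for `z ≠ 0`, `|arg z| < π`. -/
def UnOp.Ok : UnOp → ℂ → Prop
  | .log, z => z ∈ Complex.slitPlane
  | _, _ => True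

/-- The initial memory: the inputs, followed by zeros. -/
def initMem (l : List ℂ) : ℕ → ℂ := fun i => l.getD i 0

/-- `Exec E p m m' n`: started with memory `m`, the program `p` halts with memory `m'` after `n`
operations. -/
inductive Exec (E : Env) : Prog → (ℕ → ℂ) → (ℕ → ℂ) → ℕ → Prop
  | lit (m : ℕ → ℂ) (d : ℕ) (a b : ℚ) :
      Exec E (.lit d a b) m (Function.update m d ((a : ℂ) + (b : ℂ) * Complex.I)) 1
  | const (m : ℕ → ℂ) (d : ℕ) (i : Fin 3) :
      Exec E (.const d i) m (Function.update m d (E.c i)) 1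
  | bin (m : ℕ → ℂ) (o : BinOp) (d a b : ℕ) (h : o.Ok (m b)) :
      Exec E (.bin o d a b) m (Function.update m d (o.eval (m a) (m b))) 1
  | un (m : ℕ → ℂ) (o : UnOp) (d a : ℕ) (h : o.Ok (m a)) :
      Exec E (.un o d a) m (Function.update m d (o.eval (m a))) 1
  | load (m : ℕ → ℂ) (d a i : ℕ) (h : m a = i) :
      Exec E (.load d a) m (Function.update m d (m i)) 1
  | store (m : ℕ → ℂ) (d a i : ℕ) (h : m d = i) :
      Exec E (.store d a) m (Function.update m i (m a)) 1
  | char (m : ℕ → ℂ) (d a : ℕ) (j : ℤ) (h : m a = j) :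
      Exec E (.char d a) m (Function.update m d (E.χ (j : ZMod E.q))) 1
  | form (m : ℕ → ℂ) (d : ℕ) (b : ℕ × ℕ × ℕ) (x t θ : ℕ) (x₀ t₀ θ₀ : ℝ)
      (hx : m x = x₀) (ht : m t = t₀) (hθ : m θ = θ₀) :
      Exec E (.form d b x t θ) m
        (Function.update m d (partialPow b E.F (nMat x₀ * aMat t₀ * kMat θ₀))) 1
  | seq (m m' m'' : ℕ → ℂ) (p p' : Prog) (n n' : ℕ) (h : Exec E p m m' n)
      (h' : Exec E p' m' m'' n') : Exec E (.seq p p') m m'' (n + n')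
  | iteTrue (m m' : ℕ → ℂ) (a b : ℕ) (p p' : Prog) (n : ℕ) (hc : (m a).re ≤ (m b).re)
      (h : Exec E p m m' n) : Exec E (.ite a b p p') m m' (n + 1)
  | iteFalse (m m' : ℕ → ℂ) (a b : ℕ) (p p' : Prog) (n : ℕ) (hc : ¬ (m a).re ≤ (m b).re)
      (h : Exec E p' m m' n) : Exec E (.ite a b p p') m m' (n + 1)
  | loopTrue (m m' m'' : ℕ → ℂ) (a b : ℕ) (p : Prog) (n n' : ℕ) (hc : (m a).re ≤ (m b).re)
      (h : Exec E p m m' n) (h' : Exec E (.loop a b p) m' m'' n') :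
      Exec E (.loop a b p) m m'' (n + n' + 1)
  | loopFalse (m : ℕ → ℂ) (a b : ℕ) (p : Prog) (hc : ¬ (m a).re ≤ (m b).re) :
      Exec E (.loop a b p) m m 1
  | call (m m' : ℕ → ℂ) (d : ℕ) (p : Prog) (args : List ℕ) (n : ℕ)
      (h : Exec E p (initMem (args.map m)) m' n) :
      Exec E (.call d p args) m (Function.update m d (m' 0)) (n + args.length + 1)

/-- On the given inputs the program `p` halts after at most `time` operations and returns (in
`m[0]`) a number within `err` of `v`. -/
def Computes (E : Env) (p : Prog) (inputs : List ℂ) (v : ℂ) (err time : ℝ) : Prop :=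
  ∃ (m' : ℕ → ℂ) (n : ℕ), Exec E p (initMem inputs) m' n ∧ (n : ℝ) ≤ time ∧ ‖m' 0 - v‖ ≤ err

/-! ### The reduction -/

/-- `∑_{j < q} χ(j) ∂₂^l G (n(j/q) a(t))`. -/
def orbitSum {q : ℕ} (χ : DirichletCharacter ℂ q) (G : SL(2, ℝ) → ℂ) (l : ℕ) (t : ℝ) : ℂ :=
  ∑ j ∈ Finset.range q, χ (j : ZMod q) * partial2^[l] G (nMat (j / q) * aMat t)

/-- The values `τ(χ) L(χ)`, for the characters that satisfy `adm`, can be computed from the sums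
`∑_{j < q} χ(j) ∂₂^l G (n(j/q) a(t))`, by programs which use the lift `F` and the constants `c`.

Here `A`, `B` bound all implied constants by `A ((1 + γ)/ε)^B`. The program `Q` depends on `γ`, `ε`
and on the given programs `P l`, but not on `q`, `χ`, `C` or `D`. The sums are needed to the
precision `q^{-(γ + ε + max(0, 1 - 2 Re s))}` for the final error to be `O(q^{-γ})`. -/
def ReducesToOrbitSums (F G : SL(2, ℝ) → ℂ) (c : Fin 3 → ℂ) (s : ℂ)
    (adm : ∀ q : ℕ, DirichletCharacter ℂ q → Prop)
    (L : ∀ q : ℕ, DirichletCharacter ℂ q → ℂ) : Prop :=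
  ∃ (A : ℝ) (B : ℕ), ∀ γ ε : ℝ, 0 < γ → 0 < ε → ε ≤ 1 →
    ∃ (N' : ℕ) (T : ℝ), 1 ≤ N' ∧ (N' : ℝ) ≤ A * ((1 + γ) / ε) ∧ T ≤ A * ((1 + γ) / ε) ^ B ∧
      ∀ P : ℕ → Prog, ∃ Q : Prog, ∀ (q : ℕ) [NeZero q] (χ : DirichletCharacter ℂ q), adm q χ →
        ∀ C D : ℝ,
          (∀ l ≤ N', ∀ t : ℝ, |t| ≤ T * (1 + Real.log q) →
            Computes ⟨q, χ, F, c⟩ (P l) [(q : ℂ), (t : ℂ)] (orbitSum χ G l t)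
              (C * (q : ℝ) ^ (-(γ + ε + max 0 (1 - 2 * s.re)))) D) →
          Computes ⟨q, χ, F, c⟩ Q [(q : ℂ)] (tau χ * L q χ)
            (A * ((1 + γ) / ε) ^ B * (1 + C) * (q : ℝ) ^ (-γ))
            (A * ((1 + γ) / ε) ^ B * D * (q : ℝ) ^ ε)

end TwistedL

end

open UpperHalfPlane
open scoped MatrixGroups Real

noncomputable section

namespace TwistedL

open MeasureTheory Filter Topology

/-! ### The trapezoidal rule for functions holomorphic in a strip -/

/-! Put `w = s - 1/2`. Expanding `f` in its Fourier series and summing over `j` with Gauss sums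
turns the orbit sum into `τ(χ) ∑ b(n) χ⁻¹(n) φ(t + log n)`, with a kernel `φ` that does not depend
on `q`: an exponential for holomorphic forms, a Bessel function for Maass forms. Integrating against
`e^{wt}` gives `τ(χ) L(s, f × χ⁻¹)` times the Mellin transform of `φ`, a product of Gamma factors
whose inverse `H` is entire. Hence `τ(χ) L = H(w) ∫ S_χ(0, t) e^{wt} dt`, and the task is to compute
this integral.

The kernel decays doubly exponentially as `t → ∞`, and so does the orbit sum. An element of `SL(2,
ℤ)` exchanging the geodesics above `j/q` and `j'/q` with `j j' ≡ -1` gives a functional equation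
under `t ↦ -2 log q - t`, so the same decay holds at `-∞`, with centre `-log q`. The integral
therefore converges for every `w`, which gives the continuation of `L`.

The decay persists on the strip `|Im t| < 1`, because `Re e^t ≥ e^{Re t} / 2` there. By Poisson
summation the trapezoidal rule with step `h` then has error `O(e^{-π/h})` up to a power of `q`. A
step `h` of size `1 / (K₁ (1 + log q))` and a cutoff `R = log q + log (K₂ (1 + log q))`, with `K₁`
and `K₂` linear in `γ`, bring the discretization and truncation errors below `q^{-γ}`. This takes
`O(K₁ K₂ (1 + log q)^2)` nodes, each sampled by `P 0`; powers of `log q` are paid for by `q^ε`. The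
weight `e^{wt}` at the nodes is at most `q^{max(0, 1 - 2 Re s)}` up to powers of `log q`, whence the
precision asked of the input.

The analytic input is packaged in `OrbitData`; `OrbitData.exists_quadrature_bound` is the quadrature
and `OrbitData.reducesToOrbitSums` the program with its cost. For Maass forms the Fourier expansion
has to be derived: a Fourier coefficient satisfies the Bessel equation in `t`, and moderate growth
forces it to be a multiple of the recessive solution (`exists_eq_mul_of_tendsto`). For odd
characters `∂₁` replaces cosines by sines, which are the terms that an odd character detects. -/

/-- The strip `|Im z| < 1`. -/
def strip : Set ℂ := {z | |z.im| < 1}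

lemma isOpen_strip : IsOpen strip := isOpen_lt (by fun_prop) continuous_const

lemma convex_strip : Convex ℝ strip := by
  have : strip = Complex.imLm ⁻¹' Set.Ioo (-1) 1 := by
    ext z; simp [strip, abs_lt]
  rw [this]
  exact (convex_Ioo _ _).linear_preimage Complex.imLm

lemma ofReal_mem_strip (x : ℝ) : (x : ℂ) ∈ strip := by simp [strip]

lemma add_mul_I_mem_strip {x v : ℝ} (hv : |v| < 1) : (x + v * Complex.I : ℂ) ∈ strip := by
  simpa [strip] using hv

lemma integral_exp_neg_abs : ∫ x : ℝ, Real.exp (-|x|) = 2 := by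
  have := integral_comp_abs (f := fun x => Real.exp (-x))
  rw [this, integral_exp_neg_Ioi_zero, mul_one]

/-- A non-integrable function has Bochner integral `0`, so the value `2` already forces
integrability. -/
lemma integrable_exp_neg_abs : Integrable (fun x : ℝ => Real.exp (-|x|)) :=
  not_imp_comm.1 integral_undef (by rw [integral_exp_neg_abs]; norm_num)

/-- A holomorphic function on the strip `|Im z| < 1` that is `O(e^{-|Re z|})`. -/
structure StripDecay (g : ℂ → ℂ) (B : ℝ) : Prop where
  diff : DifferentiableOn ℂ g strip
  bound : ∀ z ∈ strip, ‖g z‖ ≤ B * Real.exp (-|z.re|)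

namespace StripDecay

variable {g : ℂ → ℂ} {B : ℝ}

lemma nonneg (hg : StripDecay g B) : 0 ≤ B := by
  simpa using (norm_nonneg _).trans (hg.bound 0 (by simp [strip]))

lemma continuous_line (hg : StripDecay g B) {v : ℝ} (hv : |v| < 1) :
    Continuous (fun x : ℝ => g (x + v * Complex.I)) :=
  hg.diff.continuousOn.comp_continuous (by fun_prop) fun x => add_mul_I_mem_strip hv

lemma bound_line (hg : StripDecay g B) {v : ℝ} (hv : |v| < 1) (x : ℝ) :
    ‖g (x + v * Complex.I)‖ ≤ B * Real.exp (-|x|) := by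
  simpa using hg.bound _ (add_mul_I_mem_strip hv (x := x))

lemma integrable_line (hg : StripDecay g B) {v : ℝ} (hv : |v| < 1) :
    Integrable (fun x : ℝ => g (x + v * Complex.I)) :=
  (integrable_exp_neg_abs.const_mul B).mono' (hg.continuous_line hv).aestronglyMeasurable
    (.of_forall fun x => hg.bound_line hv x)

/-- Cauchy's theorem on the rectangle `[-R, R] × [0, v]`: the vertical sides are `O(e^{-R})` and
disappear in the limit. -/
lemma integral_line_eq (hg : StripDecay g B) {v : ℝ} (hv : |v| < 1) :
    ∫ x : ℝ, g (x + v * Complex.I) = ∫ x : ℝ, g x := by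
  have hB := hg.nonneg
  have h0 : Tendsto (fun R : ℝ => ∫ x in (-R)..R, g (x + v * Complex.I)) atTop
      (𝓝 (∫ x : ℝ, g (x + v * Complex.I))) :=
    intervalIntegral_tendsto_integral (hg.integrable_line hv) tendsto_neg_atTop_atBot tendsto_id
  have h1 : Tendsto (fun R : ℝ => ∫ x in (-R)..R, g x) atTop (𝓝 (∫ x : ℝ, g x)) :=
    intervalIntegral_tendsto_integral
      (by simpa using hg.integrable_line (v := 0) (by simp)) tendsto_neg_atTop_atBot tendsto_id
  have hside : ∀ (e : ℝ), |e| = 1 →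
      Tendsto (fun R : ℝ => ∫ y in (0 : ℝ)..v, g ((e * R : ℝ) + y * Complex.I)) atTop (𝓝 0) := by
    intro e he
    have hlim : Tendsto (fun R : ℝ => B * Real.exp (-R) * |v - 0|) atTop (𝓝 0) := by
      have := (Real.tendsto_exp_neg_atTop_nhds_zero.const_mul B).mul_const |v - 0|
      simpa using this
    refine squeeze_zero_norm' ?_ hlim
    filter_upwards [eventually_ge_atTop 0] with R hR
    refine intervalIntegral.norm_integral_le_of_norm_le_const fun y hy => ?_
    have hy' : |y| < 1 := by
      refine lt_of_le_of_lt ?_ hv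
      rcases Set.mem_uIoc.1 hy with h | h
      · rw [abs_of_pos h.1, abs_of_pos (h.1.trans_le h.2)]; exact h.2
      · rw [abs_of_nonpos h.2, abs_of_neg (h.1.trans_le h.2)]; linarith [h.1]
    have := hg.bound_line hy' (e * R)
    rwa [abs_mul, he, one_mul, abs_of_nonneg hR] at this
  have hrect : ∀ R : ℝ, (∫ x in (-R)..R, g x) - (∫ x in (-R)..R, g (x + v * Complex.I))
      + Complex.I • (∫ y in (0 : ℝ)..v, g ((1 * R : ℝ) + y * Complex.I))
      - Complex.I • (∫ y in (0 : ℝ)..v, g ((-1 * R : ℝ) + y * Complex.I)) = 0 := by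
    intro R
    have := Complex.integral_boundary_rect_eq_zero_of_differentiableOn g (-R : ℝ) (R + v * Complex.I)
      (hg.diff.mono ?_)
    · simpa using this
    · intro z hz
      have hz2 := hz.2
      simp only [Set.mem_preimage, Complex.ofReal_im, Complex.add_im, Complex.mul_im,
        Complex.ofReal_re, Complex.I_im, mul_one, Complex.I_re, mul_zero, add_zero, zero_add] at hz2
      have := Set.abs_sub_left_of_mem_uIcc hz2
      simp only [sub_zero] at this
      exact this.trans_lt hv
  have hlim := ((h1.sub h0).add ((hside 1 (by simp)).const_smul Complex.I)).sub
    ((hside (-1) (by simp)).const_smul Complex.I)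
  have := tendsto_nhds_unique (hlim.congr hrect) tendsto_const_nhds
  simp only [smul_zero, add_zero, sub_zero] at this
  exact (sub_eq_zero.1 this).symm

/-- The Fourier transform decays exponentially. -/
lemma norm_integral_exp_mul_le (hg : StripDecay g B) (ξ : ℝ) :
    ‖∫ x : ℝ, Complex.exp (-2 * π * ξ * x * Complex.I) * g x‖ ≤ 2 * B * Real.exp (-π * |ξ|) := by
  -- The sign `e` is such that moving the contour to height `e / 2` gains `exp (-π |ξ|)`. The
  -- constant in `hG` only serves to justify the move; the estimate on the new line uses the bound
  -- for `g` itself.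
  obtain ⟨e, he, heξ⟩ : ∃ e : ℝ, |e| = 1 ∧ e * ξ = -|ξ| := by
    rcases le_total 0 ξ with h | h
    · exact ⟨-1, by simp, by rw [abs_of_nonneg h]; ring⟩
    · exact ⟨1, by simp, by rw [abs_of_nonpos h]; ring⟩
  have hG : StripDecay (fun z => Complex.exp (-2 * π * ξ * z * Complex.I) * g z)
      (Real.exp (2 * π * |ξ|) * B) := by
    refine ⟨?_, fun z hz => ?_⟩
    · exact DifferentiableOn.mul (by fun_prop) hg.diff
    · rw [norm_mul, Complex.norm_exp]
      have hre : (-2 * π * ξ * z * Complex.I).re = 2 * π * ξ * z.im := by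
        have : -2 * π * ξ * z * Complex.I = ((-2 * π * ξ : ℝ) : ℂ) * (z * Complex.I) := by
          push_cast; ring
        rw [this, Complex.re_ofReal_mul]; simp
      rw [hre, mul_assoc (Real.exp _) B]
      refine mul_le_mul (Real.exp_le_exp.2 ?_) (hg.bound z hz) (norm_nonneg _) (Real.exp_nonneg _)
      · have : ξ * z.im ≤ |ξ| * 1 := (le_abs_self _).trans (by
          rw [abs_mul]; exact mul_le_mul_of_nonneg_left (le_of_lt hz) (abs_nonneg _))
        nlinarith [Real.pi_pos]
  have hv : |e / 2| < 1 := by rw [abs_div, he]; norm_num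
  rw [← hG.integral_line_eq hv]
  have heq : ∀ x : ℝ, Complex.exp (-2 * π * ξ * (x + (e / 2 : ℝ) * Complex.I) * Complex.I)
      * g (x + (e / 2 : ℝ) * Complex.I) = Complex.exp (-π * |ξ| : ℝ) *
      (Complex.exp (-2 * π * ξ * x * Complex.I) * g (x + (e / 2 : ℝ) * Complex.I)) := by
    intro x
    rw [← mul_assoc, ← Complex.exp_add]
    congr 2
    have hc : (e : ℂ) * ξ = -(|ξ| : ℝ) := by exact_mod_cast heξ
    push_cast
    linear_combination (-π * e * ξ) * Complex.I_sq + (π : ℂ) * hc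
  simp_rw [heq]
  rw [integral_const_mul, norm_mul, ← Complex.ofReal_exp, Complex.norm_real, Real.norm_of_nonneg
    (Real.exp_nonneg _), mul_comm]
  gcongr
  refine (norm_integral_le_of_norm_le (integrable_exp_neg_abs.const_mul B)
    (.of_forall fun x => ?_)).trans_eq (by rw [integral_const_mul, integral_exp_neg_abs, mul_comm])
  rw [norm_mul, Complex.norm_exp]
  have hre : (-2 * π * ξ * x * Complex.I).re = 0 := by
    have : -2 * π * ξ * x * Complex.I = ((-2 * π * ξ * x : ℝ) : ℂ) * Complex.I := by
      push_cast; ring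
    rw [this, Complex.re_ofReal_mul]; simp
  rw [hre, Real.exp_zero, one_mul]
  exact hg.bound_line hv x

/-- The substitution `x = x₀ + h y` replaces the frequency `w` by `w / h` and contributes a
unimodular phase and the factor `h⁻¹`. -/
lemma norm_fourier_le (hg : StripDecay g B) {h : ℝ} (hh : 0 < h) (x₀ w : ℝ) :
    ‖FourierTransform.fourier (fun y : ℝ => g ((x₀ + h * y : ℝ) : ℂ)) w‖
      ≤ h⁻¹ * (2 * B) * Real.exp (-(π / h * |w|)) := by
  rw [Real.fourier_real_eq_integral_exp_smul]
  set Φ : ℝ → ℂ := fun x => Complex.exp (-2 * π * (w / h : ℝ) * x * Complex.I) * g x with hΦ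
  have heq : ∀ v : ℝ, Complex.exp (((-2 * π * v * w : ℝ) : ℂ) * Complex.I)
      • g ((x₀ + h * v : ℝ) : ℂ)
      = Complex.exp (((2 * π * (w / h) * x₀ : ℝ) : ℂ) * Complex.I) * Φ (x₀ + h * v) := by
    intro v
    simp only [hΦ]
    rw [← mul_assoc, ← Complex.exp_add, smul_eq_mul]
    congr 2
    have : (h : ℂ) ≠ 0 := by exact_mod_cast hh.ne'
    push_cast
    field_simp
    ring
  simp_rw [heq]
  rw [integral_const_mul, norm_mul, Complex.norm_exp_ofReal_mul_I, one_mul,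
    Measure.integral_comp_mul_left (fun y => Φ (x₀ + y)), integral_add_left_eq_self Φ, norm_smul,
    mul_assoc, Real.norm_of_nonneg (abs_nonneg _), abs_of_pos (inv_pos.2 hh)]
  gcongr
  refine (hg.norm_integral_exp_mul_le (w / h)).trans_eq ?_
  rw [abs_div, abs_of_pos hh]
  ring_nf

/-- Poisson summation is applied in a form that asks for power decay of the function and of its
transform; the exponent `-2` also gives summability. -/
lemma exp_neg_mul_abs_isBigO {a : ℝ} (ha : 0 < a) :
    (fun x : ℝ => Real.exp (-(a * |x|))) =O[cocompact ℝ] (fun x : ℝ => |x| ^ (-2 : ℝ)) := by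
  have h := (isLittleO_exp_neg_mul_rpow_atTop ha (-2)).isBigO
  have := h.comp_tendsto (tendsto_norm_cocompact_atTop (E := ℝ))
  simpa [Function.comp_def, neg_mul] using this

lemma summable_grid (hg : StripDecay g B) {h : ℝ} (hh : 0 < h) (x₀ : ℝ) :
    Summable fun m : ℤ => g ((x₀ + h * m : ℝ) : ℂ) := by
  refine summable_of_isBigO (Real.summable_abs_int_rpow (b := 2) (by norm_num)) ?_
  have h1 : (fun y : ℝ => g ((x₀ + h * y : ℝ) : ℂ)) =O[cocompact ℝ]
      fun x : ℝ => |x| ^ (-2 : ℝ) := by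
    refine Asymptotics.IsBigO.trans ?_ (exp_neg_mul_abs_isBigO hh)
    refine Asymptotics.IsBigO.of_bound (B * Real.exp |x₀|) (.of_forall fun y => ?_)
    rw [Real.norm_of_nonneg (Real.exp_nonneg _), mul_assoc, ← Real.exp_add]
    refine (by simpa using hg.bound_line (v := 0) (by simp) (x₀ + h * y) :
      ‖g ((x₀ + h * y : ℝ) : ℂ)‖ ≤ B * Real.exp (-|x₀ + h * y|)).trans ?_
    refine mul_le_mul_of_nonneg_left (Real.exp_le_exp.2 ?_) hg.nonneg
    have := abs_sub_abs_le_abs_sub (h * y) (-x₀)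
    rw [abs_neg, abs_mul, abs_of_pos hh, sub_neg_eq_add, add_comm (h * y)] at this
    linarith
  exact h1.comp_tendsto Int.tendsto_coe_cofinite

/-- The trapezoidal rule converges exponentially. -/
theorem norm_integral_sub_tsum_le (hg : StripDecay g B) {h : ℝ} (hh : 0 < h) (hh1 : h ≤ 1)
    (x₀ : ℝ) :
    ‖(∫ x : ℝ, g x) - h * ∑' m : ℤ, g ((x₀ + h * m : ℝ) : ℂ)‖ ≤ 8 * B * Real.exp (-(π / h)) := by
  have hB := hg.nonneg
  have hpi : 0 < π / h := div_pos Real.pi_pos hh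
  set f : ℝ → ℂ := fun y => g ((x₀ + h * y : ℝ) : ℂ) with hf
  have hcont : Continuous f :=
    hg.diff.continuousOn.comp_continuous (by fun_prop) fun x => ofReal_mem_strip _
  have hfO : f =O[cocompact ℝ] fun x : ℝ => |x| ^ (-2 : ℝ) := by
    refine Asymptotics.IsBigO.trans ?_ (exp_neg_mul_abs_isBigO hh)
    refine Asymptotics.IsBigO.of_bound (B * Real.exp |x₀|) (.of_forall fun y => ?_)
    rw [Real.norm_of_nonneg (Real.exp_nonneg _), mul_assoc, ← Real.exp_add]
    refine (by simpa using hg.bound_line (v := 0) (by simp) (x₀ + h * y) :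
      ‖g ((x₀ + h * y : ℝ) : ℂ)‖ ≤ B * Real.exp (-|x₀ + h * y|)).trans ?_
    refine mul_le_mul_of_nonneg_left (Real.exp_le_exp.2 ?_) hg.nonneg
    have := abs_sub_abs_le_abs_sub (h * y) (-x₀)
    rw [abs_neg, abs_mul, abs_of_pos hh, sub_neg_eq_add, add_comm (h * y)] at this
    linarith
  have hFO : FourierTransform.fourier f =O[cocompact ℝ] fun x : ℝ => |x| ^ (-2 : ℝ) := by
    refine Asymptotics.IsBigO.trans ?_ (exp_neg_mul_abs_isBigO hpi)
    refine Asymptotics.IsBigO.of_bound (h⁻¹ * (2 * B)) (.of_forall fun w => ?_)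
    rw [Real.norm_of_nonneg (Real.exp_nonneg _)]
    exact hg.norm_fourier_le hh x₀ w
  -- In Poisson's formula frequency `0` is the integral; the error is the sum over the other
  -- frequencies.
  have hP := Real.tsum_eq_tsum_fourier_of_rpow_decay hcont (b := 2) (by norm_num) hfO hFO 0
  simp only [zero_add, QuotientAddGroup.mk_zero, fourier_eval_zero, mul_one] at hP
  have hsum : Summable fun n : ℤ => FourierTransform.fourier f (n : ℝ) :=
    summable_of_isBigO (Real.summable_abs_int_rpow (b := 2) (by norm_num))
      (hFO.comp_tendsto Int.tendsto_coe_cofinite)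
  have h0 : FourierTransform.fourier f ((0 : ℤ) : ℝ) = h⁻¹ * ∫ x : ℝ, g x := by
    rw [Real.fourier_real_eq_integral_exp_smul]
    simp only [Int.cast_zero, mul_zero, Complex.ofReal_zero, zero_mul, Complex.exp_zero, one_smul,
      hf]
    rw [Measure.integral_comp_mul_left (fun y : ℝ => g ((x₀ + y : ℝ) : ℂ)),
      integral_add_left_eq_self (fun y : ℝ => g (y : ℂ)), abs_of_pos (inv_pos.2 hh)]
    simp
  have hhc : (h : ℂ) ≠ 0 := by exact_mod_cast hh.ne'
  have hs := HasSum.of_nat_of_neg_add_one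
    (f := fun n : ℤ => FourierTransform.fourier f (n : ℝ))
    ((hsum.comp_injective Nat.cast_injective).hasSum)
    ((hsum.comp_injective (i := fun n : ℕ => -((n : ℤ) + 1)) (fun a b hab => by simpa using hab)).hasSum)
  have hpos : ∀ (e : ℤ), |e| = 1 → ‖∑' n : ℕ, FourierTransform.fourier f ((e * ((n : ℤ) + 1) : ℤ) : ℝ)‖
      ≤ h⁻¹ * (4 * B) * Real.exp (-(π / h)) := by
    intro e he
    have hgeo := (hasSum_geometric_of_lt_one (Real.exp_nonneg (-(π / h)))
      (by simpa using hpi)).mul_left (h⁻¹ * (2 * B) * Real.exp (-(π / h)))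
    refine (tsum_of_norm_bounded hgeo fun n => ?_).trans ?_
    · refine (hg.norm_fourier_le hh x₀ _).trans_eq ?_
      rw [mul_assoc (h⁻¹ * (2 * B)), ← Real.exp_nat_mul, ← Real.exp_add]
      congr 2
      have : |((e * ((n : ℤ) + 1) : ℤ) : ℝ)| = n + 1 := by
        rw [← Int.cast_abs, abs_mul, he, one_mul, abs_of_nonneg (by positivity)]; simp
      rw [this]; ring
    -- The geometric ratio is at most `1 / 2` because `h ≤ 1`, so each tail costs a factor `2`. With
    -- `2 B` from the Fourier bound and two signs of the frequency this makes `8 B`.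
    · have h3 : Real.exp (-(π / h)) ≤ 1 / 2 := by
        have : 1 ≤ π / h := by
          rw [le_div_iff₀ hh]; linarith [Real.pi_gt_three]
        calc Real.exp (-(π / h)) ≤ Real.exp (-1) := Real.exp_le_exp.2 (by linarith)
          _ ≤ 1 / 2 := by
            rw [Real.exp_neg, one_div]
            exact inv_anti₀ (by norm_num) (by linarith [Real.add_one_le_exp 1])
      have h4 : (1 - Real.exp (-(π / h)))⁻¹ ≤ 2 := by
        rw [inv_le_comm₀ (by linarith) (by norm_num)]; linarith
      calc _ ≤ h⁻¹ * (2 * B) * Real.exp (-(π / h)) * 2 :=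
            mul_le_mul_of_nonneg_left h4 (by positivity)
        _ = _ := by ring
  have hsplit : ∑' n : ℕ, FourierTransform.fourier f (((n : ℤ) : ℤ) : ℝ) = h⁻¹ * (∫ x : ℝ, g x)
      + ∑' n : ℕ, FourierTransform.fourier f ((1 * ((n : ℤ) + 1) : ℤ) : ℝ) := by
    rw [← h0]
    refine (Summable.tsum_eq_zero_add (hsum.comp_injective (Nat.cast_injective (R := ℤ)))).trans ?_
    simp
  have key : (∫ x : ℝ, g x) - h * ∑' m : ℤ, g ((x₀ + h * m : ℝ) : ℂ)
      = -(h * (∑' n : ℕ, FourierTransform.fourier f ((1 * ((n : ℤ) + 1) : ℤ) : ℝ)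
        + ∑' n : ℕ, FourierTransform.fourier f ((-1 * ((n : ℤ) + 1) : ℤ) : ℝ))) := by
    have e1 := hs.tsum_eq
    rw [Function.comp_def, Function.comp_def] at e1
    simp only at e1
    rw [hsplit] at e1
    have : ∑' m : ℤ, g ((x₀ + h * m : ℝ) : ℂ) = ∑' n : ℤ, f n := rfl
    rw [this, hP, e1]
    have e2 : ∀ n : ℕ, (-1 * ((n : ℤ) + 1) : ℤ) = -((n : ℤ) + 1) := fun n => by ring
    simp_rw [e2]
    push_cast
    linear_combination -(∫ x : ℝ, g x) * mul_inv_cancel₀ hhc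
  rw [key, norm_neg, norm_mul, Complex.norm_real, Real.norm_of_nonneg hh.le]
  calc h * _ ≤ h * (h⁻¹ * (4 * B) * Real.exp (-(π / h)) + h⁻¹ * (4 * B) * Real.exp (-(π / h))) := by
        gcongr
        exact (norm_add_le _ _).trans (add_le_add (hpos 1 (by simp)) (hpos (-1) (by simp)))
    _ = _ := by field_simp; ring

/-- The truncated trapezoidal rule. -/
theorem norm_integral_sub_sum_le (hg : StripDecay g B) {h R B' : ℝ} (hh : 0 < h) (hh1 : h ≤ 1)
    (hR : 0 ≤ R) (hB' : 0 ≤ B') (htail : ∀ x : ℝ, R ≤ |x| → ‖g x‖ ≤ B' * Real.exp (-|x|))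
    (M : ℕ) (hM : 2 * R ≤ h * M) :
    ‖(∫ x : ℝ, g x) - h * ∑ i ∈ Finset.range M, g ((-R + h * i : ℝ) : ℂ)‖
      ≤ 8 * B * Real.exp (-(π / h)) + 4 * B' := by
  have hsum := hg.summable_grid hh (-R)
  set a : ℤ → ℂ := fun m : ℤ => g ((-R + h * m : ℝ) : ℂ) with ha
  have hs := (HasSum.of_nat_of_neg_add_one (f := a)
    ((hsum.comp_injective Nat.cast_injective).hasSum)
    ((hsum.comp_injective (i := fun n : ℕ => -((n : ℤ) + 1))
      (fun a b hab => by simpa using hab)).hasSum)).tsum_eq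
  have hs2 := (Summable.sum_add_tsum_nat_add M (hsum.comp_injective (Nat.cast_injective (R := ℤ)))).symm
  have hbd : ∀ u : ℕ → ℂ, (∀ n : ℕ, ‖u n‖ ≤ B' * Real.exp (-(h * n))) →
      h * ‖∑' n : ℕ, u n‖ ≤ 2 * B' := by
    intro u hu
    have hlt : Real.exp (-h) < 1 := by simpa using hh
    have hgeo := (hasSum_geometric_of_lt_one (Real.exp_nonneg (-h)) hlt).mul_left B'
    have h1 := tsum_of_norm_bounded hgeo (f := u) fun n => by
      refine (hu n).trans_eq ?_
      rw [← Real.exp_nat_mul]; ring_nf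
    -- This makes `h` times the geometric sum at most `2`, uniformly in the step size.
    have h2 : h / 2 ≤ 1 - Real.exp (-h) := by
      have h3 : Real.exp (-h) ≤ 1 / (1 + h) := by
        rw [Real.exp_neg, one_div]
        exact inv_anti₀ (by linarith) (by linarith [Real.add_one_le_exp h])
      have h4 : 1 / (1 + h) ≤ 1 - h / 2 := by
        rw [div_le_iff₀ (by linarith)]; nlinarith
      linarith
    have h5 : h * (1 - Real.exp (-h))⁻¹ ≤ 2 := by
      rw [← div_eq_mul_inv, div_le_iff₀ (by linarith)]; linarith
    calc h * ‖∑' n : ℕ, u n‖ ≤ h * (B' * (1 - Real.exp (-h))⁻¹) := by gcongr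
      _ = B' * (h * (1 - Real.exp (-h))⁻¹) := by ring
      _ ≤ B' * 2 := by gcongr
      _ = _ := by ring
  have t1 := hbd (fun n => a ((n + M : ℕ) : ℤ)) fun n => by
    -- The nodes from index `M` on lie beyond `R`, as `2 R ≤ h M`; those of negative index lie
    -- beyond `-R`.
    have hx : R + h * n ≤ -R + h * ((n + M : ℕ) : ℤ) := by push_cast; nlinarith
    have hn : 0 ≤ h * n := by positivity
    refine (htail _ ?_).trans ?_
    · rw [abs_of_nonneg (by linarith)]; linarith
    · gcongr
      rw [abs_of_nonneg (by linarith)]; linarith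
  have t2 := hbd (fun n => a (-((n : ℤ) + 1))) fun n => by
    have hx : -R + h * ((-((n : ℤ) + 1) : ℤ) : ℝ) ≤ -R - h * n := by push_cast; nlinarith
    have hn : 0 ≤ h * n := by positivity
    refine (htail _ ?_).trans ?_
    · rw [abs_of_nonpos (by linarith)]; linarith
    · gcongr
      rw [abs_of_nonpos (by linarith)]; linarith
  have key : (∫ x : ℝ, g x) - h * ∑ i ∈ Finset.range M, g ((-R + h * i : ℝ) : ℂ)
      = ((∫ x : ℝ, g x) - h * ∑' m : ℤ, a m)
        + (h * ∑' n : ℕ, a ((n + M : ℕ) : ℤ) + h * ∑' n : ℕ, a (-((n : ℤ) + 1))) := by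
    rw [Function.comp_def, Function.comp_def] at hs
    simp only [Function.comp_def] at hs2
    rw [hs, hs2]
    simp only [ha, Int.cast_natCast]
    ring
  rw [key]
  refine (norm_add_le _ _).trans (add_le_add (hg.norm_integral_sub_tsum_le hh hh1 (-R)) ?_)
  refine (norm_add_le _ _).trans ?_
  rw [norm_mul, norm_mul, Complex.norm_real, Real.norm_of_nonneg hh.le]
  linarith

end StripDecay

/-! ### Twisted series over a kernel on the strip -/

/-- One term of the exponential series: `y ^ p / p! ≤ e^y` with `y = a e^x`. It is valid for both
signs of `x`. -/
lemma exp_neg_mul_exp_le {a : ℝ} (ha : 0 < a) (p : ℕ) (x : ℝ) :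
    Real.exp (-(a * Real.exp x)) ≤ p.factorial * (1 / a) ^ p * Real.exp (-(p * x)) := by
  have h := Real.pow_div_factorial_le_exp (a * Real.exp x) (by positivity) p
  rw [div_le_iff₀ (by positivity)] at h
  rw [Real.exp_neg, Real.exp_neg (p * x), Real.exp_nat_mul, inv_le_iff_one_le_mul₀ (by positivity)]
  have : (1 / a) ^ p * (Real.exp x ^ p)⁻¹ = ((a * Real.exp x) ^ p)⁻¹ := by
    rw [mul_pow, mul_inv, one_div, inv_pow]
  rw [mul_assoc (p.factorial : ℝ), this, mul_comm, ← div_eq_mul_inv, mul_div_assoc',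
    le_div_iff₀ (by positivity), one_mul]
  linarith

/-- Holomorphic on the strip, at most polynomial in `e^t` at `-∞` and decaying doubly exponentially
at `∞`. -/
structure IsStripKernel (φ : ℂ → ℂ) : Prop where
  diff : DifferentiableOn ℂ φ strip
  decay : ∃ c : ℝ, 0 < c ∧ ∃ (N : ℕ) (C : ℝ), ∀ t ∈ strip,
    ‖φ t‖ ≤ C * Real.exp (-(N * t.re)) * Real.exp (-(c * Real.exp t.re))

/-- Half of the double exponential is exchanged for a further factor `e^{-p t}`. A larger `N` is
what makes sums over `n` of `φ (t + log n)` converge. -/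
lemma IsStripKernel.decay_of_le {φ : ℂ → ℂ} (hφ : IsStripKernel φ) :
    ∃ c : ℝ, 0 < c ∧ ∃ N₀ : ℕ, ∀ N : ℕ, N₀ ≤ N → ∃ C : ℝ, 0 ≤ C ∧ ∀ t ∈ strip,
      ‖φ t‖ ≤ C * Real.exp (-(N * t.re)) * Real.exp (-(c * Real.exp t.re)) := by
  obtain ⟨c, hc, N₀, C, h⟩ := hφ.decay
  refine ⟨c / 2, by positivity, N₀, fun N hN => ?_⟩
  obtain ⟨p, rfl⟩ := Nat.exists_eq_add_of_le hN
  have hC : 0 ≤ C := by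
    have h0 := (norm_nonneg _).trans (h 0 (by simp [strip]))
    simp only [Complex.zero_re, mul_zero, neg_zero, Real.exp_zero, mul_one] at h0
    exact nonneg_of_mul_nonneg_left h0 (Real.exp_pos _)
  refine ⟨C * (p.factorial * (1 / (c / 2)) ^ p), by positivity, fun t ht => (h t ht).trans ?_⟩
  have h1 := exp_neg_mul_exp_le (half_pos hc) p t.re
  have h2 : Real.exp (-(c * Real.exp t.re)) = Real.exp (-(c / 2 * Real.exp t.re))
      * Real.exp (-(c / 2 * Real.exp t.re)) := by rw [← Real.exp_add]; ring_nf
  have h3 : Real.exp (-(((N₀ + p : ℕ) : ℝ) * t.re)) = Real.exp (-(N₀ * t.re))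
      * Real.exp (-(p * t.re)) := by rw [← Real.exp_add]; push_cast; ring_nf
  rw [h2, h3]
  calc _ = C * Real.exp (-(N₀ * t.re)) * Real.exp (-(c / 2 * Real.exp t.re))
        * Real.exp (-(c / 2 * Real.exp t.re)) := by ring
    _ ≤ C * Real.exp (-(N₀ * t.re)) * (p.factorial * (1 / (c / 2)) ^ p * Real.exp (-(p * t.re)))
        * Real.exp (-(c / 2 * Real.exp t.re)) := by gcongr
    _ = _ := by ring

/-- `a(n) = O(n^N)` for some `N`. -/
def PolyBounded (b : ℕ → ℂ) : Prop := ∃ (N : ℕ) (C : ℝ), ∀ n : ℕ+, ‖b n‖ ≤ C * (n : ℝ) ^ N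

lemma add_log_mem_strip {t : ℂ} (ht : t ∈ strip) (x : ℝ) : t + x ∈ strip := by
  simpa [strip] using ht

section series

variable {q : ℕ} (b : ℕ → ℂ) (φ : ℂ → ℂ) (χ : DirichletCharacter ℂ q)

/-- The `n`-th term of `twistSeries`. -/
def twistTerm (n : ℕ+) (t : ℂ) : ℂ :=
  b n * χ ((n : ℕ) : ZMod q) * φ (t + (Real.log n : ℝ))

/-- `∑ b(n) χ(n) φ(t + log n)`. -/
def twistSeries (t : ℂ) : ℂ := ∑' n : ℕ+, twistTerm b φ χ n t

end series

lemma summable_pnat_inv_sq : Summable fun n : ℕ+ => (1 / (n : ℝ) ^ 2) :=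
  (Real.summable_one_div_nat_pow.2 one_lt_two).comp_injective PNat.coe_injective

/-- Uniform bound for the terms of the twisted series. -/
lemma exists_twistTerm_bound {b : ℕ → ℂ} {φ : ℂ → ℂ} (hb : PolyBounded b)
    (hφ : IsStripKernel φ) : ∃ c : ℝ, 0 < c ∧ ∃ (N : ℕ) (C : ℝ), 0 ≤ C ∧
      ∀ (q : ℕ) (χ : DirichletCharacter ℂ q) (n : ℕ+), ∀ t ∈ strip, ‖twistTerm b φ χ n t‖
        ≤ C * Real.exp (-(N * t.re)) * Real.exp (-(c * Real.exp t.re)) * (1 / (n : ℝ) ^ 2) := by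
  obtain ⟨N₁, C₁, h₁⟩ := hb
  obtain ⟨c, hc, N₀, h₀⟩ := hφ.decay_of_le
  -- `N₁` absorbs the growth of the coefficients and `2` leaves the summable factor `1 / n ^ 2`.
  obtain ⟨C, hC, h⟩ := h₀ (N₀ + (N₁ + 2)) (by omega)
  have hC₁ : 0 ≤ C₁ := by simpa using (norm_nonneg _).trans (h₁ 1)
  refine ⟨c, hc, N₀ + (N₁ + 2), C₁ * C, by positivity, fun q χ n t ht => ?_⟩
  have hn : (1 : ℝ) ≤ n := by exact_mod_cast n.pos
  have hn0 : (0 : ℝ) < n := by linarith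
  have h2 := h _ (add_log_mem_strip ht (Real.log n))
  have hre : (t + (Real.log n : ℝ)).re = t.re + Real.log n := by
    rw [Complex.add_re, Complex.ofReal_re]
  rw [hre] at h2
  have e1 : Real.exp (-(((N₀ + (N₁ + 2) : ℕ) : ℝ) * (t.re + Real.log n)))
      = Real.exp (-(((N₀ + (N₁ + 2) : ℕ) : ℝ) * t.re)) * (1 / (n : ℝ) ^ (N₀ + (N₁ + 2))) := by
    rw [mul_add, neg_add, Real.exp_add, Real.exp_neg (_ * Real.log n), Real.exp_nat_mul,
      Real.exp_log hn0, one_div]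
  have e2 : Real.exp (-(c * Real.exp (t.re + Real.log n))) ≤ Real.exp (-(c * Real.exp t.re)) := by
    rw [Real.exp_add, Real.exp_log hn0]
    refine Real.exp_le_exp.2 (neg_le_neg (mul_le_mul_of_nonneg_left ?_ hc.le))
    exact le_mul_of_one_le_right (Real.exp_nonneg _) hn
  rw [e1] at h2
  rw [twistTerm, norm_mul, norm_mul]
  calc ‖b n‖ * ‖χ ((n : ℕ) : ZMod q)‖ * ‖φ (t + (Real.log n : ℝ))‖
      ≤ (C₁ * (n : ℝ) ^ N₁) * 1 * (C * (Real.exp (-(((N₀ + (N₁ + 2) : ℕ) : ℝ) * t.re))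
        * (1 / (n : ℝ) ^ (N₀ + (N₁ + 2)))) * Real.exp (-(c * Real.exp t.re))) := by
        gcongr
        · exact h₁ n
        · exact χ.norm_le_one _
        · exact h2.trans (by gcongr)
    _ = C₁ * C * Real.exp (-(((N₀ + (N₁ + 2) : ℕ) : ℝ) * t.re)) * Real.exp (-(c * Real.exp t.re))
        * ((n : ℝ) ^ N₁ * (1 / (n : ℝ) ^ (N₀ + (N₁ + 2)))) := by ring
    _ ≤ _ := by
        refine mul_le_mul_of_nonneg_left ?_ (by positivity)
        rw [mul_one_div, div_le_div_iff₀ (by positivity) (by positivity), one_mul, ← pow_add]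
        exact pow_le_pow_right₀ hn (by omega)

lemma summable_twistTerm {b : ℕ → ℂ} {φ : ℂ → ℂ} (hb : PolyBounded b) (hφ : IsStripKernel φ)
    {q : ℕ} (χ : DirichletCharacter ℂ q) {t : ℂ} (ht : t ∈ strip) :
    Summable fun n => twistTerm b φ χ n t := by
  obtain ⟨c, hc, N, C, hC, h⟩ := exists_twistTerm_bound hb hφ
  exact Summable.of_norm_bounded (summable_pnat_inv_sq.mul_left _) fun n => h q χ n t ht

lemma exists_twistSeries_bound {b : ℕ → ℂ} {φ : ℂ → ℂ} (hb : PolyBounded b)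
    (hφ : IsStripKernel φ) : ∃ c : ℝ, 0 < c ∧ ∃ (N : ℕ) (C : ℝ), 0 ≤ C ∧
      ∀ (q : ℕ) (χ : DirichletCharacter ℂ q), ∀ t ∈ strip, ‖twistSeries b φ χ t‖
        ≤ C * Real.exp (-(N * t.re)) * Real.exp (-(c * Real.exp t.re)) := by
  obtain ⟨c, hc, N, C, hC, h⟩ := exists_twistTerm_bound hb hφ
  refine ⟨c, hc, N, C * ∑' n : ℕ+, (1 / (n : ℝ) ^ 2), ?_, fun q χ t ht => ?_⟩
  · exact mul_nonneg hC (tsum_nonneg fun n => by positivity)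
  · refine (tsum_of_norm_bounded (summable_pnat_inv_sq.mul_left _).hasSum
      fun n => h q χ n t ht).trans_eq ?_
    rw [tsum_mul_left]; ring

/-- The bound on the terms is uniform in `t` only on half-strips bounded on the left, so the
Weierstrass theorem is applied near each point separately. -/
lemma differentiableOn_twistSeries {b : ℕ → ℂ} {φ : ℂ → ℂ} (hb : PolyBounded b)
    (hφ : IsStripKernel φ) {q : ℕ} (χ : DirichletCharacter ℂ q) :
    DifferentiableOn ℂ (twistSeries b φ χ) strip := by
  obtain ⟨c, hc, N, C, hC, h⟩ := exists_twistTerm_bound hb hφ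
  intro t₀ ht₀
  set U : Set ℂ := strip ∩ {t | t₀.re - 1 < t.re} with hU
  have hUo : IsOpen U := isOpen_strip.inter (isOpen_lt continuous_const Complex.continuous_re)
  have : DifferentiableOn ℂ (twistSeries b φ χ) U := by
    refine Complex.differentiableOn_tsum_of_summable_norm
      (summable_pnat_inv_sq.mul_left (C * Real.exp (-(N * (t₀.re - 1))))) ?_ hUo ?_
    · intro n t ht
      refine DifferentiableWithinAt.const_mul ?_ _
      have h1 : DifferentiableAt ℂ φ (t + (Real.log n : ℝ)) :=
        hφ.diff.differentiableAt (isOpen_strip.mem_nhds (add_log_mem_strip ht.1 _))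
      exact (h1.comp t (f := fun t => t + ((Real.log n : ℝ) : ℂ))
        (by fun_prop)).differentiableWithinAt
    · intro n t ht
      refine (h q χ n t ht.1).trans ?_
      refine mul_le_mul_of_nonneg_right ?_ (by positivity)
      refine (mul_le_of_le_one_right (by positivity) (Real.exp_le_one_iff.2 ?_)).trans ?_
      · have := Real.exp_pos t.re
        nlinarith
      · refine mul_le_mul_of_nonneg_left (Real.exp_le_exp.2 (neg_le_neg ?_)) hC
        exact mul_le_mul_of_nonneg_left (le_of_lt ht.2) (by positivity)
  exact (this.differentiableAt (hUo.mem_nhds ⟨ht₀, by simp⟩)).differentiableWithinAt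

/-- At `-∞` the factor `e^{α u}` with `α ≥ 1` is enough; at `∞` the double exponential beats `e^{(α
+ 1) u}`. -/
lemma exp_mul_sub_exp_le {c α : ℝ} (hc : 0 < c) (hα : 1 ≤ α) : ∃ K : ℝ, ∀ u : ℝ,
    Real.exp (α * u) * Real.exp (-(c * Real.exp u)) ≤ K * Real.exp (-|u|) := by
  obtain ⟨j, hj⟩ := exists_nat_ge (α + 1)
  refine ⟨max 1 (j.factorial * (1 / c) ^ j), fun u => ?_⟩
  rcases le_total u 0 with hu | hu
  · have h1 : Real.exp (-(c * Real.exp u)) ≤ 1 := Real.exp_le_one_iff.2 (by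
      have := Real.exp_pos u; nlinarith)
    calc _ ≤ Real.exp (α * u) * 1 := by gcongr
      _ ≤ 1 * Real.exp (-|u|) := by
        rw [mul_one, one_mul, abs_of_nonpos hu]
        exact Real.exp_le_exp.2 (by nlinarith)
      _ ≤ _ := by gcongr; exact le_max_left _ _
  · calc _ ≤ Real.exp (α * u) * (j.factorial * (1 / c) ^ j * Real.exp (-(j * u))) := by
          gcongr; exact exp_neg_mul_exp_le hc j u
      _ = j.factorial * (1 / c) ^ j * Real.exp (α * u - j * u) := by
          rw [sub_eq_add_neg, Real.exp_add]; ring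
      _ ≤ j.factorial * (1 / c) ^ j * Real.exp (-|u|) := by
          gcongr; rw [abs_of_nonneg hu]; nlinarith
      _ ≤ _ := by gcongr; exact le_max_right _ _

lemma norm_exp_mul_ofReal (w : ℂ) (t : ℝ) : ‖Complex.exp (w * t)‖ = Real.exp (w.re * t) := by
  rw [Complex.norm_exp, Complex.re_mul_ofReal]

/-- The Mellin transform of a twisted series. -/
lemma hasSum_integral_twistSeries {b : ℕ → ℂ} {φ : ℂ → ℂ} (hb : PolyBounded b)
    (hφ : IsStripKernel φ) : ∃ σ : ℝ, ∀ (q : ℕ) (χ : DirichletCharacter ℂ q) (w : ℂ), σ < w.re →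
      HasSum (fun n : ℕ+ => b n * χ ((n : ℕ) : ZMod q) / ((n : ℕ) : ℂ) ^ w
          * ∫ t : ℝ, φ t * Complex.exp (w * t))
        (∫ t : ℝ, twistSeries b φ χ t * Complex.exp (w * t)) := by
  obtain ⟨c, hc, N, C, hC, h⟩ := exists_twistTerm_bound hb hφ
  refine ⟨N + 1, fun q χ w hw => ?_⟩
  obtain ⟨K, hK⟩ := exp_mul_sub_exp_le hc (α := w.re - N) (by linarith)
  have hcont : ∀ n : ℕ+, Continuous fun t : ℝ => twistTerm b φ χ n t * Complex.exp (w * t) := by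
    intro n
    refine Continuous.mul ?_ (by fun_prop)
    refine continuous_const.mul (hφ.diff.continuousOn.comp_continuous (by fun_prop) fun t => ?_)
    exact add_log_mem_strip (ofReal_mem_strip t) _
  have hbd : ∀ (n : ℕ+) (t : ℝ), ‖twistTerm b φ χ n t * Complex.exp (w * t)‖
      ≤ C * K * (1 / (n : ℝ) ^ 2) * Real.exp (-|t|) := by
    intro n t
    rw [norm_mul, norm_exp_mul_ofReal]
    have h1 := h q χ n t (ofReal_mem_strip t)
    rw [Complex.ofReal_re] at h1
    calc _ ≤ C * Real.exp (-(N * t)) * Real.exp (-(c * Real.exp t)) * (1 / (n : ℝ) ^ 2)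
          * Real.exp (w.re * t) := by gcongr
      _ = C * (1 / (n : ℝ) ^ 2) * (Real.exp ((w.re - N) * t) * Real.exp (-(c * Real.exp t))) := by
          rw [sub_mul, sub_eq_add_neg, Real.exp_add]; ring
      _ ≤ C * (1 / (n : ℝ) ^ 2) * (K * Real.exp (-|t|)) :=
          mul_le_mul_of_nonneg_left (hK t) (by positivity)
      _ = _ := by ring
  have hint : ∀ n : ℕ+, Integrable fun t : ℝ => twistTerm b φ χ n t * Complex.exp (w * t) :=
    fun n => (integrable_exp_neg_abs.const_mul _).mono' (hcont n).aestronglyMeasurable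
      (.of_forall (hbd n))
  have hsum : Summable fun n : ℕ+ => ∫ t : ℝ, ‖twistTerm b φ χ n t * Complex.exp (w * t)‖ := by
    refine Summable.of_nonneg_of_le (fun n => by positivity) (fun n => ?_)
      ((summable_pnat_inv_sq.mul_left (C * K)).mul_right 2)
    refine (integral_mono (hint n).norm (integrable_exp_neg_abs.const_mul _) (hbd n)).trans_eq ?_
    rw [integral_const_mul, integral_exp_neg_abs]
  have := hasSum_integral_of_summable_integral_norm hint hsum
  have e1 : ∀ n : ℕ+, ∫ t : ℝ, twistTerm b φ χ n t * Complex.exp (w * t)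
      = b n * χ ((n : ℕ) : ZMod q) / ((n : ℕ) : ℂ) ^ w * ∫ t : ℝ, φ t * Complex.exp (w * t) := by
    intro n
    have hn : ((n : ℕ) : ℂ) ≠ 0 := by exact_mod_cast n.ne_zero
    have hn' : (0 : ℝ) < n := by exact_mod_cast n.pos
    -- Translating by `log n` is what extracts `n ^ (-w)`.
    rw [← integral_add_right_eq_self (fun t : ℝ => φ t * Complex.exp (w * t)) (Real.log n),
      ← integral_const_mul]
    congr 1 with t
    have e2 : Complex.exp (w * ((t + Real.log n : ℝ) : ℂ))
        = Complex.exp (w * t) * ((n : ℕ) : ℂ) ^ w := by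
      rw [Complex.cpow_def_of_ne_zero hn, ← Complex.exp_add, Complex.ofReal_add,
        Complex.ofReal_log hn'.le]
      push_cast
      ring_nf
    have hnw : ((n : ℕ) : ℂ) ^ w ≠ 0 := by simp [Complex.cpow_eq_zero_iff, hn]
    rw [e2, twistTerm, Complex.ofReal_add]
    field_simp
  simp_rw [e1] at this
  have e3 : ∀ t : ℝ, twistSeries b φ χ t * Complex.exp (w * t)
      = ∑' n : ℕ+, twistTerm b φ χ n t * Complex.exp (w * t) := fun t => tsum_mul_right.symm
  simp_rw [e3]
  exact this

/-! ### Orbit sums with a series expansion and a functional equation -/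

/-- The analytic input on the orbit sums of `G`: for the characters in `adm`, they are given by
twisted series over the kernel `φ` with coefficients `b`, they satisfy a functional equation, and
the Mellin transform of `φ` has an inverse `H` that is entire. -/
structure OrbitData (G : SL(2, ℝ) → ℂ) (b : ℕ → ℂ) (φ H : ℂ → ℂ)
    (adm : ∀ q : ℕ, DirichletCharacter ℂ q → Prop) : Prop where
  kernel : IsStripKernel φ
  coeff : PolyBounded b
  diff : Differentiable ℂ H
  mellin : ∃ σ : ℝ, ∀ w : ℂ, σ < w.re → H w * ∫ t : ℝ, φ t * Complex.exp (w * t) = 1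
  prim : ∀ (q : ℕ) (χ : DirichletCharacter ℂ q), adm q χ → χ.IsPrimitive
  inv : ∀ (q : ℕ) (χ : DirichletCharacter ℂ q), adm q χ → adm q χ⁻¹
  series : ∀ (q : ℕ) [NeZero q] (χ : DirichletCharacter ℂ q), adm q χ → ∀ t : ℝ,
    orbitSum χ G 0 t = tau χ * twistSeries b φ χ⁻¹ t
  feq : ∀ (q : ℕ) [NeZero q] (χ : DirichletCharacter ℂ q), adm q χ → ∃ ω : ℂ, ‖ω‖ ≤ 1 ∧
    ∀ t : ℝ, orbitSum χ G 0 t = ω * orbitSum χ⁻¹ G 0 (-(2 * Real.log q) - t)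

/-- The discrete Fourier transform of a primitive character is a multiple of its Gauss sum. If that
were zero, injectivity of the transform would give `χ = 0`, against `χ 1 = 1`. -/
lemma tau_ne_zero {q : ℕ} [NeZero q] {χ : DirichletCharacter ℂ q} (hχ : χ.IsPrimitive) :
    tau χ ≠ 0 := by
  intro h
  have h1 : ZMod.dft (χ : ZMod q → ℂ) = 0 := by
    funext k
    rw [hχ.fourierTransform_eq_inv_mul_gaussSum]
    rw [show gaussSum χ ZMod.stdAddChar = tau χ from rfl, h, mul_zero, Pi.zero_apply]
  have h2 : (χ : ZMod q → ℂ) = 0 := by simpa using h1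
  have := congrFun h2 1
  simp at this

/-- The trivial bound suffices: fixed powers of `q` are absorbed later by the choice of step and
cutoff. -/
lemma norm_tau_le {q : ℕ} [NeZero q] (χ : DirichletCharacter ℂ q) : ‖tau χ‖ ≤ q := by
  rw [tau, gaussSum]
  refine (norm_sum_le _ _).trans ?_
  have : ∀ a : ZMod q, ‖χ a * ZMod.stdAddChar a‖ ≤ 1 := fun a => by
    rw [norm_mul, AddChar.norm_apply, mul_one]; exact χ.norm_le_one a
  refine (Finset.sum_le_sum fun a _ => this a).trans_eq ?_
  simp

/-! ### Decay of the orbit sums, quadrature and continuation -/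

namespace OrbitData

variable {G : SL(2, ℝ) → ℂ} {b : ℕ → ℂ} {φ H : ℂ → ℂ}
  {adm : ∀ q : ℕ, DirichletCharacter ℂ q → Prop}

/-- Both sides are holomorphic on the strip and agree on the real line, so the identity theorem
applies. -/
lemma feq_strip (D : OrbitData G b φ H adm) {q : ℕ} [NeZero q] {χ : DirichletCharacter ℂ q}
    (hχ : adm q χ) : ∃ ω : ℂ, ‖ω‖ ≤ 1 ∧ ∀ t ∈ strip, tau χ * twistSeries b φ χ⁻¹ t
      = ω * (tau χ⁻¹ * twistSeries b φ χ (-(2 * Real.log q : ℝ) - t)) := by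
  obtain ⟨ω, hω, h⟩ := D.feq q χ hχ
  refine ⟨ω, hω, fun t ht => ?_⟩
  have hd1 : DifferentiableOn ℂ (fun t => tau χ * twistSeries b φ χ⁻¹ t) strip :=
    (differentiableOn_twistSeries D.coeff D.kernel _).const_mul _
  have hmaps : Set.MapsTo (fun t : ℂ => -((2 * Real.log q : ℝ) : ℂ) - t) strip strip := by
    intro t ht
    have : (-((2 * Real.log q : ℝ) : ℂ) - t).im = -t.im := by
      rw [Complex.sub_im, Complex.neg_im, Complex.ofReal_im]; simp
    simpa only [strip, Set.mem_ofPred_eq, this, abs_neg] using ht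
  have hd2 : DifferentiableOn ℂ (fun t => ω * (tau χ⁻¹ * twistSeries b φ χ
      (-(2 * Real.log q : ℝ) - t))) strip :=
    (((differentiableOn_twistSeries D.coeff D.kernel χ).comp
      (by fun_prop) hmaps).const_mul _).const_mul _
  have hfreq : ∃ᶠ z in 𝓝[≠] (0 : ℂ), tau χ * twistSeries b φ χ⁻¹ z
      = ω * (tau χ⁻¹ * twistSeries b φ χ (-(2 * Real.log q : ℝ) - z)) := by
    have htend : Tendsto (fun x : ℝ => (x : ℂ)) (𝓝[≠] 0) (𝓝[≠] 0) := by
      refine tendsto_nhdsWithin_of_tendsto_nhds_of_eventually_within _ ?_ ?_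
      · exact (Complex.continuous_ofReal.tendsto' 0 0 (by simp)).mono_left nhdsWithin_le_nhds
      · filter_upwards [self_mem_nhdsWithin] with x hx
        simpa using hx
    refine htend.frequently (Eventually.frequently (.of_forall fun x => ?_))
    have h1 := h x
    rw [D.series q χ hχ, D.series q χ⁻¹ (D.inv q χ hχ), inv_inv] at h1
    push_cast at h1 ⊢
    exact h1
  exact (hd1.analyticOnNhd isOpen_strip).eqOn_of_preconnected_of_frequently_eq
    (hd2.analyticOnNhd isOpen_strip) convex_strip.isPreconnected (by simp [strip]) hfreq ht

/-- The holomorphic extension of the orbit sum, centred at `- log q`. -/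
def centred (b : ℕ → ℂ) (φ : ℂ → ℂ) {q : ℕ} [NeZero q] (χ : DirichletCharacter ℂ q) (z : ℂ) : ℂ :=
  tau χ * twistSeries b φ χ⁻¹ (z - (Real.log q : ℝ))

/-- To the right of the centre this is the bound for the series; since `-log q` is fixed by `t ↦ -2
log q - t`, the functional equation reflects it to the left. The constant `c / q` is `c e^{-log q}`.
-/
lemma exists_centred_bound (D : OrbitData G b φ H adm) : ∃ c : ℝ, 0 < c ∧ ∃ (N : ℕ) (C : ℝ),
    0 ≤ C ∧ ∀ (q : ℕ) [NeZero q] (χ : DirichletCharacter ℂ q), adm q χ → ∀ z ∈ strip,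
      ‖centred b φ χ z‖ ≤ C * (q : ℝ) ^ N * Real.exp (-(c / q * Real.exp |z.re|)) := by
  obtain ⟨c, hc, N, C, hC, h⟩ := exists_twistSeries_bound D.coeff D.kernel
  refine ⟨c, hc, N + 1, C, hC, fun q _ χ hχ z hz => ?_⟩
  have hq : (0 : ℝ) < q := by exact_mod_cast NeZero.pos q
  have hpos : ∀ χ' : DirichletCharacter ℂ q, ∀ z ∈ strip, 0 ≤ z.re →
      ‖tau χ' * twistSeries b φ χ'⁻¹ (z - (Real.log q : ℝ))‖
        ≤ C * (q : ℝ) ^ (N + 1) * Real.exp (-(c / q * Real.exp |z.re|)) := by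
    intro χ' z hz hre
    have h1 := h q χ'⁻¹ (z - (Real.log q : ℝ)) (by
      simpa only [sub_eq_add_neg, Complex.ofReal_neg] using add_log_mem_strip hz (-Real.log q))
    have e : (z - (Real.log q : ℝ)).re = z.re - Real.log q := by
      rw [Complex.sub_re, Complex.ofReal_re]
    rw [e] at h1
    have e1 : Real.exp (-(N * (z.re - Real.log q))) ≤ (q : ℝ) ^ N := by
      have : (q : ℝ) ^ N = Real.exp (N * Real.log q) := by
        rw [Real.exp_nat_mul, Real.exp_log hq]
      rw [this]
      refine Real.exp_le_exp.2 ?_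
      have : 0 ≤ N * z.re := by positivity
      linarith
    have e2 : c * Real.exp (z.re - Real.log q) = c / q * Real.exp |z.re| := by
      rw [Real.exp_sub, Real.exp_log hq, abs_of_nonneg hre]; ring
    rw [e2] at h1
    rw [norm_mul]
    calc _ ≤ q * (C * (q : ℝ) ^ N * Real.exp (-(c / q * Real.exp |z.re|))) := by
          gcongr
          · exact norm_tau_le χ'
          · exact h1.trans (by gcongr)
      _ = _ := by ring
  rcases le_total 0 z.re with hre | hre
  · exact hpos χ z hz hre
  · obtain ⟨ω, hω, hfe⟩ := D.feq_strip hχ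
    have hz' : -z ∈ strip := by simpa [strip] using hz
    have h2 := hpos χ⁻¹ (-z) hz' (by simpa using hre)
    rw [inv_inv, Complex.neg_re, abs_neg] at h2
    rw [centred, hfe _ (by
      simpa only [sub_eq_add_neg, Complex.ofReal_neg] using add_log_mem_strip hz (-Real.log q)),
      norm_mul]
    have e : (-((2 * Real.log q : ℝ) : ℂ) - (z - (Real.log q : ℝ))) = -z - (Real.log q : ℝ) := by
      push_cast; ring
    rw [e]
    exact (mul_le_of_le_one_left (norm_nonneg _) hω).trans h2

/-- The weighted orbit sum, centred at `- log q`. -/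
def weighted (b : ℕ → ℂ) (φ : ℂ → ℂ) {q : ℕ} [NeZero q] (χ : DirichletCharacter ℂ q) (w z : ℂ) :
    ℂ :=
  centred b φ χ z * Complex.exp (w * (z - (Real.log q : ℝ)))

lemma weighted_ofReal (D : OrbitData G b φ H adm) {q : ℕ} [NeZero q] {χ : DirichletCharacter ℂ q}
    (hχ : adm q χ) (w : ℂ) (x : ℝ) : weighted b φ χ w x
      = orbitSum χ G 0 (x - Real.log q) * Complex.exp (w * ((x - Real.log q : ℝ) : ℂ)) := by
  rw [D.series q χ hχ, weighted, centred, Complex.ofReal_sub]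

/-- The weight costs at most `(e q) ^ p e^{p |Re z|}`. Half of the double exponential pays for this
and for `e^{-|Re z|}`, at the price of a power of `q`; the other half is kept for the truncation
error. -/
lemma exists_weighted_bound (D : OrbitData G b φ H adm) (ρ : ℝ) : ∃ c : ℝ, 0 < c ∧
    ∃ (N : ℕ) (C : ℝ), 0 ≤ C ∧ ∀ (q : ℕ) [NeZero q] (χ : DirichletCharacter ℂ q), adm q χ →
      ∀ w : ℂ, ‖w‖ ≤ ρ → ∀ z ∈ strip, ‖weighted b φ χ w z‖
        ≤ C * (q : ℝ) ^ N * Real.exp (-(c / q * Real.exp |z.re|)) * Real.exp (-|z.re|) := by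
  obtain ⟨c, hc, N, C, hC, h⟩ := D.exists_centred_bound
  obtain ⟨p, hp⟩ := exists_nat_ge ρ
  refine ⟨c / 2, by positivity, N + p + (p + 1),
    C * Real.exp p * ((p + 1).factorial * (2 / c) ^ (p + 1)), by positivity,
    fun q _ χ hχ w hw z hz => ?_⟩
  have hq : (0 : ℝ) < q := by exact_mod_cast NeZero.pos q
  have hq1 : (1 : ℝ) ≤ q := by exact_mod_cast NeZero.pos q
  have hlog : 0 ≤ Real.log q := Real.log_nonneg hq1
  have h1 := h q χ hχ z hz
  have h2 : ‖Complex.exp (w * (z - (Real.log q : ℝ)))‖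
      ≤ Real.exp p * (q : ℝ) ^ p * Real.exp (p * |z.re|) := by
    rw [Complex.norm_exp]
    have : (q : ℝ) ^ p = Real.exp (p * Real.log q) := by
      rw [Real.exp_nat_mul, Real.exp_log hq]
    rw [this, ← Real.exp_add, ← Real.exp_add]
    refine Real.exp_le_exp.2 ((Complex.re_le_norm _).trans ?_)
    rw [norm_mul]
    have h3 : ‖z - (Real.log q : ℝ)‖ ≤ |z.re| + 1 + Real.log q := by
      refine (norm_sub_le _ _).trans ?_
      rw [Complex.norm_real, Real.norm_of_nonneg hlog]
      have := Complex.norm_le_abs_re_add_abs_im z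
      have h4 : |z.im| < 1 := hz
      linarith
    calc ‖w‖ * ‖z - (Real.log q : ℝ)‖ ≤ p * (|z.re| + 1 + Real.log q) :=
          mul_le_mul (hw.trans hp) h3 (norm_nonneg _) (by positivity)
      _ = _ := by ring
  have h5 := exp_neg_mul_exp_le (a := c / 2 / q) (by positivity) (p + 1) |z.re|
  have h6 : Real.exp (-(c / q * Real.exp |z.re|)) = Real.exp (-(c / 2 / q * Real.exp |z.re|))
      * Real.exp (-(c / 2 / q * Real.exp |z.re|)) := by rw [← Real.exp_add]; ring_nf
  have h7 : (1 / (c / 2 / q)) ^ (p + 1) = (2 / c) ^ (p + 1) * (q : ℝ) ^ (p + 1) := by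
    rw [← mul_pow]; congr 1; field_simp
  have h8 : Real.exp (-(((p + 1 : ℕ) : ℝ) * |z.re|)) = Real.exp (-(p * |z.re|))
      * Real.exp (-|z.re|) := by rw [← Real.exp_add]; push_cast; ring_nf
  rw [h7, h8] at h5
  have h9 : Real.exp (p * |z.re|) * Real.exp (-(p * |z.re|)) = 1 := by
    rw [← Real.exp_add]; simp
  rw [weighted, norm_mul]
  calc _ ≤ (C * (q : ℝ) ^ N * Real.exp (-(c / q * Real.exp |z.re|)))
        * (Real.exp p * (q : ℝ) ^ p * Real.exp (p * |z.re|)) := by gcongr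
    _ = C * (q : ℝ) ^ N * (Real.exp p * (q : ℝ) ^ p * Real.exp (p * |z.re|))
        * Real.exp (-(c / 2 / q * Real.exp |z.re|)) * Real.exp (-(c / 2 / q * Real.exp |z.re|)) := by
        rw [h6]; ring
    _ ≤ C * (q : ℝ) ^ N * (Real.exp p * (q : ℝ) ^ p * Real.exp (p * |z.re|))
        * ((p + 1).factorial * ((2 / c) ^ (p + 1) * (q : ℝ) ^ (p + 1)) * (Real.exp (-(p * |z.re|))
      * Real.exp (-|z.re|))) * Real.exp (-(c / 2 / q * Real.exp |z.re|)) := by gcongr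
    _ = C * Real.exp p * ((p + 1).factorial * (2 / c) ^ (p + 1)) * (q : ℝ) ^ (N + p + (p + 1))
        * Real.exp (-(c / 2 / q * Real.exp |z.re|)) * Real.exp (-|z.re|)
        * (Real.exp (p * |z.re|) * Real.exp (-(p * |z.re|))) := by ring
    _ = _ := by rw [h9, mul_one]

lemma differentiableOn_weighted (D : OrbitData G b φ H adm) {q : ℕ} [NeZero q]
    (χ : DirichletCharacter ℂ q) (w : ℂ) : DifferentiableOn ℂ (weighted b φ χ w) strip := by
  refine DifferentiableOn.mul (DifferentiableOn.const_mul ?_ _) (by fun_prop)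
  refine (differentiableOn_twistSeries D.coeff D.kernel _).comp (by fun_prop) fun z hz => ?_
  simpa only [sub_eq_add_neg, Complex.ofReal_neg] using add_log_mem_strip hz (-Real.log q)

/-- The completed `L`-function, as an integral of orbit sums. -/
def orbitMellin (G : SL(2, ℝ) → ℂ) {q : ℕ} (χ : DirichletCharacter ℂ q) (w : ℂ) : ℂ :=
  ∫ t : ℝ, orbitSum χ G 0 t * Complex.exp (w * t)

lemma orbitMellin_eq (D : OrbitData G b φ H adm) {q : ℕ} [NeZero q] {χ : DirichletCharacter ℂ q}
    (hχ : adm q χ) (w : ℂ) : orbitMellin G χ w = ∫ x : ℝ, weighted b φ χ w x := by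
  simp_rw [D.weighted_ofReal hχ]
  exact (integral_sub_right_eq_self
    (fun t : ℝ => orbitSum χ G 0 t * Complex.exp (w * t)) (Real.log q)).symm

/-- The integral of orbit sums is approximated by a finite sum. -/
theorem exists_quadrature_bound (D : OrbitData G b φ H adm) (w : ℂ) : ∃ c : ℝ, 0 < c ∧
    ∃ (N : ℕ) (C : ℝ), 0 ≤ C ∧ ∀ (q : ℕ) [NeZero q] (χ : DirichletCharacter ℂ q), adm q χ →
      ∀ (h R : ℝ) (M : ℕ), 0 < h → h ≤ 1 → 0 ≤ R → 2 * R ≤ h * M →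
        ‖orbitMellin G χ w - h * ∑ i ∈ Finset.range M,
            orbitSum χ G 0 (-R + h * i - Real.log q)
              * Complex.exp (w * ((-R + h * i - Real.log q : ℝ) : ℂ))‖
          ≤ C * (q : ℝ) ^ N * (Real.exp (-(π / h)) + Real.exp (-(c / q * Real.exp R))) := by
  obtain ⟨c, hc, N, C, hC, hbd⟩ := D.exists_weighted_bound ‖w‖
  refine ⟨c, hc, N, 8 * C, by positivity, fun q _ χ hχ h R M hh hh1 hR hM => ?_⟩
  have hq : (0 : ℝ) < q := by exact_mod_cast NeZero.pos q
  have hg : StripDecay (weighted b φ χ w) (C * (q : ℝ) ^ N) := by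
    refine ⟨D.differentiableOn_weighted χ w, fun z hz => (hbd q χ hχ w le_rfl z hz).trans ?_⟩
    refine mul_le_mul_of_nonneg_right (mul_le_of_le_one_right (by positivity) ?_) (by positivity)
    exact Real.exp_le_one_iff.2 (neg_nonpos.2 (by positivity))
  -- In the tails `|x| ≥ R` the double exponential is frozen at its value at `R`, which becomes the
  -- constant `B'`.
  have := hg.norm_integral_sub_sum_le (h := h) (R := R)
    (B' := C * (q : ℝ) ^ N * Real.exp (-(c / q * Real.exp R))) hh hh1 hR (by positivity)
    (fun x hx => ?_) M hM
  · rw [← D.orbitMellin_eq hχ] at this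
    simp_rw [D.weighted_ofReal hχ] at this
    refine this.trans ?_
    have h1 : 0 ≤ C * (q : ℝ) ^ N * Real.exp (-(c / q * Real.exp R)) := by positivity
    linarith
  · refine (hbd q χ hχ w le_rfl x (ofReal_mem_strip x)).trans ?_
    rw [Complex.ofReal_re]
    gcongr

/-- Differentiation under the integral sign. The new factor `y = x - log q` satisfies `|y| ≤ e^y +
e^{-y}`, so the derivative is dominated by the integrands at `w + 1` and `w - 1`; this is why bounds
are taken up to radius `‖w₀‖ + 2`. -/
lemma differentiable_orbitMellin (D : OrbitData G b φ H adm) {q : ℕ} [NeZero q]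
    {χ : DirichletCharacter ℂ q} (hχ : adm q χ) : Differentiable ℂ (orbitMellin G χ) := by
  intro w₀
  obtain ⟨c, hc, N, C, hC, hbd⟩ := D.exists_weighted_bound (‖w₀‖ + 2)
  have hq : (0 : ℝ) < q := by exact_mod_cast NeZero.pos q
  have hline : ∀ w : ℂ, ‖w‖ ≤ ‖w₀‖ + 2 → ∀ x : ℝ, ‖weighted b φ χ w x‖
      ≤ C * (q : ℝ) ^ N * Real.exp (-|x|) := by
    intro w hw x
    refine (hbd q χ hχ w hw x (ofReal_mem_strip x)).trans ?_
    rw [Complex.ofReal_re]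
    refine mul_le_mul_of_nonneg_right (mul_le_of_le_one_right (by positivity) ?_) (by positivity)
    exact Real.exp_le_one_iff.2 (neg_nonpos.2 (by positivity))
  have hcont : ∀ w : ℂ, Continuous fun x : ℝ => weighted b φ χ w x := fun w =>
    (D.differentiableOn_weighted χ w).continuousOn.comp_continuous (by fun_prop) ofReal_mem_strip
  have heq : orbitMellin G χ = fun w => ∫ x : ℝ, weighted b φ χ w x :=
    funext fun w => D.orbitMellin_eq hχ w
  rw [heq]
  have := hasDerivAt_integral_of_dominated_loc_of_deriv_le (μ := volume) (𝕜 := ℂ)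
    (F := fun w (x : ℝ) => weighted b φ χ w x)
    (F' := fun w (x : ℝ) => weighted b φ χ w x * ((x : ℂ) - (Real.log q : ℝ))) (x₀ := w₀)
    (bound := fun x => 2 * (C * (q : ℝ) ^ N * Real.exp (-|x|))) (s := Metric.ball w₀ 1)
    (Metric.ball_mem_nhds w₀ one_pos)
    (.of_forall fun w => (hcont w).aestronglyMeasurable)
    ((integrable_exp_neg_abs.const_mul _).mono' (hcont w₀).aestronglyMeasurable
      (.of_forall (hline w₀ (by linarith))))
    ((hcont w₀).mul (by fun_prop)).aestronglyMeasurable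
    (.of_forall fun x w hw => ?_) ((integrable_exp_neg_abs.const_mul _).const_mul _)
    (.of_forall fun x w _ => ?_)
  · exact this.2.differentiableAt
  · set y : ℝ := x - Real.log q with hy
    have hyc : (x : ℂ) - (Real.log q : ℝ) = (y : ℂ) := by rw [hy, Complex.ofReal_sub]
    have hw' : ‖w‖ ≤ ‖w₀‖ + 1 := by
      have h1 := norm_sub_norm_le w w₀
      have h2 : ‖w - w₀‖ < 1 := by simpa [dist_eq_norm] using hw
      linarith
    have e : ∀ w : ℂ, weighted b φ χ w x = centred b φ χ x * Complex.exp (w * y) := by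
      intro w; rw [weighted, hyc]
    have h3 : ‖weighted b φ χ w x * y‖ ≤ ‖weighted b φ χ (w + 1) x‖
        + ‖weighted b φ χ (w - 1) x‖ := by
      rw [e, e, e]
      simp only [norm_mul, norm_exp_mul_ofReal, Complex.norm_real, Real.norm_eq_abs]
      rw [mul_assoc, ← mul_add]
      refine mul_le_mul_of_nonneg_left ?_ (norm_nonneg _)
      simp only [Complex.add_re, Complex.sub_re, Complex.one_re]
      rw [add_mul, sub_mul, Real.exp_add, sub_eq_add_neg, Real.exp_add, ← mul_add]
      refine mul_le_mul_of_nonneg_left ?_ (Real.exp_nonneg _)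
      have p1 := Real.add_one_le_exp (1 * y)
      have p2 := Real.add_one_le_exp (-(1 * y))
      have p3 := Real.exp_pos (1 * y)
      have p4 := Real.exp_pos (-(1 * y))
      rcases abs_cases y with hh | hh <;> rw [hh.1] <;> linarith
    rw [hyc]
    have h4 := hline (w + 1) ((norm_add_le _ _).trans (by simpa using by linarith)) x
    have h5 := hline (w - 1) ((norm_sub_le _ _).trans (by simpa using by linarith)) x
    linarith
  · have h1 : HasDerivAt (fun w : ℂ => w * ((x : ℂ) - (Real.log q : ℝ)))
        ((x : ℂ) - (Real.log q : ℝ)) w := by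
      simpa using (hasDerivAt_id w).mul_const ((x : ℂ) - (Real.log q : ℝ))
    have := (h1.cexp).const_mul (centred b φ χ x)
    simpa only [weighted, mul_assoc] using this

/-- The continuation of the twisted Dirichlet series. -/
def continuation (G : SL(2, ℝ) → ℂ) (H : ℂ → ℂ) {q : ℕ} [NeZero q] (χ : DirichletCharacter ℂ q)
    (w : ℂ) : ℂ :=
  H w * orbitMellin G χ⁻¹ w / tau χ⁻¹

lemma differentiable_continuation (D : OrbitData G b φ H adm) {q : ℕ} [NeZero q]
    {χ : DirichletCharacter ℂ q} (hχ : adm q χ) : Differentiable ℂ (continuation G H χ) :=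
  (D.diff.mul (D.differentiable_orbitMellin (D.inv q χ hχ))).div_const _

/-- Far to the right the Mellin transform may be taken term by term, and `H` cancels the transform
of the kernel. The orbit sum of `χ⁻¹` enters because its series carries `χ`. -/
lemma hasSum_continuation (D : OrbitData G b φ H adm) {q : ℕ} [NeZero q]
    {χ : DirichletCharacter ℂ q} (hχ : adm q χ) : ∃ σ : ℝ, ∀ w : ℂ, σ < w.re →
      HasSum (fun n : ℕ+ => b n * χ ((n : ℕ) : ZMod q) / ((n : ℕ) : ℂ) ^ w)
        (continuation G H χ w) := by
  obtain ⟨σ₁, h₁⟩ := hasSum_integral_twistSeries D.coeff D.kernel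
  obtain ⟨σ₂, h₂⟩ := D.mellin
  refine ⟨max σ₁ σ₂, fun w hw => ?_⟩
  have h3 := (h₁ q χ w ((le_max_left _ _).trans_lt hw)).mul_left (H w)
  have h4 := h₂ w ((le_max_right _ _).trans_lt hw)
  have h5 : continuation G H χ w = H w * ∫ t : ℝ, twistSeries b φ χ t * Complex.exp (w * t) := by
    have hinv := D.inv q χ hχ
    have ht := tau_ne_zero (D.prim q _ hinv)
    rw [continuation, orbitMellin]
    simp_rw [D.series q _ hinv, inv_inv, mul_assoc]
    rw [integral_const_mul]
    field_simp
  rw [h5]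
  have h6 : (fun n : ℕ+ => b n * χ ((n : ℕ) : ZMod q) / ((n : ℕ) : ℂ) ^ w) = fun n : ℕ+ =>
      H w * (b n * χ ((n : ℕ) : ZMod q) / ((n : ℕ) : ℂ) ^ w
        * ∫ t : ℝ, φ t * Complex.exp (w * t)) := by
    funext n
    linear_combination (-(b n * χ ((n : ℕ) : ZMod q) / ((n : ℕ) : ℂ) ^ w)) * h4
  rw [h6]
  exact h3

end OrbitData

/-! ### Programs -/

/-- Arithmetic expressions in the registers. -/
inductive Expr
  | var (i : ℕ)
  | lit (a b : ℚ)
  | const (i : Fin 3)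
  | bin (o : BinOp) (e e' : Expr)
  | un (o : UnOp) (e : Expr)

namespace Expr

def eval (c : Fin 3 → ℂ) (m : ℕ → ℂ) : Expr → ℂ
  | var i => m i
  | lit a b => (a : ℂ) + (b : ℂ) * Complex.I
  | const i => c i
  | bin o e e' => o.eval (e.eval c m) (e'.eval c m)
  | un o e => o.eval (e.eval c m)

/-- The operations in the expression are permitted. -/
def Ok (c : Fin 3 → ℂ) (m : ℕ → ℂ) : Expr → Prop
  | var _ => True
  | lit _ _ => True
  | const _ => True
  | bin o e e' => e.Ok c m ∧ e'.Ok c m ∧ o.Ok (e'.eval c m)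
  | un o e => e.Ok c m ∧ o.Ok (e.eval c m)

/-- A program that evaluates the expression on `k` inputs. -/
def compile (k : ℕ) : Expr → Prog
  -- The inputs occupy the registers below `k`, so register `k` still holds `0` and the addition is
  -- a copy.
  | var i => .bin .add 0 i k
  | lit a b => .lit 0 a b
  | const i => .const 0 i
  -- Subexpressions run as calls with fresh memory; their values go to registers past the inputs and
  -- overwrite nothing.
  | bin o e e' => .seq (.call k (e.compile k) (List.range k))
      (.seq (.call (k + 1) (e'.compile k) (List.range k)) (.bin o 0 k (k + 1)))
  | un o e => .seq (.call k (e.compile k) (List.range k)) (.un o 0 k)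

def cost (k : ℕ) : Expr → ℕ
  | var _ => 1
  | lit _ _ => 1
  | const _ => 1
  | bin _ e e' => (e.cost k + k + 1) + ((e'.cost k + k + 1) + 1)
  | un _ e => (e.cost k + k + 1) + 1

lemma map_range_initMem (l : List ℂ) : (List.range l.length).map (initMem l) = l := by
  refine List.ext_getElem (by simp) fun i h1 h2 => ?_
  simp [initMem, h2]

lemma map_range_update (m : ℕ → ℂ) (k d : ℕ) (v : ℂ) (h : k ≤ d) :
    (List.range k).map (Function.update m d v) = (List.range k).map m := by
  refine List.map_congr_left fun i hi => ?_
  have := List.mem_range.1 hi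
  rw [Function.update_of_ne (by omega)]

theorem exec_compile (E : Env) (l : List ℂ) (e : Expr) (h : e.Ok E.c (initMem l)) :
    ∃ m', Exec E (e.compile l.length) (initMem l) m' (e.cost l.length)
      ∧ m' 0 = e.eval E.c (initMem l) := by
  induction e with
  | var i =>
    refine ⟨_, .bin _ .add _ _ _ trivial, ?_⟩
    simp [BinOp.eval, eval, initMem]
  | lit a b => exact ⟨_, .lit _ _ _ _, by simp [eval]⟩
  | const i => exact ⟨_, .const _ _ _, by simp [eval]⟩
  | bin o e e' ih ih' =>
    obtain ⟨m₁, h₁, v₁⟩ := ih h.1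
    obtain ⟨m₂, h₂, v₂⟩ := ih' h.2.1
    have c₁ := Exec.call (E := E) (initMem l) m₁ l.length (e.compile l.length)
      (List.range l.length) _ (by rw [map_range_initMem]; exact h₁)
    have c₂ := Exec.call (E := E) (Function.update (initMem l) l.length (m₁ 0)) m₂ (l.length + 1)
      (e'.compile l.length) (List.range l.length) _
      (by rw [map_range_update _ _ _ _ le_rfl, map_range_initMem]; exact h₂)
    rw [List.length_range] at c₁ c₂
    refine ⟨_, .seq _ _ _ _ _ _ _ c₁ (.seq _ _ _ _ _ _ _ c₂ (.bin _ o _ _ _ ?_)), ?_⟩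
    · simpa [v₂] using h.2.2
    · simp [eval, v₁, v₂]
  | un o e ih =>
    obtain ⟨m₁, h₁, v₁⟩ := ih h.1
    have c₁ := Exec.call (E := E) (initMem l) m₁ l.length (e.compile l.length)
      (List.range l.length) _ (by rw [map_range_initMem]; exact h₁)
    rw [List.length_range] at c₁
    refine ⟨_, .seq _ _ _ _ _ _ _ c₁ (.un _ o _ _ ?_), ?_⟩
    · simpa [v₁] using h.2
    · simp [eval, v₁]

end Expr

/-- Started with memory `m`, the program `p` halts after at most `n` operations, with a memory
that satisfies `Q`. -/
def Steps (E : Env) (p : Prog) (m : ℕ → ℂ) (Q : (ℕ → ℂ) → Prop) (n : ℕ) : Prop :=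
  ∃ m' n', Exec E p m m' n' ∧ n' ≤ n ∧ Q m'

lemma Steps.seq {E : Env} {p p' : Prog} {m : ℕ → ℂ} {Q Q' : (ℕ → ℂ) → Prop} {n n' : ℕ}
    (h : Steps E p m Q n) (h' : ∀ m', Q m' → Steps E p' m' Q' n') :
    Steps E (.seq p p') m Q' (n + n') := by
  obtain ⟨m₁, n₁, e₁, l₁, q₁⟩ := h
  obtain ⟨m₂, n₂, e₂, l₂, q₂⟩ := h' m₁ q₁
  exact ⟨m₂, n₁ + n₂, .seq _ _ _ _ _ _ _ e₁ e₂, by omega, q₂⟩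

/-- The first `k` registers. -/
def firstRegs (k : ℕ) (m : ℕ → ℂ) : ℕ → ℂ := initMem ((List.range k).map m)

lemma firstRegs_apply {k i : ℕ} (h : i < k) (m : ℕ → ℂ) : firstRegs k m i = m i := by
  simp [firstRegs, initMem, h]

/-- `m[d] := e(m[0], …, m[k - 1])`. -/
def assign (k d : ℕ) (e : Expr) : Prog := .call d (e.compile k) (List.range k)

lemma steps_assign (E : Env) (k d : ℕ) (e : Expr) (m : ℕ → ℂ) {v : ℂ}
    (h : e.Ok E.c (firstRegs k m)) (hv : e.eval E.c (firstRegs k m) = v) :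
    Steps E (assign k d e) m (fun m' => m' = Function.update m d v) (e.cost k + k + 1) := by
  obtain ⟨m', h', v'⟩ := Expr.exec_compile E ((List.range k).map m) e h
  simp only [List.length_map, List.length_range] at h'
  have := Exec.call (E := E) m m' d (e.compile k) (List.range k) _ h'
  rw [List.length_range] at this
  exact ⟨_, _, this, le_rfl, by rw [v', ← hv]; rfl⟩

abbrev Expr.log (e : Expr) : Expr := .un .log e
abbrev Expr.exp (e : Expr) : Expr := .un .exp e
abbrev Expr.add (e e' : Expr) : Expr := .bin .add e e'
abbrev Expr.sub (e e' : Expr) : Expr := .bin .sub e e'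
abbrev Expr.mul (e e' : Expr) : Expr := .bin .mul e e'
abbrev Expr.div (e e' : Expr) : Expr := .bin .div e e'
abbrev Expr.nat (n : ℕ) : Expr := .lit n 0

/-! ### The quadrature program and its cost -/

section quadrature

variable (K₁ K₂ : ℕ) (P : Prog) (e : Expr)

/-- `1 + log q`. -/
def ellExpr : Expr := .add (.nat 1) (.log (.var 0))

/-- The body of the loop. The registers are: `0` the modulus, `1` the cutoff `R`, `2` the step `h`,
`3` the counter, `4` the partial sum, `5` the bound for the counter, `6` the node and `7` the value
of the orbit sum at the node. -/
def quadratureBody : Prog :=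
  .seq (assign 8 6 (.sub (.sub (.mul (.var 2) (.var 3)) (.var 1)) (.log (.var 0))))
  (.seq (.call 7 P [0, 6])
  (.seq (assign 8 4 (.add (.var 4)
      (.mul (.exp (.mul (.sub (.const 0) (.lit (1 / 2) 0)) (.var 6))) (.var 7))))
    (assign 8 3 (.add (.var 3) (.nat 1)))))

/-- The trapezoidal rule, with the final result multiplied by the value of `e`. -/
def quadrature : Prog :=
  .seq (assign 8 1 (.add (.log (.var 0)) (.log (.mul (.nat K₂) ellExpr))))
  (.seq (assign 8 2 (.div (.nat 1) (.mul (.nat K₁) ellExpr)))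
  (.seq (assign 8 5 (.div (.mul (.nat 2) (.var 1)) (.var 2)))
  (.seq (.loop 3 5 (quadratureBody P))
    (assign 8 0 (.mul e (.mul (.var 2) (.var 4)))))))

/-- The cost of an iteration, apart from the call of `P`. -/
def bodyCost : ℕ :=
  ((Expr.sub (.sub (.mul (.var 2) (.var 3)) (.var 1)) (.log (.var 0))).cost 8 + 8 + 1)
  + (3 + (((Expr.add (.var 4)
      (.mul (.exp (.mul (.sub (.const 0) (.lit (1 / 2) 0)) (.var 6))) (.var 7))).cost 8
      + 8 + 1) + ((Expr.add (.var 3) (.nat 1)).cost 8 + 8 + 1)))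

/-- The invariant of the loop. -/
structure LoopInv (q R h bnd : ℝ) (term : ℕ → ℂ) (j : ℕ) (m : ℕ → ℂ) : Prop where
  r0 : m 0 = q
  r1 : m 1 = R
  r2 : m 2 = h
  r3 : m 3 = j
  r4 : m 4 = ∑ i ∈ Finset.range j, term i
  r5 : m 5 = bnd

variable {P}

lemma steps_quadratureBody {E : Env} {q R h bnd : ℝ} {v : ℕ → ℂ} {n : ℕ} {j : ℕ} (hq : 0 < q)
    (hP : ∃ m' n', Exec E P (initMem [(q : ℂ), ((h * j - R - Real.log q : ℝ) : ℂ)]) m' n' ∧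
      n' ≤ n ∧ m' 0 = v j) {m : ℕ → ℂ}
    (hm : LoopInv q R h bnd (fun i => Complex.exp ((E.c 0 - 1 / 2)
      * ((h * i - R - Real.log q : ℝ) : ℂ)) * v i) j m) :
    Steps E (quadratureBody P) m (LoopInv q R h bnd (fun i => Complex.exp ((E.c 0 - 1 / 2)
      * ((h * i - R - Real.log q : ℝ) : ℂ)) * v i) (j + 1)) (n + bodyCost) := by
  have hslit : (q : ℂ) ∈ Complex.slitPlane := Complex.ofReal_mem_slitPlane.2 hq
  have hlog : Complex.log q = (Real.log q : ℝ) := (Complex.ofReal_log hq.le).symm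
  obtain ⟨m₀, n₀, he₀, hn₀, hv₀⟩ := hP
  set t : ℝ := h * j - R - Real.log q with ht
  rw [bodyCost, ← add_assoc, add_comm n, add_assoc, ← add_assoc n, quadratureBody]
  refine Steps.seq (steps_assign E 8 6 _ m (v := (t : ℂ)) ?_ ?_) ?_
  · simp [Expr.Ok, BinOp.Ok, UnOp.Ok, Expr.eval, firstRegs_apply, hm.r0, hslit]
  · simp [Expr.eval, BinOp.eval, UnOp.eval, firstRegs_apply, hm.r0, hm.r1, hm.r2, hm.r3, hlog, ht]
  rintro _ rfl
  refine Steps.seq (Q := fun m' => m' = Function.update (Function.update m 6 (t : ℂ)) 7 (v j))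
    ⟨_, _, .call _ m₀ 7 P [0, 6] n₀ ?_, by simp; omega, by rw [hv₀]⟩ ?_
  · simpa [hm.r0] using he₀
  rintro _ rfl
  refine Steps.seq (steps_assign E 8 4 _ _ (v := ∑ i ∈ Finset.range (j + 1),
    Complex.exp ((E.c 0 - 1 / 2) * ((h * i - R - Real.log q : ℝ) : ℂ)) * v i) ?_ ?_) ?_
  · simp [Expr.Ok, BinOp.Ok, UnOp.Ok]
  · rw [Finset.sum_range_succ, ← ht]
    simp [Expr.eval, BinOp.eval, UnOp.eval, firstRegs_apply, hm.r4]
  rintro _ rfl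
  obtain ⟨m', n', h1, h2, rfl⟩ := steps_assign E 8 3 (.add (.var 3) (.nat 1))
    (Function.update (Function.update (Function.update m 6 (t : ℂ)) 7 (v j)) 4
    (∑ i ∈ Finset.range (j + 1),
      Complex.exp ((E.c 0 - 1 / 2) * ((h * i - R - Real.log q : ℝ) : ℂ)) * v i))
    (v := ((j + 1 : ℕ) : ℂ)) (by simp [Expr.Ok, BinOp.Ok])
    (by simp [Expr.eval, BinOp.eval, firstRegs_apply, hm.r3])
  refine ⟨_, n', h1, h2, ?_⟩
  constructor <;> simp [hm.r0, hm.r1, hm.r2, hm.r5]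

/-- Induction on the number `k` of remaining iterations, because the semantics of a loop unrolls it
from the front. -/
lemma steps_loop {E : Env} {q R h bnd : ℝ} {v : ℕ → ℂ} {n M : ℕ} (hq : 0 < q)
    (hM : ∀ j : ℕ, (j : ℝ) ≤ bnd ↔ j < M)
    (hP : ∀ j < M, ∃ m' n', Exec E P (initMem [(q : ℂ), ((h * j - R - Real.log q : ℝ) : ℂ)]) m' n' ∧
      n' ≤ n ∧ m' 0 = v j) (k : ℕ) :
    ∀ (j : ℕ), j + k = M → ∀ m : ℕ → ℂ, LoopInv q R h bnd (fun i => Complex.exp ((E.c 0 - 1 / 2)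
      * ((h * i - R - Real.log q : ℝ) : ℂ)) * v i) j m →
    Steps E (.loop 3 5 (quadratureBody P)) m (LoopInv q R h bnd (fun i => Complex.exp
      ((E.c 0 - 1 / 2) * ((h * i - R - Real.log q : ℝ) : ℂ)) * v i) M)
      (k * (n + bodyCost + 1) + 1) := by
  induction k with
  | zero =>
    intro j hj m hm
    obtain rfl : j = M := by omega
    refine ⟨m, 1, .loopFalse _ _ _ _ ?_, by omega, hm⟩
    rw [hm.r3, hm.r5, Complex.natCast_re, Complex.ofReal_re, hM]
    exact lt_irrefl _
  | succ k ih =>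
    intro j hj m hm
    obtain ⟨m₁, n₁, e₁, l₁, q₁⟩ := steps_quadratureBody hq (hP j (by omega)) hm
    obtain ⟨m₂, n₂, e₂, l₂, q₂⟩ := ih (j + 1) (by omega) m₁ q₁
    refine ⟨m₂, _, .loopTrue _ _ _ _ _ _ _ _ ?_ e₁ e₂, ?_, q₂⟩
    · rw [hm.r3, hm.r5, Complex.natCast_re, Complex.ofReal_re, hM]
      omega
    · rw [Nat.succ_mul]; omega

/-- The cost of the quadrature program, apart from the loop. -/
def frameCost : ℕ :=
  ((Expr.add (.log (.var 0)) (.log (.mul (.nat K₂) ellExpr))).cost 8 + 8 + 1)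
  + (((Expr.div (.nat 1) (.mul (.nat K₁) ellExpr)).cost 8 + 8 + 1)
  + (((Expr.div (.mul (.nat 2) (.var 1)) (.var 2)).cost 8 + 8 + 1)
  + (1 + ((Expr.mul e (.mul (.var 2) (.var 4))).cost 8 + 8 + 1))))

/-- Here `v j` is whatever `P` returns at the `j`-th node. The run is exact in terms of `v`, so that
accuracy can be treated separately. -/
theorem exec_quadrature {E : Env} {K₁ K₂ : ℕ} (hK₁ : 0 < K₁) (hK₂ : 0 < K₂) {q R h : ℝ}
    {v : ℕ → ℂ} {n M : ℕ} {a : ℂ} (hq : 1 ≤ q) (hR : R = Real.log q + Real.log (K₂ * (1 + Real.log q)))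
    (hh : h = 1 / (K₁ * (1 + Real.log q)))
    (hM : ∀ j : ℕ, (j : ℝ) ≤ 2 * R / h ↔ j < M) (he : ∀ m, e.Ok E.c m ∧ e.eval E.c m = a)
    (hP : ∀ j < M, ∃ m' n', Exec E P (initMem [(q : ℂ), ((h * j - R - Real.log q : ℝ) : ℂ)]) m' n' ∧
      n' ≤ n ∧ m' 0 = v j) :
    ∃ m' n', Exec E (quadrature K₁ K₂ P e) (initMem [(q : ℂ)]) m' n' ∧
      n' ≤ M * (n + bodyCost + 1) + frameCost K₁ K₂ e ∧
      m' 0 = a * (h * ∑ i ∈ Finset.range M, Complex.exp ((E.c 0 - 1 / 2)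
        * ((h * i - R - Real.log q : ℝ) : ℂ)) * v i) := by
  have hq0 : 0 < q := by linarith
  have hl : 0 ≤ Real.log q := Real.log_nonneg hq
  have hslit : (q : ℂ) ∈ Complex.slitPlane := Complex.ofReal_mem_slitPlane.2 hq0
  have hlog : Complex.log q = (Real.log q : ℝ) := (Complex.ofReal_log hq0.le).symm
  have hK₁' : (0 : ℝ) < K₁ := by exact_mod_cast hK₁
  have hK₂' : (0 : ℝ) < K₂ := by exact_mod_cast hK₂
  have hx : (0 : ℝ) < K₂ * (1 + Real.log q) := by positivity
  have hxc : (K₂ : ℂ) * (1 + (Real.log q : ℝ)) = ((K₂ * (1 + Real.log q) : ℝ) : ℂ) := by push_cast; rfl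
  have hslit2 : (K₂ : ℂ) * (1 + (Real.log q : ℝ)) ∈ Complex.slitPlane := by
    rw [hxc]; exact Complex.ofReal_mem_slitPlane.2 hx
  have hlog2 : Complex.log ((K₂ : ℂ) * (1 + (Real.log q : ℝ)))
      = (Real.log (K₂ * (1 + Real.log q)) : ℝ) := by
    rw [hxc]; exact (Complex.ofReal_log hx.le).symm
  have hh0 : 0 < h := by rw [hh]; positivity
  have hhc : (h : ℂ) ≠ 0 := by exact_mod_cast hh0.ne'
  have hell : (K₁ : ℂ) * (1 + (Real.log q : ℝ)) ≠ 0 := by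
    have : (0 : ℝ) < K₁ * (1 + Real.log q) := by positivity
    exact_mod_cast this.ne'
  have main : Steps E (quadrature K₁ K₂ P e) (initMem [(q : ℂ)]) (fun m' =>
      m' 0 = a * (h * ∑ i ∈ Finset.range M, Complex.exp ((E.c 0 - 1 / 2)
        * ((h * i - R - Real.log q : ℝ) : ℂ)) * v i))
      (((Expr.add (.log (.var 0)) (.log (.mul (.nat K₂) ellExpr))).cost 8 + 8 + 1)
        + (((Expr.div (.nat 1) (.mul (.nat K₁) ellExpr)).cost 8 + 8 + 1)
        + (((Expr.div (.mul (.nat 2) (.var 1)) (.var 2)).cost 8 + 8 + 1)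
        + ((M * (n + bodyCost + 1) + 1)
          + ((Expr.mul e (.mul (.var 2) (.var 4))).cost 8 + 8 + 1))))) := by
    refine Steps.seq (steps_assign E 8 1 _ _ (v := (R : ℂ)) ?_ ?_) ?_
    · simpa [Expr.Ok, BinOp.Ok, UnOp.Ok, Expr.eval, BinOp.eval, UnOp.eval, ellExpr,
        firstRegs_apply, initMem, hslit, hlog] using hslit2
    · simp [Expr.eval, BinOp.eval, UnOp.eval, ellExpr, firstRegs_apply, initMem, hlog, hR]
      simpa using hlog2
    rintro _ rfl
    refine Steps.seq (steps_assign E 8 2 _ _ (v := (h : ℂ)) ?_ ?_) ?_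
    · simpa [Expr.Ok, BinOp.Ok, UnOp.Ok, Expr.eval, BinOp.eval, UnOp.eval, ellExpr,
        firstRegs_apply, initMem, hslit, hlog] using hell
    · simp [Expr.eval, BinOp.eval, UnOp.eval, ellExpr, firstRegs_apply, initMem, hlog, hh]
    rintro _ rfl
    refine Steps.seq (steps_assign E 8 5 _ _ (v := ((2 * R / h : ℝ) : ℂ)) ?_ ?_) ?_
    · simpa [Expr.Ok, BinOp.Ok, UnOp.Ok, Expr.eval, firstRegs_apply] using hhc
    · simp [Expr.eval, BinOp.eval, firstRegs_apply]
    rintro _ rfl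
    refine Steps.seq (steps_loop hq0 hM hP M 0 (by omega) _ ?_) ?_
    · constructor <;> simp [initMem]
    intro m hm
    obtain ⟨m', n', h1, h2, rfl⟩ := steps_assign E 8 0 (.mul e (.mul (.var 2) (.var 4))) m
      (v := a * (h * ∑ i ∈ Finset.range M, Complex.exp ((E.c 0 - 1 / 2)
        * ((h * i - R - Real.log q : ℝ) : ℂ)) * v i))
      (by simpa [Expr.Ok, BinOp.Ok] using (he _).1)
      (by simp [Expr.eval, BinOp.eval, firstRegs_apply, hm.r2, hm.r4, (he _).2])
    exact ⟨_, n', h1, h2, by simp⟩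
  obtain ⟨m', n', h1, h2, h3⟩ := main
  refine ⟨m', n', h1, ?_, h3⟩
  rw [frameCost]
  omega

end quadrature

/-! ### The reduction -/

/-- From `1 + x ≤ e^x` with `x = (ε / m) log q`. Every power of `log q` in the time and in the error
is exchanged for `q ^ ε` in this way, with a loss polynomial in `1 / ε`. -/
lemma one_add_log_pow_le {q ε : ℝ} (hq : 1 ≤ q) (hε : 0 < ε) (hε1 : ε ≤ 1) {m : ℕ} (hm : 1 ≤ m) :
    (1 + Real.log q) ^ m ≤ (m / ε) ^ m * q ^ ε := by
  have hm0 : (1 : ℝ) ≤ m := by exact_mod_cast hm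
  have hl : 0 ≤ Real.log q := Real.log_nonneg hq
  have h1 : 1 + Real.log q ≤ m / ε * Real.exp (ε / m * Real.log q) := by
    have h2 := Real.add_one_le_exp (ε / m * Real.log q)
    have h3 : 1 ≤ m / ε := by rw [le_div_iff₀ hε]; linarith
    calc 1 + Real.log q ≤ m / ε + Real.log q := by linarith
      _ = m / ε * (ε / m * Real.log q + 1) := by field_simp; ring
      _ ≤ _ := by gcongr
  calc (1 + Real.log q) ^ m ≤ (m / ε * Real.exp (ε / m * Real.log q)) ^ m := by gcongr
    _ = (m / ε) ^ m * q ^ ε := by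
      rw [mul_pow, ← Real.exp_nat_mul, Real.rpow_def_of_pos (by linarith)]
      congr 2
      field_simp

/-- The discretization and truncation errors. -/
lemma quadrature_error_le {c C q γ : ℝ} {N K₁ K₂ : ℕ} (hc : 0 < c) (hC : 0 ≤ C) (hq : 1 ≤ q)
    (hK₁ : N + γ ≤ K₁) (hK₂ : (N + γ) / c ≤ K₂) :
    C * q ^ N * (Real.exp (-(π * (K₁ * (1 + Real.log q))))
      + Real.exp (-(c * (K₂ * (1 + Real.log q))))) ≤ 2 * C * q ^ (-γ) := by
  have hl : 0 ≤ Real.log q := Real.log_nonneg hq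
  have hq0 : 0 < q := by linarith
  have e1 : q ^ N * Real.exp (-((N + γ) * Real.log q)) = q ^ (-γ) := by
    rw [Real.rpow_def_of_pos hq0, ← Real.rpow_natCast, Real.rpow_def_of_pos hq0, ← Real.exp_add]
    ring_nf
  have h1 : Real.exp (-(π * (K₁ * (1 + Real.log q)))) ≤ Real.exp (-((N + γ) * Real.log q)) := by
    refine Real.exp_le_exp.2 (neg_le_neg ?_)
    calc (N + γ) * Real.log q ≤ K₁ * (1 + Real.log q) := by gcongr; linarith
      _ ≤ π * (K₁ * (1 + Real.log q)) :=
        le_mul_of_one_le_left (by positivity) (by linarith [Real.pi_gt_three])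
  have h2 : Real.exp (-(c * (K₂ * (1 + Real.log q)))) ≤ Real.exp (-((N + γ) * Real.log q)) := by
    refine Real.exp_le_exp.2 (neg_le_neg ?_)
    rw [div_le_iff₀ hc] at hK₂
    calc (N + γ) * Real.log q ≤ (K₂ * c) * (1 + Real.log q) := by gcongr; linarith
      _ = _ := by ring
  calc _ ≤ C * q ^ N * (Real.exp (-((N + γ) * Real.log q))
        + Real.exp (-((N + γ) * Real.log q))) := by gcongr
    _ = 2 * C * (q ^ N * Real.exp (-((N + γ) * Real.log q))) := by ring
    _ = _ := by rw [e1]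

/-- The weights at the nodes. -/
lemma norm_weight_le {s : ℂ} {q y t : ℝ} {p : ℕ} (hq : 1 ≤ q) (hy : 1 ≤ y)
    (hp : |s.re - 1 / 2| ≤ p) (ht1 : -(2 * Real.log q + Real.log y) ≤ t) (ht2 : t ≤ Real.log y) :
    ‖Complex.exp ((s - 1 / 2) * t)‖ ≤ y ^ p * q ^ max 0 (1 - 2 * s.re) := by
  have hl : 0 ≤ Real.log q := Real.log_nonneg hq
  have hly : 0 ≤ Real.log y := Real.log_nonneg hy
  have hre : (s - 1 / 2).re = s.re - 1 / 2 := by simp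
  rw [norm_exp_mul_ofReal, hre]
  have e1 : y ^ p = Real.exp (p * Real.log y) := by
    rw [Real.exp_nat_mul, Real.exp_log (by linarith)]
  rw [e1, Real.rpow_def_of_pos (by linarith), ← Real.exp_add]
  refine Real.exp_le_exp.2 ?_
  -- For `Re s ≥ 1/2` the weight is largest at the right end, of size a power of `y`. Otherwise it
  -- is largest at the left end near `-2 log q`, and this produces `q ^ (1 - 2 Re s)`.
  rcases le_total 0 (s.re - 1 / 2) with h | h
  · rw [abs_of_nonneg h] at hp
    have h1 : 0 ≤ Real.log q * max 0 (1 - 2 * s.re) := mul_nonneg hl (le_max_left _ _)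
    have h2 : (s.re - 1 / 2) * t ≤ (s.re - 1 / 2) * Real.log y := by gcongr
    have h3 : (s.re - 1 / 2) * Real.log y ≤ p * Real.log y := by gcongr
    linarith
  · rw [abs_of_nonpos h] at hp
    rw [max_eq_right (by linarith)]
    have h2 : -(s.re - 1 / 2) * -t ≤ -(s.re - 1 / 2) * (2 * Real.log q + Real.log y) :=
      mul_le_mul_of_nonneg_left (by linarith) (by linarith)
    have h3 : -(s.re - 1 / 2) * Real.log y ≤ p * Real.log y := by gcongr
    nlinarith

/-- This forces the time bound `D` to be at least `1`, so that constant overheads can be absorbed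
into it. -/
lemma Exec.one_le {E : Env} {p : Prog} {m m' : ℕ → ℂ} {n : ℕ} (h : Exec E p m m' n) : 1 ≤ n := by
  induction h <;> omega

/-- A literal costs one operation whatever its size, so the overhead does not depend on `K₁` and
`K₂`, hence not on `γ` and `ε`. -/
lemma exists_quadrature_cost (e : Expr) : ∃ c₁ c₂ : ℕ, ∀ {E : Env} {P : Prog} {K₁ K₂ : ℕ},
    0 < K₁ → 0 < K₂ → ∀ {q R h : ℝ} {v : ℕ → ℂ} {n M : ℕ} {a : ℂ}, 1 ≤ q →
    R = Real.log q + Real.log (K₂ * (1 + Real.log q)) → h = 1 / (K₁ * (1 + Real.log q)) →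
    (∀ j : ℕ, (j : ℝ) ≤ 2 * R / h ↔ j < M) → (∀ m, e.Ok E.c m ∧ e.eval E.c m = a) →
    (∀ j < M, ∃ m' n', Exec E P (initMem [(q : ℂ), ((h * j - R - Real.log q : ℝ) : ℂ)]) m' n' ∧
      n' ≤ n ∧ m' 0 = v j) →
    ∃ m' n', Exec E (quadrature K₁ K₂ P e) (initMem [(q : ℂ)]) m' n' ∧
      n' ≤ M * (n + c₁) + c₂ ∧
      m' 0 = a * (h * ∑ i ∈ Finset.range M, Complex.exp ((E.c 0 - 1 / 2)
        * ((h * i - R - Real.log q : ℝ) : ℂ)) * v i) := by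
  refine ⟨bodyCost + 1, frameCost 0 0 e, ?_⟩
  intro E P K₁ K₂ hK₁ hK₂ q R h v n M a hq hR hh hM he hP
  exact exec_quadrature e hK₁ hK₂ hq hR hh hM he hP

/-- The running time of the reduction. -/
lemma quadrature_time_le {X κ κ' W D ℓ q ε K₁ K₂ M n c₁ c₂ : ℝ} (hX : 1 ≤ X) (hD : 1 ≤ D)
    (hn : n ≤ D) (hc₁ : 0 ≤ c₁) (hc₂ : 0 ≤ c₂) (hW : W = c₁ + c₂ + 1) (hM1 : 1 ≤ M)
    (hM : M ≤ 5 * (K₁ * ℓ) * (K₂ * ℓ)) (hK₂ : 0 ≤ K₂) (hκ : K₁ ≤ κ * X)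
    (hκ' : K₂ ≤ κ' * X) (hℓ : ℓ ^ 2 ≤ 4 * X ^ 2 * q ^ ε) (hκ0 : 0 ≤ κ) (hκ0' : 0 ≤ κ') :
    M * (n + c₁) + c₂ ≤ 5 * κ * κ' * W * 4 * X ^ 4 * D * q ^ ε := by
  have h2 : (n + c₁) + c₂ ≤ W * D := by rw [hW]; nlinarith
  have h3 : c₂ ≤ M * c₂ := le_mul_of_one_le_left hc₂ hM1
  have hW0 : 0 ≤ W := by rw [hW]; positivity
  calc M * (n + c₁) + c₂ ≤ M * (n + c₁) + M * c₂ := by linarith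
    _ = M * ((n + c₁) + c₂) := by ring
    _ ≤ M * (W * D) := by gcongr
    _ ≤ 5 * (K₁ * ℓ) * (K₂ * ℓ) * (W * D) := by gcongr
    _ = 5 * K₁ * K₂ * W * D * ℓ ^ 2 := by ring
    _ ≤ 5 * (κ * X) * (κ' * X) * W * D * (4 * X ^ 2 * q ^ ε) := by gcongr
    _ = _ := by ring

/-- The effect of the errors in the orbit sums. -/
lemma input_error_le {C₀ q γ ε ℓ K κ X : ℝ} {p : ℕ} (hC₀ : 0 ≤ C₀) (hq : 0 < q) (hK : 0 ≤ K)
    (hκ : K ≤ κ * X) (hℓ0 : 0 ≤ ℓ)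
    (hℓ : ℓ ^ (p + 1) ≤ (((p + 1 : ℕ) : ℝ) * X) ^ (p + 1) * q ^ ε) :
    5 * (K * ℓ) ^ (p + 1) * (C₀ * q ^ (-(γ + ε)))
      ≤ 5 * κ ^ (p + 1) * ((p + 1 : ℕ) : ℝ) ^ (p + 1) * X ^ (2 * (p + 1)) * C₀ * q ^ (-γ) := by
  have h2 : q ^ ε * q ^ (-(γ + ε)) = q ^ (-γ) := by
    rw [← Real.rpow_add hq]; ring_nf
  calc _ = 5 * K ^ (p + 1) * ℓ ^ (p + 1) * (C₀ * q ^ (-(γ + ε))) := by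
        rw [mul_pow]; ring
    _ ≤ 5 * (κ * X) ^ (p + 1) * ((((p + 1 : ℕ) : ℝ) * X) ^ (p + 1) * q ^ ε)
        * (C₀ * q ^ (-(γ + ε))) := by
        have : 0 ≤ κ * X := hK.trans hκ
        gcongr
    _ = 5 * κ ^ (p + 1) * ((p + 1 : ℕ) : ℝ) ^ (p + 1) * X ^ (2 * (p + 1)) * C₀
        * (q ^ ε * q ^ (-(γ + ε))) := by
        rw [mul_pow, mul_pow]; ring
    _ = _ := by rw [h2]

/-- A weighted sum of approximate values. -/
lemma norm_weighted_sum_sub_le {h w δ : ℝ} {M : ℕ} {z v S : ℕ → ℂ} (hh : 0 ≤ h) (hw : 0 ≤ w)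
    (hz : ∀ i < M, ‖z i‖ ≤ w) (hv : ∀ i < M, ‖v i - S i‖ ≤ δ) :
    ‖(h : ℂ) * ∑ i ∈ Finset.range M, z i * v i - h * ∑ i ∈ Finset.range M, S i * z i‖
      ≤ h * M * (w * δ) := by
  rw [← mul_sub, ← Finset.sum_sub_distrib, norm_mul, Complex.norm_real, Real.norm_of_nonneg hh,
    mul_assoc]
  refine mul_le_mul_of_nonneg_left ?_ hh
  refine (norm_sum_le_of_le _ (fun i hi => (?_ : _ ≤ w * δ))).trans_eq (by simp)
  have hi' := Finset.mem_range.1 hi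
  rw [mul_comm (S i), ← mul_sub, norm_mul]
  exact mul_le_mul (hz i hi') (hv i hi') (norm_nonneg _) hw

-- The step is `1 / (K₁ ℓ)` and the cutoff satisfies `e^R = q K₂ ℓ`, with `ℓ = 1 + log q`. As `K₁ ≥
-- N + γ` and `K₂ ≥ (N + γ) / c₀`, both quadrature errors gain `q ^ (-(N + γ))` against the loss `q
-- ^ N`. The input errors are added up with the weights, and the time is the number of nodes times
-- the cost of one iteration.
set_option maxHeartbeats 1000000 in
theorem OrbitData.reducesToOrbitSums {F G : SL(2, ℝ) → ℂ} {c : Fin 3 → ℂ} {s : ℂ}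
    {adm : ∀ q : ℕ, DirichletCharacter ℂ q → Prop} {L : ∀ q : ℕ, DirichletCharacter ℂ q → ℂ}
    {b : ℕ → ℂ} {φ H : ℂ → ℂ} (D : OrbitData G b φ H adm) (hc : c 0 = s) (e : Expr)
    (he : ∀ m, e.Ok c m ∧ e.eval c m = H (s - 1 / 2))
    (hL : ∀ (q : ℕ) [NeZero q] (χ : DirichletCharacter ℂ q), adm q χ →
      tau χ * L q χ = H (s - 1 / 2) * OrbitData.orbitMellin G χ (s - 1 / 2)) :
    ReducesToOrbitSums F G c s adm L := by
  obtain ⟨c₀, hc₀, N, C, hC, hquad⟩ := D.exists_quadrature_bound (s - 1 / 2)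
  obtain ⟨p, hp⟩ := exists_nat_ge |s.re - 1 / 2|
  obtain ⟨c₁, c₂, hcost⟩ := exists_quadrature_cost e
  generalize H (s - 1 / 2) = a at he hL
  obtain ⟨κ, hκ⟩ : ∃ κ : ℝ, κ = (N + 1) / c₀ + 2 := ⟨_, rfl⟩
  have hκ0 : 0 < κ := by rw [hκ]; positivity
  obtain ⟨W, hW⟩ : ∃ W : ℝ, W = c₁ + c₂ + 1 := ⟨_, rfl⟩
  obtain ⟨A₁, hA₁⟩ : ∃ A : ℝ, A = ‖a‖ * (2 * C) := ⟨_, rfl⟩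
  obtain ⟨A₂, hA₂⟩ : ∃ A : ℝ, A = ‖a‖ * (5 * κ ^ (p + 1) * ((p + 1 : ℕ) : ℝ) ^ (p + 1)) := ⟨_, rfl⟩
  obtain ⟨A₃, hA₃⟩ : ∃ A : ℝ, A = 5 * (N + 3) * κ * W * 4 := ⟨_, rfl⟩
  have hW0 : 0 ≤ W := by rw [hW]; positivity
  have hA₁0 : 0 ≤ A₁ := by rw [hA₁]; positivity
  have hA₂0 : 0 ≤ A₂ := by rw [hA₂]; positivity
  have hA₃0 : 0 ≤ A₃ := by rw [hA₃]; positivity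
  -- The summands serve the range `T` (`κ`), the quadrature error (`A₁`), the input error (`A₂`) and
  -- the time (`A₃`). In the exponent, `2 (p + 1)` comes from the input error and `4` from the time.
  refine ⟨3 + κ + A₁ + A₂ + A₃, 2 * (p + 1) + 4, fun γ ε hγ hε hε1 => ?_⟩
  obtain ⟨X, hX⟩ : ∃ X : ℝ, X = (1 + γ) / ε := ⟨_, rfl⟩
  rw [← hX]
  have hXγ : 1 + γ ≤ X := by rw [hX, le_div_iff₀ hε]; nlinarith
  have hXε : 1 / ε ≤ X := by rw [hX]; gcongr; linarith
  have hX1 : 1 ≤ X := by linarith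
  obtain ⟨K₁, hK₁⟩ : ∃ K₁ : ℕ, K₁ = ⌈N + γ⌉₊ + 1 := ⟨_, rfl⟩
  obtain ⟨K₂, hK₂⟩ : ∃ K₂ : ℕ, K₂ = ⌈(N + γ) / c₀⌉₊ + 1 := ⟨_, rfl⟩
  have hNγ : 0 ≤ N + γ := by positivity
  have hNγX : N + γ ≤ (N + 1) * X := by nlinarith [Nat.cast_nonneg (α := ℝ) N]
  have hK₁l : N + γ ≤ K₁ := by
    rw [hK₁]; push_cast; linarith [Nat.le_ceil (N + γ)]
  have hK₂l : (N + γ) / c₀ ≤ K₂ := by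
    rw [hK₂]; push_cast; linarith [Nat.le_ceil ((N + γ) / c₀)]
  have hK₁u : (K₁ : ℝ) ≤ (N + 3) * X := by
    rw [hK₁]; push_cast; linarith [Nat.ceil_lt_add_one hNγ]
  have hK₂u : (K₂ : ℝ) ≤ κ * X := by
    have h1 := Nat.ceil_lt_add_one (a := (N + γ) / c₀) (by positivity)
    have h2 : (N + γ) / c₀ ≤ (N + 1) / c₀ * X := by
      rw [div_mul_eq_mul_div]; gcongr
    rw [hK₂, hκ]; push_cast; linarith
  have hK₁1 : (1 : ℝ) ≤ K₁ := by rw [hK₁]; push_cast; linarith [Nat.cast_nonneg (α := ℝ) ⌈N + γ⌉₊]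
  have hK₂1 : (1 : ℝ) ≤ K₂ := by
    rw [hK₂]; push_cast; linarith [Nat.cast_nonneg (α := ℝ) ⌈(N + γ) / c₀⌉₊]
  have hXB : X ≤ X ^ (2 * (p + 1) + 4) := le_self_pow₀ hX1 (by omega)
  -- Only the sums with `l = 0` are sampled, hence `N' = 1`. The nodes lie between `-2 log q - log
  -- (K₂ ℓ)` and `log (K₂ ℓ)`, within `(2 + K₂) ℓ` of the origin.
  refine ⟨1, 2 + K₂, le_rfl, ?_, ?_, fun P => ⟨quadrature K₁ K₂ (P 0) e, ?_⟩⟩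
  · push_cast
    have : 1 ≤ 3 + κ + A₁ + A₂ + A₃ := by linarith
    nlinarith
  · calc (2 : ℝ) + K₂ ≤ (2 + κ) * X := by linarith
      _ ≤ (3 + κ + A₁ + A₂ + A₃) * X := mul_le_mul_of_nonneg_right (by linarith) (by linarith)
      _ ≤ _ := by gcongr
  intro q _ χ hχ C₀ D₀ hP
  have hq1 : (1 : ℝ) ≤ q := by exact_mod_cast NeZero.pos q
  have hq0 : (0 : ℝ) < q := by linarith
  have hl : 0 ≤ Real.log q := Real.log_nonneg hq1
  obtain ⟨ℓ, hℓ⟩ : ∃ ℓ : ℝ, ℓ = 1 + Real.log q := ⟨_, rfl⟩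
  have hℓ1 : 1 ≤ ℓ := by linarith
  have hy1 : 1 ≤ K₂ * ℓ := one_le_mul_of_one_le_of_one_le hK₂1 hℓ1
  obtain ⟨R, hR⟩ : ∃ R : ℝ, R = Real.log q + Real.log (K₂ * ℓ) := ⟨_, rfl⟩
  have hR0 : 0 ≤ R := hR ▸ add_nonneg hl (Real.log_nonneg hy1)
  have hRu : R ≤ 2 * (K₂ * ℓ) := by
    have := Real.log_le_sub_one_of_pos (show 0 < K₂ * ℓ by linarith)
    have : ℓ ≤ K₂ * ℓ := le_mul_of_one_le_left (by linarith) hK₂1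
    linarith
  obtain ⟨h, hh⟩ : ∃ h : ℝ, h = 1 / (K₁ * ℓ) := ⟨_, rfl⟩
  have hKℓ : 1 ≤ K₁ * ℓ := one_le_mul_of_one_le_of_one_le hK₁1 hℓ1
  have hh0 : 0 < h := by rw [hh]; positivity
  have hh1 : h ≤ 1 := by rw [hh, div_le_one (by linarith)]; exact hKℓ
  -- The loop test is `≤`, so the counter takes the values from `0` to `⌊2 R / h⌋`, and the grid
  -- covers `[-R, R]`.
  obtain ⟨M, hM⟩ : ∃ M : ℕ, M = ⌊2 * R / h⌋₊ + 1 := ⟨_, rfl⟩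
  have hMiff : ∀ j : ℕ, (j : ℝ) ≤ 2 * R / h ↔ j < M := fun j => by
    rw [hM, Nat.lt_succ_iff, Nat.le_floor_iff (by positivity)]
  have hMl : 2 * R ≤ h * M := by
    have := (Nat.lt_floor_add_one (2 * R / h)).le
    rw [div_le_iff₀ hh0] at this
    rw [hM]; push_cast; linarith
  have hMu : (M : ℝ) ≤ 2 * R / h + 1 := by
    have := Nat.floor_le (a := 2 * R / h) (by positivity)
    rw [hM]; push_cast; linarith
  have hhM : h * M ≤ 5 * (K₂ * ℓ) := by
    calc h * M ≤ h * (2 * R / h + 1) := by gcongr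
      _ = 2 * R + h := by field_simp
      _ ≤ _ := by linarith
  obtain ⟨δ, hδ⟩ : ∃ δ : ℝ, δ = C₀ * (q : ℝ) ^ (-(γ + ε + max 0 (1 - 2 * s.re))) := ⟨_, rfl⟩
  rw [← hδ] at hP
  have hnode : ∀ j : ℕ, j < M → -(2 * Real.log q + Real.log (K₂ * ℓ)) ≤ h * j - R - Real.log q
      ∧ h * j - R - Real.log q ≤ Real.log (K₂ * ℓ) := by
    intro j hj
    have h1 := (hMiff j).2 hj
    rw [le_div_iff₀ hh0] at h1
    have h2 : 0 ≤ h * j := by positivity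
    constructor <;> linarith
  have hlogy : Real.log (K₂ * ℓ) ≤ K₂ * ℓ := (Real.log_le_sub_one_of_pos (by linarith)).trans (by linarith)
  have hcomp : ∀ j : ℕ, j < M → Computes ⟨q, χ, F, c⟩ (P 0)
      [(q : ℂ), ((h * j - R - Real.log q : ℝ) : ℂ)]
      (orbitSum χ G 0 (h * j - R - Real.log q)) δ D₀ := by
    intro j hj
    refine hP 0 (by norm_num) _ ?_
    obtain ⟨h1, h2⟩ := hnode j hj
    have h3 := Real.log_nonneg hy1
    have h4 : (2 + (K₂ : ℝ)) * (1 + Real.log q) = 2 * ℓ + K₂ * ℓ := by rw [hℓ]; ring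
    rw [h4, abs_le]
    constructor <;> linarith
  -- No sign of `C` or size of `D` is given. Both are read off from a run at the first node: an
  -- error is nonnegative and a run takes at least one step.
  have hC₀ : 0 ≤ C₀ := by
    obtain ⟨_, _, _, _, h3⟩ := hcomp 0 (by omega)
    rw [hδ] at h3
    exact nonneg_of_mul_nonneg_left ((norm_nonneg _).trans h3) (by positivity)
  have hD₀ : 1 ≤ D₀ := by
    obtain ⟨_, n, h1, h2, _⟩ := hcomp 0 (by omega)
    have : (1 : ℝ) ≤ n := by exact_mod_cast h1.one_le
    linarith
  -- The values returned by `P 0` are fixed once and for all; past the last node the choice `0` is a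
  -- dummy.
  have hv : ∀ j : ℕ, ∃ v : ℂ, j < M → (∃ m' n', Exec ⟨q, χ, F, c⟩ (P 0)
      (initMem [(((q : ℝ)) : ℂ), ((h * j - R - Real.log q : ℝ) : ℂ)]) m' n' ∧ n' ≤ ⌊D₀⌋₊ ∧ m' 0 = v) ∧
      ‖v - orbitSum χ G 0 (h * j - R - Real.log q)‖ ≤ δ := by
    intro j
    by_cases hj : j < M
    · obtain ⟨m', n', h1, h2, h3⟩ := hcomp j hj
      exact ⟨m' 0, fun _ => ⟨⟨m', n', h1, Nat.le_floor h2, rfl⟩, h3⟩⟩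
    · exact ⟨0, fun h => absurd h hj⟩
  choose v hv using hv
  obtain ⟨m', n', hexec, htime, hval⟩ := hcost (E := ⟨q, χ, F, c⟩) (P := P 0)
    (K₁ := K₁) (K₂ := K₂) (by omega) (by omega) hq1 (hℓ ▸ hR) (hℓ ▸ hh) hMiff he
    (fun j hj => (hv j hj).1)
  refine ⟨m', n', hexec, ?_, ?_⟩
  · have hn' : (n' : ℝ) ≤ M * (⌊D₀⌋₊ + c₁) + c₂ := by exact_mod_cast htime
    have hM1 : (1 : ℝ) ≤ M := by rw [hM]; push_cast; linarith [Nat.cast_nonneg (α := ℝ) ⌊2 * R / h⌋₊]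
    have hMu' : (M : ℝ) ≤ 5 * (K₁ * ℓ) * (K₂ * ℓ) := by
      have h1 : 2 * R / h = 2 * R * (K₁ * ℓ) := by rw [hh]; field_simp
      rw [h1] at hMu
      have h2 : 2 * R * (K₁ * ℓ) ≤ 4 * (K₂ * ℓ) * (K₁ * ℓ) :=
        mul_le_mul_of_nonneg_right (by linarith) (by linarith)
      have h3 : 1 ≤ (K₁ * ℓ) * (K₂ * ℓ) := one_le_mul_of_one_le_of_one_le hKℓ hy1
      linarith [mul_comm (K₂ * ℓ) (K₁ * ℓ)]
    have h4 : ℓ ^ 2 ≤ 4 * X ^ 2 * (q : ℝ) ^ ε := by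
      rw [hℓ]
      refine (one_add_log_pow_le hq1 hε hε1 (m := 2) (by norm_num)).trans ?_
      refine mul_le_mul_of_nonneg_right ?_ (by positivity)
      calc (((2 : ℕ) : ℝ) / ε) ^ 2 = 4 * (1 / ε) ^ 2 := by push_cast; ring
        _ ≤ _ := by gcongr
    refine (hn'.trans (quadrature_time_le hX1 hD₀ (Nat.floor_le (by linarith)) (Nat.cast_nonneg c₁)
      (Nat.cast_nonneg c₂) hW hM1 hMu' (by linarith) hK₁u hK₂u h4 (by positivity)
      hκ0.le)).trans ?_
    rw [← hA₃]
    have h5 : A₃ * X ^ 4 ≤ (3 + κ + A₁ + A₂ + A₃) * X ^ (2 * (p + 1) + 4) :=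
      mul_le_mul (by linarith) (pow_le_pow_right₀ hX1 (by omega)) (by positivity) (by linarith)
    exact mul_le_mul_of_nonneg_right (mul_le_mul_of_nonneg_right h5 (by linarith)) (by positivity)
  · have hbound := hquad q χ hχ h R M hh0 hh1 hR0 hMl
    have hrw : ∀ i : ℕ, -R + h * i - Real.log q = h * i - R - Real.log q := fun i => by ring
    simp_rw [hrw] at hbound
    have hπh : π / h = π * (K₁ * (1 + Real.log q)) := by rw [hh, hℓ]; field_simp
    have hcR : c₀ / q * Real.exp R = c₀ * (K₂ * (1 + Real.log q)) := by
      rw [hR, Real.exp_add, Real.exp_log hq0, Real.exp_log (by linarith), hℓ]; field_simp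
    rw [hπh, hcR] at hbound
    have hb2 := hbound.trans (quadrature_error_le hc₀ hC hq1 hK₁l hK₂l)
    have hval' : m' 0 = a * (h * ∑ i ∈ Finset.range M, Complex.exp ((s - 1 / 2)
        * ((h * i - R - Real.log q : ℝ) : ℂ)) * v i) := by subst hc; exact hval
    have hsum : ‖(h : ℂ) * ∑ i ∈ Finset.range M, Complex.exp ((s - 1 / 2)
        * ((h * i - R - Real.log q : ℝ) : ℂ)) * v i
        - h * ∑ i ∈ Finset.range M, orbitSum χ G 0 (h * i - R - Real.log q)
          * Complex.exp ((s - 1 / 2) * ((h * i - R - Real.log q : ℝ) : ℂ))‖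
        ≤ 5 * (K₂ * ℓ) ^ (p + 1) * (C₀ * (q : ℝ) ^ (-(γ + ε))) := by
      have h1 := norm_weighted_sum_sub_le (S := fun i : ℕ => orbitSum χ G 0 (h * i - R - Real.log q))
        (z := fun i : ℕ => Complex.exp ((s - 1 / 2) * ((h * i - R - Real.log q : ℝ) : ℂ))) (v := v)
        (δ := δ) (M := M) (w := (K₂ * ℓ) ^ p * (q : ℝ) ^ max 0 (1 - 2 * s.re)) hh0.le (by positivity)
        (fun i hi => norm_weight_le hq1 hy1 hp (hnode i hi).1 (hnode i hi).2)
        (fun i hi => (hv i hi).2)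
      refine h1.trans ?_
      -- The power of `q` in the weights cancels exactly against the additional precision of the
      -- input.
      have h2 : (q : ℝ) ^ max 0 (1 - 2 * s.re) * δ = C₀ * (q : ℝ) ^ (-(γ + ε)) := by
        rw [hδ, mul_left_comm, ← Real.rpow_add hq0]; ring_nf
      calc _ = h * M * ((K₂ * ℓ) ^ p * (C₀ * (q : ℝ) ^ (-(γ + ε)))) := by rw [← h2]; ring
        _ ≤ 5 * (K₂ * ℓ) * ((K₂ * ℓ) ^ p * (C₀ * (q : ℝ) ^ (-(γ + ε)))) := by gcongr
        _ = _ := by ring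
    have hpow := input_error_le (γ := γ) (ε := ε) (p := p) hC₀ hq0 (Nat.cast_nonneg K₂) hK₂u
      (by linarith) (ℓ := ℓ) (by
        rw [hℓ]
        refine (one_add_log_pow_le hq1 hε hε1 (m := p + 1) (by omega)).trans ?_
        refine mul_le_mul_of_nonneg_right (pow_le_pow_left₀ (by positivity) ?_ _) (by positivity)
        rw [div_eq_mul_one_div]
        exact mul_le_mul_of_nonneg_left hXε (by positivity))
    rw [hval', hL q χ hχ, ← mul_sub, norm_mul]
    have htri := (norm_sub_le_norm_sub_add_norm_sub _ _ _).trans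
      (add_le_add (hsum.trans hpow) ((norm_sub_rev _ _).trans_le hb2))
    have hqγ : 0 < (q : ℝ) ^ (-γ) := by positivity
    calc _ ≤ ‖a‖ * (5 * κ ^ (p + 1) * ((p + 1 : ℕ) : ℝ) ^ (p + 1) * X ^ (2 * (p + 1)) * C₀
          * (q : ℝ) ^ (-γ) + 2 * C * (q : ℝ) ^ (-γ)) := by gcongr
      _ = (A₂ * X ^ (2 * (p + 1)) * C₀ + A₁ * 1) * (q : ℝ) ^ (-γ) := by rw [hA₁, hA₂]; ring
      _ ≤ (A₂ * X ^ (2 * (p + 1) + 4) * (1 + C₀) + A₁ * (X ^ (2 * (p + 1) + 4) * (1 + C₀)))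
          * (q : ℝ) ^ (-γ) := by
          have h1 : X ^ (2 * (p + 1)) ≤ X ^ (2 * (p + 1) + 4) := pow_le_pow_right₀ hX1 (by omega)
          have h2 : 1 ≤ X ^ (2 * (p + 1) + 4) * (1 + C₀) :=
            one_le_mul_of_one_le_of_one_le (one_le_pow₀ hX1) (by linarith)
          have h3 : A₂ * X ^ (2 * (p + 1)) * C₀ ≤ A₂ * X ^ (2 * (p + 1) + 4) * (1 + C₀) :=
            mul_le_mul (mul_le_mul_of_nonneg_left h1 hA₂0) (by linarith) hC₀ (by positivity)
          have h4 := mul_le_mul_of_nonneg_left h2 hA₁0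
          exact mul_le_mul_of_nonneg_right (by linarith) hqγ.le
      _ = (A₂ + A₁) * X ^ (2 * (p + 1) + 4) * (1 + C₀) * (q : ℝ) ^ (-γ) := by ring
      _ ≤ _ := by
        refine mul_le_mul_of_nonneg_right ?_ hqγ.le
        refine mul_le_mul_of_nonneg_right ?_ (by linarith)
        exact mul_le_mul_of_nonneg_right (by linarith) (by positivity)

/-! ### Character sums -/

lemma sum_range_natCast {q : ℕ} [NeZero q] {M : Type*} [AddCommMonoid M] (f : ℕ → M) :
    ∑ j ∈ Finset.range q, f j = ∑ a : ZMod q, f a.val := by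
  refine Finset.sum_nbij' (fun j => (j : ZMod q)) (fun a => a.val) (by simp) ?_ ?_ ?_ ?_
  · intro a _; exact Finset.mem_range.2 (ZMod.val_lt a)
  · intro j hj; exact ZMod.val_cast_of_lt (Finset.mem_range.1 hj)
  · intro a _; simp
  · intro j hj; rw [ZMod.val_cast_of_lt (Finset.mem_range.1 hj)]

/-- Primitivity makes the Gauss sum separable for all `n`; if `n` is not prime to `q` both sides
vanish. -/
lemma sum_char_mul_exp {q : ℕ} [NeZero q] {χ : DirichletCharacter ℂ q} (hχ : χ.IsPrimitive)
    (n : ℤ) : ∑ j ∈ Finset.range q, χ (j : ZMod q)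
      * Complex.exp (2 * π * Complex.I * (n * (j / q : ℝ))) = tau χ * χ⁻¹ (n : ZMod q) := by
  rw [mul_comm (tau χ), tau, ← gaussSum_mulShift_of_isPrimitive _ hχ, gaussSum, sum_range_natCast]
  refine Finset.sum_congr rfl fun a _ => ?_
  have : (n : ZMod q) * a = ((n * (a.val : ℤ) : ℤ) : ZMod q) := by simp
  rw [AddChar.mulShift_apply, this, ZMod.stdAddChar_coe, ZMod.natCast_zmod_val]
  congr 2
  push_cast
  ring

lemma inv_apply_neg_one {q : ℕ} (χ : DirichletCharacter ℂ q) : χ⁻¹ (-1) = χ (-1) := by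
  rw [MulChar.inv_apply, show (-1 : ZMod q) = ((-1 : (ZMod q)ˣ) : ZMod q) by simp,
    Ring.inverse_unit]
  simp

/-- The average of the exponential sums for `n` and `-n`, which coincide for an even character. -/
lemma sum_char_mul_cos {q : ℕ} [NeZero q] {χ : DirichletCharacter ℂ q} (hχ : χ.IsPrimitive)
    (h1 : χ (-1) = 1) (n : ℕ) : ∑ j ∈ Finset.range q, χ (j : ZMod q)
      * (Real.cos (2 * π * (n * (j / q))) : ℂ) = tau χ * χ⁻¹ (n : ZMod q) := by
  have e1 := sum_char_mul_exp hχ (n : ℤ)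
  have e2 := sum_char_mul_exp hχ (-n : ℤ)
  have h2 : χ⁻¹ (-1) = 1 := (inv_apply_neg_one χ).trans h1
  have h3 : χ⁻¹ (((-n : ℤ)) : ZMod q) = χ⁻¹ (n : ZMod q) := by
    rw [Int.cast_neg, ← neg_one_mul, map_mul, h2, one_mul, Int.cast_natCast]
  rw [h3] at e2
  rw [Int.cast_natCast (R := ZMod q)] at e1
  have h4 : ∀ j : ℕ, χ (j : ZMod q) * (Real.cos (2 * π * (n * (j / q))) : ℂ)
      = (χ (j : ZMod q) * Complex.exp (2 * π * Complex.I * (((n : ℤ) : ℂ) * (j / q : ℝ)))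
        + χ (j : ZMod q) * Complex.exp (2 * π * Complex.I * (((-n : ℤ) : ℂ) * (j / q : ℝ)))) / 2 := by
    intro j
    rw [Complex.ofReal_cos, Complex.cos]
    push_cast
    ring_nf
  simp_rw [h4]
  rw [← Finset.sum_div, Finset.sum_add_distrib, e1, e2]
  ring

/-- Half the difference of the exponential sums for `n` and `-n`, which are opposite for an odd
character. The factor `i` keeps the right-hand side as in the even case. -/
lemma sum_char_mul_sin {q : ℕ} [NeZero q] {χ : DirichletCharacter ℂ q} (hχ : χ.IsPrimitive)
    (h1 : χ (-1) = -1) (n : ℕ) : ∑ j ∈ Finset.range q, χ (j : ZMod q)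
      * (Complex.I * (Real.sin (2 * π * (n * (j / q))) : ℂ)) = tau χ * χ⁻¹ (n : ZMod q) := by
  have e1 := sum_char_mul_exp hχ (n : ℤ)
  have e2 := sum_char_mul_exp hχ (-n : ℤ)
  have h2 : χ⁻¹ (-1) = -1 := (inv_apply_neg_one χ).trans h1
  have h3 : χ⁻¹ (((-n : ℤ)) : ZMod q) = -χ⁻¹ (n : ZMod q) := by
    rw [Int.cast_neg, ← neg_one_mul, map_mul, h2, neg_one_mul, Int.cast_natCast]
  rw [h3] at e2
  rw [Int.cast_natCast (R := ZMod q)] at e1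
  have h4 : ∀ j : ℕ, χ (j : ZMod q) * (Complex.I * (Real.sin (2 * π * (n * (j / q))) : ℂ))
      = (χ (j : ZMod q) * Complex.exp (2 * π * Complex.I * (((n : ℤ) : ℂ) * (j / q : ℝ)))
        - χ (j : ZMod q) * Complex.exp (2 * π * Complex.I * (((-n : ℤ) : ℂ) * (j / q : ℝ)))) / 2 := by
    intro j
    rw [Complex.ofReal_sin, Complex.sin]
    push_cast
    ring_nf
    rw [Complex.I_sq]
    ring
  simp_rw [h4]
  rw [← Finset.sum_div, Finset.sum_sub_distrib, e1, e2]
  ring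

/-- Reindexing a character sum by `a ↦ - a⁻¹`. -/
lemma sum_char_mul_of_neg_inv {q : ℕ} [NeZero q] (χ : DirichletCharacter ℂ q) {A B : ZMod q → ℂ}
    {ω : ℂ} (h : ∀ u : (ZMod q)ˣ, A u = ω * B ((-u⁻¹ : (ZMod q)ˣ) : ZMod q)) :
    ∑ a, χ a * A a = ω * χ (-1) * ∑ a, χ⁻¹ a * B a := by
  -- Characters vanish off the units, so that only classes which can be inverted contribute.
  have hunits : ∀ (ψ : DirichletCharacter ℂ q) (f : ZMod q → ℂ),
      ∑ u : (ZMod q)ˣ, ψ u * f u = ∑ a, ψ a * f a := by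
    intro ψ f
    refine Fintype.sum_of_injective (fun u : (ZMod q)ˣ => (u : ZMod q)) Units.val_injective _ _ ?_ ?_
    · intro a ha
      rw [ψ.map_nonunit (fun hu => ha ⟨hu.unit, rfl⟩), zero_mul]
    · intro u; rfl
  rw [← hunits, ← hunits, Finset.mul_sum]
  refine Fintype.sum_equiv ((Equiv.inv (ZMod q)ˣ).trans (Equiv.neg _)) _ _ fun u => ?_
  rw [h u]
  simp only [Equiv.trans_apply, Equiv.inv_apply, Equiv.neg_apply]
  rw [MulChar.inv_apply]
  have e : Ring.inverse ((-u⁻¹ : (ZMod q)ˣ) : ZMod q) = -1 * u := by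
    rw [Ring.inverse_unit]; simp
  rw [e, map_mul]
  have h1 : χ (-1) * χ (-1) = 1 := by rw [← map_mul]; simp
  linear_combination (-ω * χ u * B ((-u⁻¹ : (ZMod q)ˣ) : ZMod q)) * h1

/-! ### Orbit sums of invariant functions -/

lemma coe_nMat (t : ℝ) : (nMat t : Matrix (Fin 2) (Fin 2) ℝ) = !![1, t; 0, 1] := rfl

lemma coe_aMat (t : ℝ) : (aMat t : Matrix (Fin 2) (Fin 2) ℝ)
    = !![Real.exp (t / 2), 0; 0, Real.exp (-(t / 2))] := rfl

lemma coe_nMat_mul_aMat (x t : ℝ) : ((nMat x * aMat t : SL(2, ℝ)) : Matrix (Fin 2) (Fin 2) ℝ)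
    = !![Real.exp (t / 2), x * Real.exp (-(t / 2)); 0, Real.exp (-(t / 2))] := by
  rw [Matrix.SpecialLinearGroup.coe_mul, coe_nMat, coe_aMat, Matrix.mul_fin_two]
  simp

lemma orbitSum_zero_eq {q : ℕ} [NeZero q] (χ : DirichletCharacter ℂ q) (G : SL(2, ℝ) → ℂ) (t : ℝ) :
    orbitSum χ G 0 t = ∑ a : ZMod q, χ a * G (nMat (a.val / q) * aMat t) := by
  rw [orbitSum, sum_range_natCast]
  simp

/-- The functional equation, from the behaviour at each cusp. -/
lemma orbitSum_feq {q : ℕ} [NeZero q] (χ : DirichletCharacter ℂ q) {G : SL(2, ℝ) → ℂ} {ω : ℂ}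
    (hω : ‖ω‖ ≤ 1)
    (h : ∀ (j j' : ℤ) (t : ℝ), (q : ℤ) ∣ j * j' + 1 →
      G (nMat (j / q) * aMat t) = ω * G (nMat (j' / q) * aMat (-(2 * Real.log q) - t))) :
    ∃ ω : ℂ, ‖ω‖ ≤ 1 ∧
      ∀ t : ℝ, orbitSum χ G 0 t = ω * orbitSum χ⁻¹ G 0 (-(2 * Real.log q) - t) := by
  refine ⟨ω * χ (-1), ?_, fun t => ?_⟩
  · rw [norm_mul]
    exact mul_le_one₀ hω (norm_nonneg _) (χ.norm_le_one _)
  · rw [orbitSum_zero_eq, orbitSum_zero_eq]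
    refine sum_char_mul_of_neg_inv χ (A := fun a => G (nMat (a.val / q) * aMat t))
      (B := fun a => G (nMat (a.val / q) * aMat (-(2 * Real.log q) - t))) fun u => ?_
    -- The representatives of `u` and `-u⁻¹` have product `-1` modulo `q`.
    have := h (u : ZMod q).val ((-u⁻¹ : (ZMod q)ˣ) : ZMod q).val t ?_
    · simpa using this
    · rw [← ZMod.intCast_zmod_eq_zero_iff_dvd]
      push_cast
      rw [ZMod.natCast_zmod_val, ZMod.natCast_zmod_val]
      simp

/-- The series, from the Fourier expansion. -/
lemma orbitSum_series {q : ℕ} [NeZero q] {χ : DirichletCharacter ℂ q} {G : SL(2, ℝ) → ℂ}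
    {b : ℕ → ℂ} {φ : ℂ → ℂ} {Ψ : ℝ → ℂ}
    (hG : ∀ x t : ℝ, HasSum (fun n : ℕ+ => b n * Ψ (n * x) * φ (t + (Real.log n : ℝ)))
      (G (nMat x * aMat t)))
    (hΨ : ∀ n : ℕ, ∑ j ∈ Finset.range q, χ (j : ZMod q) * Ψ (n * (j / q))
      = tau χ * χ⁻¹ (n : ZMod q)) (t : ℝ) :
    orbitSum χ G 0 t = tau χ * twistSeries b φ χ⁻¹ t := by
  have h1 := hasSum_sum (s := Finset.range q) fun (j : ℕ) _ =>
    (hG (j / q) t).mul_left (χ (j : ZMod q))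
  have h2 : ∀ n : ℕ+, ∑ j ∈ Finset.range q, χ (j : ZMod q)
      * (b n * Ψ (n * (j / q)) * φ (t + (Real.log n : ℝ))) = tau χ * twistTerm b φ χ⁻¹ n t := by
    intro n
    rw [twistTerm]
    calc _ = (∑ j ∈ Finset.range q, χ (j : ZMod q) * Ψ (n * (j / q)))
          * (b n * φ (t + (Real.log n : ℝ))) := by
          rw [Finset.sum_mul]; exact Finset.sum_congr rfl fun j _ => by ring
      _ = _ := by rw [hΨ n]; ring
  simp_rw [h2] at h1
  rw [twistSeries, ← tsum_mul_left, h1.tsum_eq]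
  simp [orbitSum]

/-! ### Lifts at the points `n(x) a(t)` -/

lemma im_add_exp_pos (x t : ℝ) : 0 < ((x : ℂ) + (Real.exp t : ℝ) * Complex.I).im := by
  rw [Complex.add_im, Complex.ofReal_im, Complex.im_ofReal_mul, Complex.I_im]
  simpa only [mul_one, zero_add] using Real.exp_pos t

lemma nMat_aMat_smul_I (x t : ℝ) : (nMat x * aMat t) • UpperHalfPlane.I
    = ofComplex ((x : ℂ) + (Real.exp t : ℝ) * Complex.I) := by
  rw [ofComplex_apply_of_im_pos (im_add_exp_pos x t)]
  ext1
  rw [coe_specialLinearGroup_apply]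
  have h : (Real.exp (-(t / 2)) : ℂ) ≠ 0 := by exact_mod_cast (Real.exp_pos _).ne'
  have h2 : Real.exp t * Real.exp (-(t / 2)) = Real.exp (t / 2) := by
    rw [← Real.exp_add]; ring_nf
  have h2c : (Real.exp t : ℂ) * (Real.exp (-(t / 2)) : ℂ) = (Real.exp (t / 2) : ℂ) := by
    rw [← h2, Complex.ofReal_mul]
  rw [coe_nMat_mul_aMat, UpperHalfPlane.coe_I]
  simp only [Matrix.of_apply, Matrix.cons_val', Matrix.cons_val_zero, Matrix.cons_val_one,
    Matrix.cons_val_fin_one, Algebra.algebraMap_self, RingHom.id_apply, zero_mul, zero_add,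
    Complex.ofReal_zero]
  rw [div_eq_iff h, ← h2c, Complex.ofReal_mul]
  ring

lemma lift_nMat_aMat (k : ℤ) (f : ℍ → ℂ) (x t : ℝ) : lift k f (nMat x * aMat t)
    = Complex.exp (k * t / 2) * f (ofComplex ((x : ℂ) + (Real.exp t : ℝ) * Complex.I)) := by
  rw [lift, nMat_aMat_smul_I]
  congr 1
  have h1 : (nMat x * aMat t) 1 0 = 0 := by rw [coe_nMat_mul_aMat]; rfl
  have h2 : (nMat x * aMat t) 1 1 = Real.exp (-(t / 2)) := by rw [coe_nMat_mul_aMat]; rfl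
  rw [h1, h2, Complex.ofReal_zero, zero_mul, zero_add, Complex.ofReal_exp, ← Complex.exp_int_mul]
  congr 1
  push_cast
  ring

/-- The matrix that moves `j/q` to `∞` and `∞` to `j'/q`. -/
def cuspMat (j j' m q : ℤ) (h : q * m - j * j' = 1) : SL(2, ℤ) :=
  ⟨!![j', -m; q, -j], by rw [Matrix.det_fin_two_of]; linarith⟩

lemma im_neg_inv_pos {q : ℕ} [NeZero q] (j' : ℤ) {w : ℂ} (hw : 0 < w.im) :
    0 < ((j' / q : ℝ) - 1 / ((q : ℂ) ^ 2 * w)).im := by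
  have hq : (0 : ℝ) < q := by exact_mod_cast NeZero.pos q
  have hn : 0 < Complex.normSq w := Complex.normSq_pos.2 (by rintro rfl; simp at hw)
  rw [Complex.sub_im, Complex.ofReal_im, one_div, mul_inv]
  have : ((q : ℂ) ^ 2)⁻¹ = (((q : ℝ) ^ 2)⁻¹ : ℝ) := by push_cast; rfl
  rw [this, Complex.im_ofReal_mul, Complex.inv_im]
  have : 0 < ((q : ℝ) ^ 2)⁻¹ * (w.im / Complex.normSq w) := by positivity
  have e : -w.im / Complex.normSq w = -(w.im / Complex.normSq w) := by ring
  rw [e]; linarith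

lemma cuspMat_smul {q : ℕ} [NeZero q] {j j' m : ℤ} (h : (q : ℤ) * m - j * j' = 1) {w : ℂ}
    (hw : 0 < w.im) : cuspMat j j' m q h • ofComplex ((j / q : ℝ) + w)
      = ofComplex ((j' / q : ℝ) - 1 / ((q : ℂ) ^ 2 * w)) := by
  have hq : (q : ℂ) ≠ 0 := by exact_mod_cast NeZero.ne q
  have hw0 : w ≠ 0 := by rintro rfl; simp at hw
  have hw' : 0 < ((j / q : ℝ) + w : ℂ).im := by
    rw [Complex.add_im, Complex.ofReal_im, zero_add]; exact hw
  rw [ofComplex_apply_of_im_pos hw', ofComplex_apply_of_im_pos (im_neg_inv_pos j' hw)]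
  ext1
  rw [coe_specialLinearGroup_apply]
  simp only [cuspMat, Matrix.of_apply, Matrix.cons_val', Matrix.cons_val_zero, Matrix.cons_val_one,
    Matrix.cons_val_fin_one]
  have hc : (q : ℂ) * m - j * j' = 1 := by exact_mod_cast h
  push_cast
  have hden : (q : ℂ) * (j / q + w) + -j = q * w := by field_simp; ring
  simp only [eq_intCast, Complex.ofReal_intCast]
  rw [hden, div_eq_iff (mul_ne_zero hq hw0)]
  field_simp
  linear_combination -hc

/-! ### Twisted `L`-functions from orbit data -/

/-- Two continuations agree on a common right half-plane, hence everywhere. -/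
lemma IsTwistedL.unique {a : ℕ → ℂ} {k : ℤ} {q : ℕ} {χ : DirichletCharacter ℂ q} {L L' : ℂ → ℂ}
    (h : IsTwistedL a k χ L) (h' : IsTwistedL a k χ L') : L = L' := by
  obtain ⟨hd, σ, hs⟩ := h
  obtain ⟨hd', σ', hs'⟩ := h'
  refine AnalyticOnNhd.eq_of_eventuallyEq (𝕜 := ℂ) (z₀ := ((max σ σ' + 1 : ℝ) : ℂ))
    (Complex.analyticOnNhd_univ_iff_differentiable.2 hd)
    (Complex.analyticOnNhd_univ_iff_differentiable.2 hd') ?_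
  have ho : IsOpen {s : ℂ | max σ σ' < s.re} := isOpen_lt continuous_const Complex.continuous_re
  filter_upwards [ho.mem_nhds (show max σ σ' < ((max σ σ' + 1 : ℝ) : ℂ).re by
    rw [Complex.ofReal_re]; linarith)] with s hs1
  exact (hs s ((le_max_left _ _).trans_lt hs1)).unique (hs' s ((le_max_right _ _).trans_lt hs1))

lemma IsTwistedL.eq_twistedL {a : ℕ → ℂ} {k : ℤ} {q : ℕ} {χ : DirichletCharacter ℂ q} {L : ℂ → ℂ}
    (h : IsTwistedL a k χ L) : twistedL a k χ = L := by
  have : ∃ L, IsTwistedL a k χ L := ⟨L, h⟩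
  rw [twistedL, dif_pos this]
  exact this.choose_spec.unique h

namespace OrbitData

variable {G : SL(2, ℝ) → ℂ} {b : ℕ → ℂ} {φ H : ℂ → ℂ}
  {adm : ∀ q : ℕ, DirichletCharacter ℂ q → Prop} {a : ℕ → ℂ} {k : ℤ}

/-- With `a(n) = b(n) n^{k/2}` the exponent `s + (k - 1)/2` becomes `s - 1/2`, which is where the
shift by `1/2` comes from. -/
lemma isTwistedL_continuation (D : OrbitData G b φ H adm)
    (hab : ∀ n : ℕ+, a n = b n * ((n : ℕ) : ℂ) ^ ((k : ℂ) / 2)) {q : ℕ} [NeZero q]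
    {χ : DirichletCharacter ℂ q} (hχ : adm q χ) :
    IsTwistedL a k χ (fun s => continuation G H χ (s - 1 / 2)) := by
  refine ⟨(D.differentiable_continuation hχ).comp (by fun_prop), ?_⟩
  obtain ⟨σ, hσ⟩ := D.hasSum_continuation hχ
  refine ⟨σ + 1 / 2, fun s hs => ?_⟩
  convert hσ (s - 1 / 2) (by rw [Complex.sub_re]; norm_num; linarith) using 2 with n
  have hn : ((n : ℕ) : ℂ) ≠ 0 := by exact_mod_cast n.ne_zero
  rw [hab, show s + ((k : ℂ) - 1) / 2 = (s - 1 / 2) + k / 2 by ring, Complex.cpow_add _ _ hn]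
  have h0 : ((n : ℕ) : ℂ) ^ ((k : ℂ) / 2) ≠ 0 := by
    rw [Ne, Complex.cpow_eq_zero_iff]; exact fun h => hn h.1
  have h1 : ((n : ℕ) : ℂ) ^ (s - 1 / 2) ≠ 0 := by
    rw [Ne, Complex.cpow_eq_zero_iff]; exact fun h => hn h.1
  field_simp

lemma isTwistedL_twistedL (D : OrbitData G b φ H adm)
    (hab : ∀ n : ℕ+, a n = b n * ((n : ℕ) : ℂ) ^ ((k : ℂ) / 2)) {q : ℕ} [NeZero q]
    {χ : DirichletCharacter ℂ q} (hχ : adm q χ) : IsTwistedL a k χ (twistedL a k χ) := by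
  have h := D.isTwistedL_continuation hab hχ
  rwa [h.eq_twistedL]

lemma tau_mul_twistedL (D : OrbitData G b φ H adm)
    (hab : ∀ n : ℕ+, a n = b n * ((n : ℕ) : ℂ) ^ ((k : ℂ) / 2)) {q : ℕ} [NeZero q]
    {χ : DirichletCharacter ℂ q} (hχ : adm q χ) (s : ℂ) :
    tau χ * twistedL a k χ⁻¹ s = H (s - 1 / 2) * orbitMellin G χ (s - 1 / 2) := by
  rw [(D.isTwistedL_continuation hab (D.inv q χ hχ)).eq_twistedL]
  simp only [continuation, inv_inv]
  exact mul_div_cancel₀ _ (tau_ne_zero (D.prim q χ hχ))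

theorem reducesToOrbitSums_twistedL (D : OrbitData G b φ H adm)
    (hab : ∀ n : ℕ+, a n = b n * ((n : ℕ) : ℂ) ^ ((k : ℂ) / 2)) {F : SL(2, ℝ) → ℂ}
    {c : Fin 3 → ℂ} {s : ℂ} (hc : c 0 = s) (e : Expr)
    (he : ∀ m, e.Ok c m ∧ e.eval c m = H (s - 1 / 2)) :
    ReducesToOrbitSums F G c s adm (fun _ χ => twistedL a k χ⁻¹ s) :=
  D.reducesToOrbitSums hc e he fun _ _ _ hχ => D.tau_mul_twistedL hab hχ s

end OrbitData

/-- An expression for `π / 2`. -/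
def Expr.halfPi : Expr := .un .im (.log (.lit 0 1))

/-- `π` is not one of the constants of the model; it is recovered from `Im (log i) = π / 2`. -/
lemma Expr.ok_halfPi (c : Fin 3 → ℂ) (m : ℕ → ℂ) :
    Expr.halfPi.Ok c m ∧ Expr.halfPi.eval c m = π / 2 := by
  constructor
  · refine ⟨⟨trivial, ?_⟩, trivial⟩
    simp [UnOp.Ok, Expr.eval, Complex.mem_slitPlane_iff]
  · simp [Expr.halfPi, Expr.eval, UnOp.eval, Complex.log_I]

/-! ### Holomorphic forms -/

lemma integral_comp_exp {E : Type*} [NormedAddCommGroup E] [NormedSpace ℝ E] (g : ℝ → E) :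
    ∫ x : ℝ, Real.exp x • g (Real.exp x) = ∫ y in Set.Ioi 0, g y := by
  symm
  rw [← Real.range_exp, ← Set.image_univ]
  simpa [abs_of_pos (Real.exp_pos _)] using integral_image_eq_integral_abs_deriv_smul
    MeasurableSet.univ (fun x _ => (Real.hasDerivAt_exp x).hasDerivWithinAt)
    (fun x _ y _ hxy => Real.exp_injective hxy) g

/-- Euler's integral for the Gamma function after the substitution `y = e^t`. -/
lemma integral_exp_mul_exp_neg {a : ℂ} {r : ℝ} (ha : 0 < a.re) (hr : 0 < r) :
    ∫ t : ℝ, Complex.exp (a * t) * Complex.exp (-(r * Real.exp t : ℝ))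
      = (1 / r : ℂ) ^ a * Complex.Gamma a := by
  rw [← Complex.integral_cpow_mul_exp_neg_mul_Ioi ha hr, ← integral_comp_exp]
  refine integral_congr_ae (.of_forall fun t => ?_)
  simp only [Complex.real_smul]
  have h : ((Real.exp t : ℝ) : ℂ) ≠ 0 := by exact_mod_cast (Real.exp_pos t).ne'
  have h2 : ((Real.exp t : ℝ) : ℂ) ^ a = Complex.exp (a * t) := by
    rw [Complex.cpow_def_of_ne_zero h, ← Complex.ofReal_log (Real.exp_pos t).le, Real.log_exp,
      mul_comm]
  rw [Complex.cpow_sub _ _ h, Complex.cpow_one, h2]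
  push_cast
  field_simp

lemma half_le_cos {y : ℝ} (hy : |y| < 1) : 1 / 2 ≤ Real.cos y := by
  have h := Real.one_sub_sq_div_two_le_cos (x := y)
  have : y ^ 2 ≤ 1 := by
    rw [← sq_abs]
    exact pow_le_one₀ (abs_nonneg _) hy.le
  linarith

/-- For `x ≤ 0` any natural `N ≥ |α|` works without using the decay; for `x ≥ 0` half of the double
exponential beats `e^{2 N x}`. -/
lemma exists_exp_mul_exp_neg_le (α : ℝ) {c : ℝ} (hc : 0 < c) : ∃ (N : ℕ) (K : ℝ), 0 ≤ K ∧
    ∀ x : ℝ, Real.exp (α * x) * Real.exp (-(c * Real.exp x))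
      ≤ K * Real.exp (-(N * x)) * Real.exp (-(c / 2 * Real.exp x)) := by
  obtain ⟨N, hN⟩ := exists_nat_ge |α|
  refine ⟨N, (2 * N).factorial * (1 / (c / 2)) ^ (2 * N) + 1, by positivity, fun x => ?_⟩
  have e1 : Real.exp (-(c * Real.exp x))
      = Real.exp (-(c / 2 * Real.exp x)) * Real.exp (-(c / 2 * Real.exp x)) := by
    rw [← Real.exp_add]; ring_nf
  rw [e1, ← mul_assoc]
  refine mul_le_mul_of_nonneg_right ?_ (Real.exp_pos _).le
  rw [add_mul, one_mul]
  rcases le_total x 0 with hx | hx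
  · have h1 : Real.exp (α * x) ≤ Real.exp (-(N * x)) := by
      rw [Real.exp_le_exp]
      nlinarith [neg_abs_le α, le_abs_self α]
    have h2 : Real.exp (-(c / 2 * Real.exp x)) ≤ 1 := by
      rw [Real.exp_le_one_iff]
      have : 0 < c / 2 * Real.exp x := by positivity
      linarith
    have h3 : 0 ≤ (2 * N).factorial * (1 / (c / 2)) ^ (2 * N) * Real.exp (-(N * x)) := by positivity
    have := mul_le_mul h1 h2 (Real.exp_pos _).le (Real.exp_pos _).le
    linarith
  · have h1 : Real.exp (α * x) ≤ Real.exp (N * x) := by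
      rw [Real.exp_le_exp]
      nlinarith [neg_abs_le α, le_abs_self α]
    have h2 := exp_neg_mul_exp_le (half_pos hc) (2 * N) x
    have h3 := mul_le_mul h1 h2 (Real.exp_pos _).le (Real.exp_pos _).le
    have h4 : Real.exp (N * x) * ((2 * N).factorial * (1 / (c / 2)) ^ (2 * N)
        * Real.exp (-((2 * N : ℕ) * x)))
        = (2 * N).factorial * (1 / (c / 2)) ^ (2 * N) * Real.exp (-(N * x)) := by
      rw [mul_left_comm, ← Real.exp_add]
      push_cast
      ring_nf
    rw [h4] at h3
    linarith [Real.exp_pos (-(N * x))]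

lemma IsStripKernel.exp_mul {φ : ℂ → ℂ} (h : IsStripKernel φ) (α : ℝ) :
    IsStripKernel fun t => Complex.exp (α * t) * φ t := by
  refine ⟨DifferentiableOn.mul (by fun_prop) h.diff, ?_⟩
  obtain ⟨c, hc, N, C, hb⟩ := h.decay
  obtain ⟨M, K, hK, hM⟩ := exists_exp_mul_exp_neg_le α hc
  have hC : 0 ≤ C := by
    have := (norm_nonneg _).trans (hb 0 (by simp [strip]))
    rw [mul_assoc] at this
    exact nonneg_of_mul_nonneg_left this (by positivity)
  refine ⟨c / 2, half_pos hc, N + M, C * K, fun t ht => ?_⟩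
  rw [norm_mul, Complex.norm_exp, Complex.re_ofReal_mul]
  calc _ ≤ Real.exp (α * t.re) * (C * Real.exp (-(N * t.re)) * Real.exp (-(c * Real.exp t.re))) := by
        gcongr; exact hb t ht
    _ = C * Real.exp (-(N * t.re)) * (Real.exp (α * t.re) * Real.exp (-(c * Real.exp t.re))) := by
        ring
    _ ≤ C * Real.exp (-(N * t.re)) * (K * Real.exp (-(M * t.re))
        * Real.exp (-(c / 2 * Real.exp t.re))) :=
        mul_le_mul_of_nonneg_left (hM t.re) (by positivity)
    _ = C * K * (Real.exp (-(N * t.re)) * Real.exp (-(M * t.re)))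
        * Real.exp (-(c / 2 * Real.exp t.re)) := by ring
    _ = _ := by rw [← Real.exp_add]; push_cast; ring_nf

/-- `Re e^t = e^{Re t} cos (Im t) ≥ e^{Re t} / 2` for `|Im t| < 1`: the strip is narrow enough for
the cosine to stay away from zero. -/
lemma isStripKernel_exp_neg_exp {c : ℝ} (hc : 0 < c) :
    IsStripKernel fun t => Complex.exp (-(c * Complex.exp t)) := by
  constructor
  · fun_prop
  · refine ⟨c / 2, half_pos hc, 0, 1, fun t ht => ?_⟩
    have ht : |t.im| < 1 := ht
    rw [Complex.norm_exp, one_mul, ← Real.exp_add, Real.exp_le_exp, Complex.neg_re,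
      Complex.re_ofReal_mul, Complex.exp_re]
    have h3 := mul_le_mul_of_nonneg_left (half_le_cos ht) (mul_pos hc (Real.exp_pos t.re)).le
    push_cast
    linarith

/-- The kernel of a holomorphic form. -/
def holoKernel (k : ℤ) (t : ℂ) : ℂ :=
  Complex.exp ((k / 2 : ℝ) * t) * Complex.exp (-((2 * π : ℝ) * Complex.exp t))

lemma isStripKernel_holoKernel (k : ℤ) : IsStripKernel (holoKernel k) :=
  (isStripKernel_exp_neg_exp Real.two_pi_pos).exp_mul _

/-- The inverse of the Mellin transform `(2π)^{-(w + k/2)} Γ(w + k/2)` of the kernel, entire because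
`1/Γ` is. -/
def holoInv (k : ℤ) (w : ℂ) : ℂ :=
  (Complex.Gamma (w + k / 2))⁻¹ * (2 * π : ℂ) ^ (w + (k : ℂ) / 2)

lemma differentiable_holoInv (k : ℤ) : Differentiable ℂ (holoInv k) := by
  unfold holoInv
  have h : (2 * π : ℂ) ≠ 0 := by exact_mod_cast Real.two_pi_pos.ne'
  refine (Complex.differentiable_one_div_Gamma.comp (by fun_prop :
    Differentiable ℂ fun w : ℂ => w + k / 2)).mul ?_
  exact fun w => (by fun_prop : DifferentiableAt ℂ (fun w : ℂ => w + k / 2) w).const_cpow (.inl h)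

lemma holoInv_mul_integral (k : ℤ) {w : ℂ} (hw : -(k / 2 : ℝ) < w.re) :
    holoInv k w * ∫ t : ℝ, holoKernel k t * Complex.exp (w * t) = 1 := by
  have hre : 0 < (w + k / 2).re := by
    rw [Complex.add_re, show (k / 2 : ℂ) = ((k / 2 : ℝ) : ℂ) by push_cast; rfl, Complex.ofReal_re]
    linarith
  have h := integral_exp_mul_exp_neg hre Real.two_pi_pos
  have h2 : ∫ t : ℝ, holoKernel k t * Complex.exp (w * t) = (1 / (2 * π : ℝ) : ℂ) ^ (w + k / 2)
      * Complex.Gamma (w + k / 2) := by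
    rw [← h]
    refine integral_congr_ae (.of_forall fun t => ?_)
    simp only [holoKernel]
    rw [← Complex.exp_add, ← Complex.exp_add, ← Complex.exp_add]
    push_cast
    ring_nf
  have h0 : (2 * π : ℂ) ≠ 0 := by exact_mod_cast Real.two_pi_pos.ne'
  have harg : (2 * π : ℂ).arg ≠ π := by
    rw [show (2 * π : ℂ) = ((2 * π : ℝ) : ℂ) by push_cast; rfl,
      Complex.arg_ofReal_of_nonneg Real.two_pi_pos.le]
    exact Real.pi_pos.ne
  rw [h2, holoInv]
  push_cast
  rw [one_div, Complex.inv_cpow _ _ harg]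
  have h3 : (2 * π : ℂ) ^ (w + (k : ℂ) / 2) ≠ 0 := by
    rw [Ne, Complex.cpow_eq_zero_iff]; exact fun h => h0 h.1
  have h4 := Complex.Gamma_ne_zero_of_re_pos hre
  rw [mul_mul_mul_comm, mul_comm (Complex.Gamma _)⁻¹, mul_mul_mul_comm, inv_mul_cancel₀ h3,
    inv_mul_cancel₀ h4, one_mul]

/-- Coefficients scaled by the size `n^{k/2}` of the Hecke bound. -/
def holoCoeff (k : ℤ) (a : ℕ → ℂ) (n : ℕ) : ℂ := a n * (n : ℂ) ^ (-((k : ℂ) / 2))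

lemma holoCoeff_mul (k : ℤ) (a : ℕ → ℂ) (n : ℕ+) :
    a n = holoCoeff k a n * ((n : ℕ) : ℂ) ^ ((k : ℂ) / 2) := by
  have hn : ((n : ℕ) : ℂ) ≠ 0 := by exact_mod_cast n.ne_zero
  rw [holoCoeff, mul_assoc, ← Complex.cpow_add _ _ hn, neg_add_cancel, Complex.cpow_zero, mul_one]

lemma exp_neg_two_log_sub (q : ℕ) [NeZero q] (t : ℝ) :
    Real.exp (-(2 * Real.log q) - t) = ((q : ℝ) ^ 2 * Real.exp t)⁻¹ := by
  have hq' : (0 : ℝ) < q := by exact_mod_cast NeZero.pos q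
  rw [Real.exp_sub, Real.exp_neg, two_mul, Real.exp_add, Real.exp_log hq', sq, div_eq_mul_inv,
    mul_inv (_ * _)]

/-- The point above `j'/q` at height `1 / (q ^ 2 e^t)`, whose logarithm is `-2 log q - t`. -/
lemma cusp_sub_inv (q : ℕ) [NeZero q] (j' : ℤ) (t : ℝ) :
    ((j' / q : ℝ) : ℂ) - 1 / ((q : ℂ) ^ 2 * ((Real.exp t : ℝ) * Complex.I))
      = (j' / q : ℝ) + (Real.exp (-(2 * Real.log q) - t) : ℝ) * Complex.I := by
  have hq : (q : ℂ) ≠ 0 := by exact_mod_cast NeZero.ne q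
  have hE : ((Real.exp t : ℝ) : ℂ) ≠ 0 := by exact_mod_cast (Real.exp_pos t).ne'
  rw [exp_neg_two_log_sub]
  push_cast
  field_simp
  linear_combination (-1 : ℂ) * Complex.I_sq

/-! ### Holomorphic cusp forms: expansion, inversion and orbit data -/

section

variable {k : ℤ} (f : CuspForm 𝒮ℒ k)

/-- Hecke's bound says that the scaled coefficients are bounded, so the exponent `0` will do. -/
lemma polyBounded_holoCoeff : PolyBounded (holoCoeff k fun n => (qExpansion 1 f).coeff n) := by
  have h := CuspFormClass.qExpansion_isBigO f
  rw [Subgroup.strictWidthInfty_SL2Z] at h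
  have h2 : (fun n => holoCoeff k (fun n => (qExpansion 1 f).coeff n) n)
      =O[atTop] fun _ : ℕ => (1 : ℝ) := by
    refine (h.mul (Asymptotics.isBigO_refl (fun n : ℕ => (n : ℂ) ^ (-((k : ℂ) / 2))) atTop).norm_right).trans
      (.of_bound 1 ?_)
    filter_upwards [eventually_gt_atTop 0] with n hn
    have hn' : (0 : ℝ) < n := by exact_mod_cast hn
    rw [norm_mul, norm_norm, Complex.norm_natCast_cpow_of_pos hn, Real.norm_of_nonneg (by positivity),
      ← Real.rpow_add hn', show (-((k : ℂ) / 2)).re = -(k / 2) by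
        rw [show (k / 2 : ℂ) = ((k / 2 : ℝ) : ℂ) by push_cast; rfl, Complex.neg_re,
          Complex.ofReal_re]]
    simp
  obtain ⟨C, hC⟩ := Asymptotics.isBigO_one_nat_atTop_iff.1 h2
  exact ⟨0, C, fun n => by simpa using hC n⟩

/-- The automorphy factor `e^{kt/2}` equals `n^{-k/2} e^{k (t + log n)/2}`: it scales the
coefficient and turns the exponential into a function of `t + log n`. The term `n = 0` vanishes by
cuspidality. -/
lemma hasSum_lift (x t : ℝ) : HasSum (fun n : ℕ+ =>
    holoCoeff k (fun n => (qExpansion 1 f).coeff n) n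
      * Complex.exp (2 * π * Complex.I * (n * x : ℝ)) * holoKernel k (t + (Real.log n : ℝ)))
    (lift k f (nMat x * aMat t)) := by
  have h := (ModularForm.hasSum_qExpansion f one_pos (by simp)
    (ofComplex ((x : ℂ) + (Real.exp t : ℝ) * Complex.I))).mul_left (Complex.exp (k * t / 2))
  rw [← lift_nMat_aMat, ← PNat.coe_injective.hasSum_iff] at h
  · refine h.congr_fun fun n => ?_
    have hn : ((n : ℕ) : ℂ) ≠ 0 := by exact_mod_cast n.ne_zero
    have hn' : (0 : ℝ) < (n : ℕ) := by exact_mod_cast n.pos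
    have e1 : Complex.exp (t + (Real.log n : ℝ)) = n * (Real.exp t : ℝ) := by
      rw [← Complex.ofReal_add, ← Complex.ofReal_exp, Real.exp_add, Real.exp_log hn']
      push_cast; ring
    rw [Function.comp_apply, holoCoeff, holoKernel, e1, Function.Periodic.qParam,
      ofComplex_apply_of_im_pos (im_add_exp_pos x t), ← Complex.exp_nat_mul,
      Complex.cpow_def_of_ne_zero hn, ← Complex.natCast_log]
    rw [mul_left_comm (Complex.exp _), mul_assoc, mul_assoc, ← Complex.exp_add, ← Complex.exp_add,
      ← Complex.exp_add, ← Complex.exp_add]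
    congr 2
    push_cast
    ring_nf
    rw [Complex.I_sq]
    ring
  · intro m hm
    have : m = 0 := by
      by_contra h0
      exact hm ⟨⟨m, Nat.pos_of_ne_zero h0⟩, rfl⟩
    rw [this, CuspFormClass.qExpansion_coeff_zero f one_pos (by simp)]
    simp

/-- The denominator of `cuspMat` at `j/q + i e^t` is `i q e^t`. The positive part of its `k`-th
power accounts for the change of `e^{kt/2}`, and `i ^ (-k)` remains. -/
lemma lift_cusp {q : ℕ} [NeZero q] {j j' : ℤ} (t : ℝ) (h : (q : ℤ) ∣ j * j' + 1) :
    lift k f (nMat (j / q) * aMat t) = Complex.I ^ (-k)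
      * lift k f (nMat (j' / q) * aMat (-(2 * Real.log q) - t)) := by
  obtain ⟨m, hm⟩ := h
  have hdet : (q : ℤ) * m - j * j' = 1 := by linarith
  have hq : (q : ℂ) ≠ 0 := by exact_mod_cast NeZero.ne q
  have hq' : (0 : ℝ) < q := by exact_mod_cast NeZero.pos q
  have hw : 0 < ((Real.exp t : ℝ) * Complex.I : ℂ).im := by
    rw [Complex.im_ofReal_mul, Complex.I_im, mul_one]; exact Real.exp_pos t
  have hE : ((Real.exp t : ℝ) : ℂ) ≠ 0 := by exact_mod_cast (Real.exp_pos t).ne'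
  have e1 := cusp_sub_inv q j' t
  have h1 : f (cuspMat j j' m q hdet • ofComplex ((j / q : ℝ) + (Real.exp t : ℝ) * Complex.I))
      = denom (cuspMat j j' m q hdet : GL (Fin 2) ℝ)
        (ofComplex ((j / q : ℝ) + (Real.exp t : ℝ) * Complex.I) : ℍ) ^ k
        * f (ofComplex ((j / q : ℝ) + (Real.exp t : ℝ) * Complex.I)) :=
    SlashInvariantForm.slash_action_eqn'' f (Set.mem_range_self _) _
  have h2 : denom (cuspMat j j' m q hdet : GL (Fin 2) ℝ)
      (ofComplex ((j / q : ℝ) + (Real.exp t : ℝ) * Complex.I) : ℍ)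
      = Complex.exp (Real.log q + t) * Complex.I := by
    rw [ofComplex_apply_of_im_pos (im_add_exp_pos _ t), denom, Complex.exp_add,
      ← Complex.ofReal_exp, Real.exp_log hq']
    have h10 : (cuspMat j j' m q hdet : GL (Fin 2) ℝ) 1 0 = ((q : ℤ) : ℝ) := rfl
    have h11 : (cuspMat j j' m q hdet : GL (Fin 2) ℝ) 1 1 = ((-j : ℤ) : ℝ) := rfl
    rw [h10, h11]
    push_cast
    field_simp
    ring
  rw [cuspMat_smul hdet hw, e1, h2, mul_zpow, ← Complex.exp_int_mul] at h1
  rw [lift_nMat_aMat, lift_nMat_aMat, h1, zpow_neg]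
  have h3 : Complex.exp (k * t / 2) = Complex.exp (k * (-(2 * Real.log q) - t : ℝ) / 2)
      * Complex.exp (k * (Real.log q + t)) := by
    rw [← Complex.exp_add]; push_cast; ring_nf
  rw [h3]
  have h4 : Complex.I ^ k ≠ 0 := zpow_ne_zero _ Complex.I_ne_zero
  field_simp

lemma orbitData_holo : OrbitData (lift k f) (holoCoeff k fun n => (qExpansion 1 f).coeff n)
    (holoKernel k) (holoInv k) (fun _ χ => χ.IsPrimitive) where
  kernel := isStripKernel_holoKernel k
  coeff := polyBounded_holoCoeff f
  diff := differentiable_holoInv k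
  mellin := ⟨_, fun _ hw => holoInv_mul_integral k hw⟩
  prim _ _ h := h
  inv _ χ h := by rwa [DirichletCharacter.isPrimitive_def, DirichletCharacter.conductor_inv]
  series _ _ χ h t := by
    refine orbitSum_series (Ψ := fun x => Complex.exp (2 * π * Complex.I * (x : ℝ)))
      (fun x t => hasSum_lift f x t) (fun n => ?_) t
    rw [← Int.cast_natCast (R := ZMod _), ← sum_char_mul_exp h n]
    push_cast
    rfl
  feq _ _ χ _ := orbitSum_feq χ (ω := Complex.I ^ (-k)) (by simp) fun _ _ t h => lift_cusp f t h

theorem isTwistedL_and_reducesToOrbitSums_holo :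
    (∀ (q : ℕ) [NeZero q] (χ : DirichletCharacter ℂ q), χ.IsPrimitive →
      IsTwistedL (fun n => (qExpansion 1 f).coeff n) k χ
        (twistedL (fun n => (qExpansion 1 f).coeff n) k χ)) ∧
    ∀ s : ℂ, ReducesToOrbitSums (lift k f) (lift k f)
      ![s, (k : ℂ), (Complex.Gamma (s + ((k : ℂ) - 1) / 2))⁻¹] s (fun _ χ => χ.IsPrimitive)
      (fun _ χ => twistedL (fun n => (qExpansion 1 f).coeff n) k χ⁻¹ s) := by
  refine ⟨fun q _ χ hχ => (orbitData_holo f).isTwistedL_twistedL (holoCoeff_mul k _) hχ,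
    fun s => (orbitData_holo f).reducesToOrbitSums_twistedL (holoCoeff_mul k _) rfl
      -- This is `(2π)^{s + (k-1)/2} Γ(s + (k-1)/2)⁻¹`, with `2π` written as four times `π / 2`.
      (.mul (.const 2) (.exp (.mul (.add (.const 0) (.div (.sub (.const 1) (.nat 1)) (.nat 2)))
        (.log (.mul (.nat 4) .halfPi))))) fun m => ?_⟩
  obtain ⟨h1, h2⟩ := Expr.ok_halfPi ![s, (k : ℂ), (Complex.Gamma (s + ((k : ℂ) - 1) / 2))⁻¹] m
  have h3 : (2 * π : ℂ) ≠ 0 := by exact_mod_cast Real.two_pi_pos.ne'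
  have h4 : (4 * (π / 2) : ℂ) = (2 * π : ℝ) := by push_cast; ring
  refine ⟨?_, ?_⟩
  · simp only [Expr.Ok, Expr.eval, UnOp.Ok, BinOp.Ok, h1, h2, BinOp.eval]
    norm_num
    rw [h4]
    exact Complex.ofReal_mem_slitPlane.2 Real.two_pi_pos
  · simp only [Expr.eval, UnOp.eval, h2, BinOp.eval, holoInv]
    norm_num
    rw [h4, Complex.cpow_def_of_ne_zero h3]
    push_cast
    ring_nf

end

/-! ### Integrals against `exp (- z cosh u)` -/

lemma exp_abs_le_two_mul_cosh (u : ℝ) : Real.exp |u| ≤ 2 * Real.cosh u := by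
  rw [← Real.cosh_abs, Real.cosh_eq]
  linarith [Real.exp_pos (-|u|)]

/-- Continuous functions bounded by a power of `cosh`. -/
structure CoshBounded (W : ℝ → ℂ) (M : ℕ) (C : ℝ) : Prop where
  continuous : Continuous W
  bound : ∀ u, ‖W u‖ ≤ C * Real.cosh u ^ M

lemma CoshBounded.nonneg {W : ℝ → ℂ} {M : ℕ} {C : ℝ} (h : CoshBounded W M C) : 0 ≤ C := by
  simpa using (norm_nonneg _).trans (h.bound 0)

lemma CoshBounded.cosh_mul {W : ℝ → ℂ} {M : ℕ} {C : ℝ} (h : CoshBounded W M C) :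
    CoshBounded (fun u => (Real.cosh u : ℂ) * W u) (M + 1) C where
  continuous := (Complex.continuous_ofReal.comp Real.continuous_cosh).mul h.continuous
  bound u := by
    rw [norm_mul, Complex.norm_real, Real.norm_of_nonneg (Real.cosh_pos u).le, pow_succ]
    nlinarith [h.bound u, Real.cosh_pos u]

lemma CoshBounded.sinh_mul {W : ℝ → ℂ} {M : ℕ} {C : ℝ} (h : CoshBounded W M C) :
    CoshBounded (fun u => (Real.sinh u : ℂ) * W u) (M + 1) C where
  continuous := (Complex.continuous_ofReal.comp Real.continuous_sinh).mul h.continuous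
  bound u := by
    have h1 : |Real.sinh u| ≤ Real.cosh u := by
      rw [Real.abs_sinh, ← Real.cosh_abs]
      exact (Real.sinh_lt_cosh _).le
    rw [norm_mul, Complex.norm_real, Real.norm_eq_abs, pow_succ]
    calc _ ≤ Real.cosh u * (C * Real.cosh u ^ M) :=
          mul_le_mul h1 (h.bound u) (norm_nonneg _) (Real.cosh_pos u).le
      _ = _ := by ring

/-- The exponent is halved. As `cosh u ≥ 1`, one half gives `e^{-a/2}`, the source of decay in `a`;
the other gives `cosh u ^ (-(M + 1))`, which beats `W` and leaves `1 / cosh u ≤ 2 e^{-|u|}`. -/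
lemma CoshBounded.norm_exp_mul_le {W : ℝ → ℂ} {M : ℕ} {C : ℝ} (h : CoshBounded W M C) {a : ℝ}
    (ha : 0 < a) {z : ℂ} (hz : a ≤ z.re) (u : ℝ) :
    ‖Complex.exp (-(z * Real.cosh u)) * W u‖ ≤
      2 * C * (M + 1).factorial * (2 / a) ^ (M + 1) * Real.exp (-(a / 2)) * Real.exp (-|u|) := by
  have hc := Real.one_le_cosh u
  have hc0 := Real.cosh_pos u
  have h1 : ‖Complex.exp (-(z * Real.cosh u))‖ ≤ Real.exp (-(a / 2)) *
      Real.exp (-(a / 2 * Real.cosh u)) := by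
    rw [Complex.norm_exp, ← Real.exp_add, Real.exp_le_exp, Complex.neg_re, Complex.re_mul_ofReal]
    nlinarith
  have h2 : Real.exp (-(a / 2 * Real.cosh u))
      ≤ (M + 1).factorial * (2 / a) ^ (M + 1) * (Real.cosh u ^ (M + 1))⁻¹ := by
    have := exp_neg_mul_exp_le (half_pos ha) (M + 1) (Real.log (Real.cosh u))
    rwa [Real.exp_log hc0, Real.exp_neg (((M + 1 : ℕ) : ℝ) * _), Real.exp_nat_mul, Real.exp_log hc0,
      one_div_div] at this
  have h3 : (Real.cosh u)⁻¹ ≤ 2 * Real.exp (-|u|) := by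
    have := exp_abs_le_two_mul_cosh u
    rw [Real.exp_neg, inv_le_iff_one_le_mul₀ hc0, mul_right_comm, ← div_eq_mul_inv,
      le_div_iff₀ (Real.exp_pos _)]
    linarith
  have hC := h.nonneg
  rw [norm_mul]
  calc _ ≤ (Real.exp (-(a / 2)) * ((M + 1).factorial * (2 / a) ^ (M + 1)
        * (Real.cosh u ^ (M + 1))⁻¹)) * (C * Real.cosh u ^ M) := by
        gcongr
        · exact h1.trans (by gcongr)
        · exact h.bound u
    _ = C * (M + 1).factorial * (2 / a) ^ (M + 1) * Real.exp (-(a / 2)) * (Real.cosh u)⁻¹ := by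
        field_simp
        ring
    _ ≤ C * (M + 1).factorial * (2 / a) ^ (M + 1) * Real.exp (-(a / 2)) * (2 * Real.exp (-|u|)) := by
        gcongr
    _ = _ := by ring

lemma CoshBounded.continuous_exp_mul {W : ℝ → ℂ} {M : ℕ} {C : ℝ} (h : CoshBounded W M C) (z : ℂ) :
    Continuous fun u => Complex.exp (-(z * Real.cosh u)) * W u :=
  (Complex.continuous_exp.comp (continuous_const.mul
    (Complex.continuous_ofReal.comp Real.continuous_cosh)).neg).mul h.continuous

lemma CoshBounded.integrable {W : ℝ → ℂ} {M : ℕ} {C : ℝ} (h : CoshBounded W M C) {z : ℂ}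
    (hz : 0 < z.re) : Integrable fun u => Complex.exp (-(z * Real.cosh u)) * W u :=
  (integrable_exp_neg_abs.const_mul _).mono' (h.continuous_exp_mul z).aestronglyMeasurable
    (.of_forall (h.norm_exp_mul_le hz le_rfl))

/-- `∫ exp(-z cosh u) W(u) du`. -/
def coshIntegral (W : ℝ → ℂ) (z : ℂ) : ℂ := ∫ u : ℝ, Complex.exp (-(z * Real.cosh u)) * W u

lemma CoshBounded.norm_coshIntegral_le {W : ℝ → ℂ} {M : ℕ} {C : ℝ} (h : CoshBounded W M C) {a : ℝ}
    (ha : 0 < a) {z : ℂ} (hz : a ≤ z.re) : ‖coshIntegral W z‖ ≤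
      4 * C * (M + 1).factorial * (2 / a) ^ (M + 1) * Real.exp (-(a / 2)) := by
  refine (norm_integral_le_of_norm_le (integrable_exp_neg_abs.const_mul _)
    (.of_forall (h.norm_exp_mul_le ha hz))).trans_eq ?_
  rw [integral_const_mul, integral_exp_neg_abs]
  ring

lemma CoshBounded.hasDerivAt {W : ℝ → ℂ} {M : ℕ} {C : ℝ} (h : CoshBounded W M C) {z : ℂ}
    (hz : 0 < z.re) : HasDerivAt (coshIntegral W)
      (-coshIntegral (fun u => (Real.cosh u : ℂ) * W u) z) z := by
  have hball : ∀ w ∈ Metric.ball z (z.re / 2), z.re / 2 ≤ w.re := by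
    intro w hw
    have h1 := (Complex.abs_re_le_norm (w - z)).trans_lt (mem_ball_iff_norm.1 hw)
    rw [Complex.sub_re] at h1
    linarith [(abs_lt.1 h1).1]
  have := (hasDerivAt_integral_of_dominated_loc_of_deriv_le
    (F := fun z u => Complex.exp (-(z * Real.cosh u)) * W u)
    (F' := fun z u => -(Complex.exp (-(z * Real.cosh u)) * ((Real.cosh u : ℂ) * W u)))
    (Metric.ball_mem_nhds z (half_pos hz))
    (.of_forall fun w => (h.continuous_exp_mul w).aestronglyMeasurable) (h.integrable hz)
    (h.cosh_mul.continuous_exp_mul z).neg.aestronglyMeasurable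
    (.of_forall fun u w hw => (norm_neg _).trans_le
      (h.cosh_mul.norm_exp_mul_le (half_pos hz) (hball w hw) u))
    (integrable_exp_neg_abs.const_mul _) (.of_forall fun u w _ => ?_)).2
  · rwa [integral_neg] at this
  · have h1 : HasDerivAt (fun w : ℂ => -(w * Real.cosh u)) (-(1 * Real.cosh u)) w :=
      ((hasDerivAt_id w).mul_const _).neg
    refine (h1.cexp.mul_const (W u)).congr_deriv ?_
    ring

/-- The parameter `r` may be complex, and then the functions grow like `e^{|Im r| |u|} ≤ (2 cosh u)
^ M`. -/
lemma coshBounded_cos (r : ℂ) : ∃ M C, CoshBounded (fun u => Complex.cos (r * u)) M C ∧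
    CoshBounded (fun u => Complex.sin (r * u)) M C := by
  obtain ⟨M, hM⟩ := exists_nat_ge |r.im|
  have key : ∀ u : ℝ, ‖Complex.exp (r * u * Complex.I)‖ ≤ 2 ^ M * Real.cosh u ^ M ∧
      ‖Complex.exp (-(r * u) * Complex.I)‖ ≤ 2 ^ M * Real.cosh u ^ M := by
    intro u
    have h1 : Real.exp (M * |u|) ≤ 2 ^ M * Real.cosh u ^ M := by
      rw [Real.exp_nat_mul, ← mul_pow]
      exact pow_le_pow_left₀ (Real.exp_pos _).le (exp_abs_le_two_mul_cosh u) _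
    have h2 : |r.im * u| ≤ M * |u| := by
      rw [abs_mul]; exact mul_le_mul_of_nonneg_right hM (abs_nonneg u)
    constructor <;> refine le_trans ?_ h1 <;> rw [Complex.norm_exp, Real.exp_le_exp] <;>
      refine le_trans ?_ h2
    · rw [Complex.mul_I_re, Complex.im_mul_ofReal]; exact neg_le_abs _
    · rw [Complex.mul_I_re, Complex.neg_im, neg_neg, Complex.im_mul_ofReal]; exact le_abs_self _
  refine ⟨M, 2 ^ M, ⟨by fun_prop, fun u => ?_⟩, ⟨by fun_prop, fun u => ?_⟩⟩
  · rw [Complex.cos, norm_div, Complex.norm_two]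
    have := norm_add_le (Complex.exp (r * u * Complex.I)) (Complex.exp (-(r * u) * Complex.I))
    linarith [(key u).1, (key u).2]
  · rw [Complex.sin, norm_div, Complex.norm_two, norm_mul, Complex.norm_I, mul_one]
    have := norm_sub_le (Complex.exp (-(r * u) * Complex.I)) (Complex.exp (r * u * Complex.I))
    linarith [(key u).1, (key u).2]

/-- The differential equation of the Bessel function. -/
lemma coshIntegral_bessel (r : ℂ) {z : ℂ} (hz : 0 < z.re) :
    z ^ 2 * coshIntegral (fun u => (Real.cosh u : ℂ) * ((Real.cosh u : ℂ) * Complex.cos (r * u))) z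
      - z * coshIntegral (fun u => (Real.cosh u : ℂ) * Complex.cos (r * u)) z
      = (z ^ 2 - r ^ 2) * coshIntegral (fun u => Complex.cos (r * u)) z := by
  obtain ⟨M, C, hc, hs⟩ := coshBounded_cos r
  have i0 := hc.integrable hz
  have i1 := hc.cosh_mul.integrable hz
  have i2 := hc.cosh_mul.cosh_mul.integrable hz
  have i21 : Integrable fun u : ℝ => z ^ 2 * (Complex.exp (-(z * Real.cosh u)) *
        ((Real.cosh u : ℂ) * ((Real.cosh u : ℂ) * Complex.cos (r * u))))
      - z * (Complex.exp (-(z * Real.cosh u)) * ((Real.cosh u : ℂ) * Complex.cos (r * u))) :=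
    (i2.const_mul _).sub (i1.const_mul _)
  -- The difference of the two sides is the integral of an exact derivative, by `cosh² - sinh² = 1`,
  -- hence zero.
  have h := integral_eq_zero_of_hasDerivAt_of_integrable
    (f := fun u : ℝ => r * (Complex.exp (-(z * Real.cosh u)) * Complex.sin (r * u))
      - z * (Complex.exp (-(z * Real.cosh u)) * (Real.sinh u * Complex.cos (r * u))))
    (f' := fun u : ℝ => z ^ 2 * (Complex.exp (-(z * Real.cosh u)) *
        ((Real.cosh u : ℂ) * ((Real.cosh u : ℂ) * Complex.cos (r * u))))
      - z * (Complex.exp (-(z * Real.cosh u)) * ((Real.cosh u : ℂ) * Complex.cos (r * u)))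
      - (z ^ 2 - r ^ 2) * (Complex.exp (-(z * Real.cosh u)) * Complex.cos (r * u)))
    (fun u => ?_) (i21.sub (i0.const_mul _))
    (((hs.integrable hz).const_mul _).sub ((hc.sinh_mul.integrable hz).const_mul _))
  · rw [integral_sub i21 (i0.const_mul _),
      integral_sub (i2.const_mul _) (i1.const_mul _), integral_const_mul, integral_const_mul,
      integral_const_mul, sub_eq_zero] at h
    exact h
  · have hch : HasDerivAt (fun u : ℝ => (Real.cosh u : ℂ)) (Real.sinh u) u :=
      (Real.hasDerivAt_cosh u).ofReal_comp
    have hsh : HasDerivAt (fun u : ℝ => (Real.sinh u : ℂ)) (Real.cosh u) u :=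
      (Real.hasDerivAt_sinh u).ofReal_comp
    have hru : HasDerivAt (fun u : ℂ => r * u) (r * 1) u := (hasDerivAt_id (u : ℂ)).const_mul r
    have hE : HasDerivAt (fun u : ℝ => Complex.exp (-(z * Real.cosh u))) _ u :=
      (hch.const_mul z).neg.cexp
    have hsin : HasDerivAt (fun u : ℝ => Complex.sin (r * (u : ℂ))) _ u := hru.csin.comp_ofReal
    have hcos : HasDerivAt (fun u : ℝ => Complex.cos (r * (u : ℂ))) _ u := hru.ccos.comp_ofReal
    refine (((hE.mul hsin).const_mul r).sub ((hE.mul (hsh.mul hcos)).const_mul z)).congr_deriv ?_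
    simp only [Pi.mul_apply, Pi.neg_apply]
    have hid : (Real.cosh u : ℂ) ^ 2 - (Real.sinh u : ℂ) ^ 2 = 1 := by
      exact_mod_cast Real.cosh_sq_sub_sinh_sq u
    linear_combination (-z ^ 2 * Complex.exp (-(z * Real.cosh u)) * Complex.cos (r * u)) * hid

/-! ### The Bessel kernel -/

lemma half_exp_le_re_exp {t : ℂ} (ht : t ∈ strip) : Real.exp t.re / 2 ≤ (Complex.exp t).re := by
  rw [Complex.exp_re]
  have := mul_le_mul_of_nonneg_left (half_le_cos ht) (Real.exp_pos t.re).le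
  linarith

/-- The bound for the integral is used with `a = e^{Re t} / 2`, so that `e^{-a/2}` becomes doubly
exponential in `t`. -/
lemma CoshBounded.isStripKernel {W : ℝ → ℂ} {M : ℕ} {C : ℝ} (h : CoshBounded W M C) :
    IsStripKernel fun t => coshIntegral W (Complex.exp t) := by
  have hpos : ∀ t : ℂ, 0 < Real.exp t.re / 2 := fun t => by positivity
  constructor
  · intro t ht
    exact ((h.hasDerivAt ((hpos t).trans_le (half_exp_le_re_exp ht))).comp t
      (Complex.hasDerivAt_exp t)).differentiableAt.differentiableWithinAt
  · refine ⟨1 / 4, by norm_num, M + 1, 4 * C * (M + 1).factorial * 4 ^ (M + 1), fun t ht => ?_⟩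
    refine (h.norm_coshIntegral_le (hpos t) (half_exp_le_re_exp ht)).trans_eq ?_
    rw [Real.exp_neg (((M + 1 : ℕ) : ℝ) * t.re), Real.exp_nat_mul, div_div_eq_mul_div, div_pow]
    norm_num
    rw [show Real.exp t.re / 2 / 2 = 1 / 4 * Real.exp t.re by ring]
    ring

/-- `K_{ir}(e^t)`. -/
def besselKernel (r t : ℂ) : ℂ := coshIntegral (fun u => Complex.cos (r * u)) (Complex.exp t) / 2

/-- The derivative of the Bessel kernel. -/
def besselKernel' (r t : ℂ) : ℂ := Complex.exp ((1 : ℝ) * t) *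
  (-1 / 2 * coshIntegral (fun u => (Real.cosh u : ℂ) * Complex.cos (r * u)) (Complex.exp t))

lemma IsStripKernel.const_mul {φ : ℂ → ℂ} (h : IsStripKernel φ) (a : ℂ) :
    IsStripKernel fun t => a * φ t := by
  refine ⟨h.diff.const_mul a, ?_⟩
  obtain ⟨c, hc, N, C, hb⟩ := h.decay
  refine ⟨c, hc, N, ‖a‖ * C, fun t ht => ?_⟩
  rw [norm_mul, mul_assoc, mul_assoc, ← mul_assoc C]
  exact mul_le_mul_of_nonneg_left (hb t ht) (norm_nonneg a)

lemma IsStripKernel.comp_add {φ : ℂ → ℂ} (h : IsStripKernel φ) (a : ℝ) :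
    IsStripKernel fun t => φ (t + a) := by
  refine ⟨h.diff.comp (by fun_prop) fun t ht => add_log_mem_strip ht a, ?_⟩
  obtain ⟨c, hc, N, C, hb⟩ := h.decay
  refine ⟨c * Real.exp a, by positivity, N, C * Real.exp (-(N * a)), fun t ht => ?_⟩
  refine (hb _ (add_log_mem_strip ht a)).trans_eq ?_
  rw [Complex.add_re, Complex.ofReal_re, mul_add, neg_add, Real.exp_add, Real.exp_add]
  ring_nf

lemma isStripKernel_besselKernel (r : ℂ) : IsStripKernel (besselKernel r) := by
  obtain ⟨M, C, hc, -⟩ := coshBounded_cos r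
  convert hc.isStripKernel.const_mul (1 / 2) using 2 with t
  rw [besselKernel]; ring

lemma isStripKernel_besselKernel' (r : ℂ) : IsStripKernel (besselKernel' r) := by
  obtain ⟨M, C, hc, -⟩ := coshBounded_cos r
  exact (hc.cosh_mul.isStripKernel.const_mul (-1 / 2)).exp_mul 1

lemma re_exp_ofReal_pos (t : ℝ) : 0 < (Complex.exp t).re := by
  rw [← Complex.ofReal_exp, Complex.ofReal_re]; exact Real.exp_pos t

lemma hasDerivAt_besselKernel (r : ℂ) (t : ℝ) :
    HasDerivAt (fun t : ℝ => besselKernel r t) (besselKernel' r t) t := by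
  obtain ⟨M, C, hc, -⟩ := coshBounded_cos r
  have h := (((hc.hasDerivAt (re_exp_ofReal_pos t)).comp (t : ℂ)
    (Complex.hasDerivAt_exp t)).div_const 2).comp_ofReal
  refine h.congr_deriv ?_
  rw [besselKernel']
  push_cast
  ring_nf

/-- In the logarithmic variable the Bessel equation has no first order term: `K'' = (e^{2t} - r²)
K`. -/
lemma hasDerivAt_besselKernel' (r : ℂ) (t : ℝ) : HasDerivAt (fun t : ℝ => besselKernel' r t)
    (((Real.exp t : ℂ) ^ 2 - r ^ 2) * besselKernel r t) t := by
  obtain ⟨M, C, hc, -⟩ := coshBounded_cos r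
  have h1 := ((hc.cosh_mul.hasDerivAt (re_exp_ofReal_pos t)).comp (t : ℂ)
    (Complex.hasDerivAt_exp t)).const_mul (-1 / 2)
  have h2 := ((((hasDerivAt_id (t : ℂ)).const_mul ((1 : ℝ) : ℂ)).cexp).mul h1).comp_ofReal
  refine h2.congr_deriv ?_
  have h3 := coshIntegral_bessel r (re_exp_ofReal_pos t)
  simp only [id, Function.comp_apply, Complex.ofReal_one, one_mul, mul_one, besselKernel,
    Complex.ofReal_exp]
  linear_combination (1 / 2) * h3

lemma besselK_exp (r : ℂ) (t : ℝ) : besselK r (Real.exp t) = besselKernel r t := by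
  obtain ⟨M, C, hc, -⟩ := coshBounded_cos r
  have hi := hc.integrable (re_exp_ofReal_pos t)
  rw [besselKernel, coshIntegral, eq_div_iff two_ne_zero, ← integral_add_compl measurableSet_Ioi hi,
    Set.compl_Ioi, mul_two]
  have h1 : besselK r (Real.exp t) = ∫ u in Set.Ioi (0 : ℝ),
      Complex.exp (-(Complex.exp t * Real.cosh u)) * Complex.cos (r * u) := by
    rw [besselK]
    refine integral_congr_ae (.of_forall fun u => ?_)
    simp only
    push_cast
    rfl
  rw [h1]
  congr 1
  have h2 := integral_comp_neg_Iic (0 : ℝ)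
    fun u => Complex.exp (-(Complex.exp t * Real.cosh u)) * Complex.cos (r * u)
  rw [neg_zero] at h2
  rw [← h2]
  simp

/-- A two-dimensional change of variables. -/
lemma integral_mul_integral_eq {F G : ℝ → ℂ} (hF : Continuous F) (hG : Continuous G)
    (h : Integrable (fun p : ℝ × ℝ => F (p.1 + p.2) * G (p.1 - p.2))) :
    (∫ a, F a) * ∫ b, G b = 2 * ∫ t : ℝ, ∫ u : ℝ, F (t + u) * G (t - u) := by
  have hswap : Integrable (fun p : ℝ × ℝ => F (p.1 + p.2) * G (p.2 - p.1)) := by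
    have := h.swap
    simp only [Function.comp_def, Prod.fst_swap, Prod.snd_swap, add_comm] at this
    exact this
  have hcont : Continuous fun p : ℝ × ℝ => F p.2 * G (p.2 - 2 * p.1) := by fun_prop
  have h2 : Integrable (fun p : ℝ × ℝ => F p.2 * G (p.2 - 2 * p.1)) := by
    refine ((measurePreserving_prod_add (volume : Measure ℝ) (volume : Measure ℝ)).integrable_comp
      hcont.aestronglyMeasurable).1 ?_
    refine (integrable_congr (.of_forall fun p => ?_)).1 hswap
    simp only [Function.comp_apply]
    ring_nf
  rw [integral_integral_swap h]
  have e1 : ∀ u : ℝ, ∫ t : ℝ, F (t + u) * G (t - u) = ∫ a : ℝ, F a * G (a - 2 * u) := by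
    intro u
    rw [← integral_add_right_eq_self (fun a => F a * G (a - 2 * u)) u]
    congr 1 with t
    ring_nf
  simp_rw [e1]
  rw [integral_integral_swap h2, ← integral_mul_const, ← integral_const_mul]
  congr 1 with a
  rw [integral_const_mul]
  have e2 : ∫ u : ℝ, G (a - 2 * u) = 2⁻¹ * ∫ b, G b := by
    rw [Measure.integral_comp_mul_left (fun u => G (a - u)) 2, integral_sub_left_eq_self G volume a,
      Complex.real_smul]
    norm_num
  rw [e2]
  ring

lemma coshBounded_exp (r : ℂ) :
    ∃ M C, CoshBounded (fun u => Complex.exp (r * u * Complex.I)) M C := by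
  obtain ⟨M, C, hc, hs⟩ := coshBounded_cos r
  refine ⟨M, 2 * C, by fun_prop, fun u => ?_⟩
  rw [Complex.exp_mul_I]
  refine (norm_add_le _ _).trans ?_
  rw [norm_mul, Complex.norm_I, mul_one]
  linarith [hc.bound u, hs.bound u]

/-- The integrand of the double integral for the Mellin transform of the Bessel kernel. -/
def besselIntegrand (r w : ℂ) (t u : ℝ) : ℂ := Complex.exp (w * t) *
  (Complex.exp (-(Complex.exp t * Real.cosh u)) * Complex.exp (r * u * Complex.I))

lemma integrable_besselIntegrand (r : ℂ) : ∃ σ : ℝ, ∀ w : ℂ, σ < w.re →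
    Integrable fun p : ℝ × ℝ => besselIntegrand r w p.1 p.2 := by
  obtain ⟨M, C, h⟩ := coshBounded_exp r
  refine ⟨M + 2, fun w hw => ?_⟩
  obtain ⟨K, hK⟩ := exp_mul_sub_exp_le (c := 1 / 2) (α := w.re - (M + 1)) (by norm_num)
    (by linarith)
  have hC := h.nonneg
  refine ((integrable_exp_neg_abs.mul_prod integrable_exp_neg_abs).const_mul
    (2 * C * (M + 1).factorial * 2 ^ (M + 1) * K)).mono' ?_ (.of_forall fun p => ?_)
  · unfold besselIntegrand
    exact Continuous.aestronglyMeasurable (by fun_prop)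
  · have h1 := h.norm_exp_mul_le (Real.exp_pos p.1) (z := Complex.exp p.1)
      (by rw [← Complex.ofReal_exp, Complex.ofReal_re]) p.2
    have e : Real.exp (w.re * p.1) = Real.exp ((w.re - (M + 1)) * p.1) * Real.exp p.1 ^ (M + 1) := by
      rw [← Real.exp_nat_mul, ← Real.exp_add]
      push_cast
      ring_nf
    rw [besselIntegrand, norm_mul, norm_exp_mul_ofReal, e]
    calc _ ≤ Real.exp ((w.re - (M + 1)) * p.1) * Real.exp p.1 ^ (M + 1) * _ :=
          mul_le_mul_of_nonneg_left h1 (by positivity)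
      _ = 2 * C * (M + 1).factorial * 2 ^ (M + 1) * (Real.exp ((w.re - (M + 1)) * p.1) *
          Real.exp (-(1 / 2 * Real.exp p.1))) * Real.exp (-|p.2|) := by
          rw [div_pow]
          field_simp
      _ ≤ 2 * C * (M + 1).factorial * 2 ^ (M + 1) * (K * Real.exp (-|p.1|)) * Real.exp (-|p.2|) := by
          have := hK p.1
          gcongr
      _ = _ := by ring

/-- As `e^t cosh u = (e^{t+u} + e^{t-u}) / 2`, the integrand is a product of functions of `t + u`
and of `t - u`, and the double integral splits into two Gamma integrals. -/
lemma integral_besselIntegrand {r w : ℂ} (h1 : 0 < (w + Complex.I * r).re)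
    (h2 : 0 < (w - Complex.I * r).re)
    (hi : Integrable fun p : ℝ × ℝ => besselIntegrand r w p.1 p.2) :
    2 * ∫ t : ℝ, ∫ u : ℝ, besselIntegrand r w t u = 2 ^ w *
      (Complex.Gamma ((w + Complex.I * r) / 2) * Complex.Gamma ((w - Complex.I * r) / 2)) := by
  have g1 := integral_exp_mul_exp_neg (a := (w + Complex.I * r) / 2) (r := 1 / 2)
    (by rw [Complex.div_ofNat_re]; positivity) (by norm_num)
  have g2 := integral_exp_mul_exp_neg (a := (w - Complex.I * r) / 2) (r := 1 / 2)
    (by rw [Complex.div_ofNat_re]; positivity) (by norm_num)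
  have e : ∀ t u : ℝ, besselIntegrand r w t u =
      (Complex.exp ((w + Complex.I * r) / 2 * (t + u : ℝ)) *
        Complex.exp (-(1 / 2 * Real.exp (t + u) : ℝ))) *
      (Complex.exp ((w - Complex.I * r) / 2 * (t - u : ℝ)) *
        Complex.exp (-(1 / 2 * Real.exp (t - u) : ℝ))) := by
    intro t u
    rw [besselIntegrand, ← Complex.exp_add, ← Complex.exp_add, ← Complex.exp_add,
      ← Complex.exp_add, ← Complex.exp_add, Real.exp_add, Real.exp_sub, Real.cosh_eq, Real.exp_neg]
    congr 1
    push_cast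
    field_simp
    ring
  have h0 : (2 : ℂ) ≠ 0 := two_ne_zero
  have h3 := integral_mul_integral_eq
    (F := fun a : ℝ => Complex.exp ((w + Complex.I * r) / 2 * a) *
      Complex.exp (-(1 / 2 * Real.exp a : ℝ)))
    (G := fun a : ℝ => Complex.exp ((w - Complex.I * r) / 2 * a) *
      Complex.exp (-(1 / 2 * Real.exp a : ℝ))) (by fun_prop) (by fun_prop) (by simpa only [e] using hi)
  simp_rw [e]
  rw [← h3, g1, g2, show (1 / (1 / 2 : ℝ) : ℂ) = 2 by push_cast; norm_num, mul_mul_mul_comm,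
    ← Complex.cpow_add _ _ h0]
  ring_nf

/-- The Mellin transform of the Bessel kernel. -/
lemma integral_besselKernel (r : ℂ) : ∃ σ : ℝ, ∀ w : ℂ, σ < w.re →
    4 * ∫ t : ℝ, besselKernel r t * Complex.exp (w * t) = 2 ^ w *
      (Complex.Gamma ((w + Complex.I * r) / 2) * Complex.Gamma ((w - Complex.I * r) / 2)) := by
  obtain ⟨σ₁, h₁⟩ := integrable_besselIntegrand r
  obtain ⟨σ₂, h₂⟩ := integrable_besselIntegrand (-r)
  obtain ⟨M, C, hE⟩ := coshBounded_exp r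
  obtain ⟨M', C', hE'⟩ := coshBounded_exp (-r)
  refine ⟨max (max σ₁ σ₂) |r.im|, fun w hw => ?_⟩
  have i1 := h₁ w (((le_max_left _ _).trans (le_max_left _ _)).trans_lt hw)
  have i2 := h₂ w (((le_max_right _ _).trans (le_max_left _ _)).trans_lt hw)
  have hr := abs_lt.1 ((le_max_right _ _).trans_lt hw)
  have p1 : 0 < (w + Complex.I * r).re := by rw [Complex.add_re, Complex.I_mul_re]; linarith
  have p2 : 0 < (w - Complex.I * r).re := by rw [Complex.sub_re, Complex.I_mul_re]; linarith
  have j1 := integral_besselIntegrand p1 p2 i1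
  have j2 := integral_besselIntegrand (r := -r) (w := w) (by rwa [mul_neg, ← sub_eq_add_neg])
    (by rwa [mul_neg, sub_neg_eq_add]) i2
  rw [mul_neg, sub_neg_eq_add, ← sub_eq_add_neg, mul_comm (Complex.Gamma _)] at j2
  -- One factor `2` comes from writing the cosine as half a sum of exponentials with `r` and `-r`,
  -- the other from the `2` in the definition of `besselKernel`.
  have e : ∀ t : ℝ, 4 * (besselKernel r t * Complex.exp (w * t)) =
      (∫ u : ℝ, besselIntegrand r w t u) + ∫ u : ℝ, besselIntegrand (-r) w t u := by
    intro t
    have k1 : Integrable fun u : ℝ => besselIntegrand r w t u :=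
      (hE.integrable (re_exp_ofReal_pos t)).const_mul _
    have k2 : Integrable fun u : ℝ => besselIntegrand (-r) w t u :=
      (hE'.integrable (re_exp_ofReal_pos t)).const_mul _
    rw [← integral_add k1 k2, besselKernel, coshIntegral, div_mul_eq_mul_div, ← integral_mul_const,
      mul_div_assoc', ← integral_const_mul, ← integral_div]
    congr 1 with u
    rw [besselIntegrand, besselIntegrand, Complex.cos, neg_mul]
    ring
  rw [← integral_const_mul]
  simp_rw [e]
  rw [integral_add (by exact i1.integral_prod_left) (by exact i2.integral_prod_left)]
  linear_combination (1 / 2) * j1 + (1 / 2) * j2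

/-- Otherwise its Mellin transform would vanish, but Gamma has no zeros. -/
lemma exists_besselKernel_ne_zero (r : ℂ) : ∃ t : ℝ, besselKernel r t ≠ 0 := by
  by_contra! h
  obtain ⟨σ, hσ⟩ := integral_besselKernel r
  set w : ℂ := ((max σ |r.im| + 1 : ℝ) : ℂ) with hw
  have hre : w.re = max σ |r.im| + 1 := Complex.ofReal_re _
  have := hσ w (by rw [hre]; linarith [le_max_left σ |r.im|])
  simp only [h, zero_mul, integral_zero, mul_zero] at this
  have hr : |r.im| < w.re := by rw [hre]; linarith [le_max_right σ |r.im|]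
  have hr' := abs_lt.1 hr
  have h2 : (2 : ℂ) ^ w ≠ 0 := by simp [Complex.cpow_eq_zero_iff]
  refine mul_ne_zero h2 (mul_ne_zero (Complex.Gamma_ne_zero_of_re_pos ?_)
    (Complex.Gamma_ne_zero_of_re_pos ?_)) this.symm
  · rw [Complex.div_ofNat_re, Complex.add_re, Complex.I_mul_re]; linarith
  · rw [Complex.div_ofNat_re, Complex.sub_re, Complex.I_mul_re]; linarith

/-! ### Second order linear differential equations -/

lemma eq_zero_of_hasDerivAt_hasDerivAt {V d d' : ℝ → ℂ} (hV : Continuous V)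
    (h1 : ∀ t, HasDerivAt d (d' t) t) (h2 : ∀ t, HasDerivAt d' (V t * d t) t) {t₀ : ℝ}
    (h3 : d t₀ = 0) (h4 : d' t₀ = 0) (t : ℝ) : d t = 0 := by
  set R := max |t| |t₀| + 1 with hR
  obtain ⟨M, hM⟩ := (isCompact_Icc (a := -R) (b := R)).exists_bound_of_continuousOn hV.continuousOn
  have hlip : ∀ s ∈ Set.Ioo (-R) R, LipschitzOnWith ⟨max 1 M, by positivity⟩
      (fun p : ℂ × ℂ => (p.2, V s * p.1)) Set.univ := by
    intro s hs
    refine LipschitzWith.lipschitzOnWith (LipschitzWith.of_dist_le_mul fun p p' => ?_)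
    rw [Prod.dist_eq, Prod.dist_eq]
    simp only [dist_eq_norm]
    have hMs : ‖V s‖ ≤ max 1 M := (hM s (Set.Ioo_subset_Icc_self hs)).trans (le_max_right _ _)
    refine max_le ?_ ?_
    · calc ‖p.2 - p'.2‖ = 1 * ‖p.2 - p'.2‖ := (one_mul _).symm
        _ ≤ _ := mul_le_mul (le_max_left _ _) (le_max_right _ _) (norm_nonneg _) (by positivity)
    · rw [← mul_sub, norm_mul]
      exact mul_le_mul hMs (le_max_left _ _) (norm_nonneg _) (NNReal.coe_nonneg _)
  have hmem : ∀ s : ℝ, |s| < R → s ∈ Set.Ioo (-R) R := fun s hs => abs_lt.1 hs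
  have := ODE_solution_unique_of_mem_Ioo (f := fun t => (d t, d' t)) (g := fun _ => (0, 0)) hlip
    (hmem t₀ (by rw [hR]; linarith [le_max_right |t| |t₀|]))
    (fun s _ => ⟨(h1 s).prodMk (h2 s), Set.mem_univ _⟩)
    (fun s _ => ⟨by simpa using! hasDerivAt_const s ((0, 0) : ℂ × ℂ), Set.mem_univ _⟩)
    (by simp [h3, h4]) (hmem t (by rw [hR]; linarith [le_max_left |t| |t₀|]))
  exact congrArg Prod.fst this

/-- A solution that does not grow too fast is a multiple of the recessive one. -/
lemma exists_eq_mul_of_tendsto {V k k' K K' : ℝ → ℂ} (hV : Continuous V)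
    (hk : ∀ t, HasDerivAt k (k' t) t) (hk' : ∀ t, HasDerivAt k' (V t * k t) t)
    (hK : ∀ t, HasDerivAt K (K' t) t) (hK' : ∀ t, HasDerivAt K' (V t * K t) t)
    (h0 : Tendsto (fun t => k t * K t) atTop (𝓝 0))
    (h1 : Tendsto (fun t => k t * K' t) atTop (𝓝 0)) (hne : ∃ t, K t ≠ 0) :
    ∃ α : ℂ, ∀ t, k t = α * K t := by
  obtain ⟨t₀, ht₀⟩ := hne
  -- The Wronskian is constant because there is no first order term.
  set W : ℂ := k t₀ * K' t₀ - k' t₀ * K t₀ with hW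
  have hWc : ∀ t, k t * K' t - k' t * K t = W := by
    have hd : ∀ t, HasDerivAt (fun t => k t * K' t - k' t * K t) 0 t := fun t =>
      (((hk t).mul (hK' t)).sub ((hk' t).mul (hK t))).congr_deriv (by ring)
    intro t
    exact is_const_of_deriv_eq_zero (fun t => (hd t).differentiableAt) (fun t => (hd t).deriv) t t₀
  -- No growth of `k'` is assumed. Instead `(k K)' = 2 k K' - W`, so `k K + W t` has derivative
  -- tending to `0` while `k K` itself tends to `0`; comparing `T` with `T + 1` bounds `‖W‖` by less
  -- than `3 ‖W‖ / 4`.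
  have hW0 : W = 0 := by
    have hg : ∀ t : ℝ, HasDerivAt (fun t : ℝ => k t * K t + W * t) (2 * (k t * K' t)) t := by
      intro t
      have := ((hk t).mul (hK t)).add
        (((hasDerivAt_id (t : ℂ)).const_mul W).comp_ofReal)
      refine this.congr_deriv ?_
      rw [← hWc t]
      ring
    by_contra hne
    have hε : 0 < ‖W‖ / 4 := by positivity
    have e0 := (Metric.tendsto_atTop.1 h0) _ hε
    have e1 := (Metric.tendsto_atTop.1 h1) _ (half_pos hε)
    obtain ⟨T0, hT0⟩ := e0
    obtain ⟨T1, hT1⟩ := e1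
    set T := max T0 T1
    have b1 := Convex.norm_image_sub_le_of_norm_hasDerivWithin_le (s := Set.Icc T (T + 1))
      (C := ‖W‖ / 4) (fun t _ => (hg t).hasDerivWithinAt) (fun t ht => ?_) (convex_Icc _ _)
      (Set.left_mem_Icc.2 (by linarith)) (Set.right_mem_Icc.2 (by linarith))
    · have b2 := hT0 T (le_max_left _ _)
      have b3 := hT0 (T + 1) ((le_max_left T0 T1).trans (by linarith))
      rw [dist_zero_right] at b2 b3
      rw [add_sub_cancel_left, norm_one, mul_one] at b1
      have e : W = (k (T + 1) * K (T + 1) + W * (T + 1 : ℝ) - (k T * K T + W * T))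
          - k (T + 1) * K (T + 1) + k T * K T := by push_cast; ring
      have b4 : ‖W‖ ≤ ‖W‖ / 4 + ‖k (T + 1) * K (T + 1)‖ + ‖k T * K T‖ := by
        conv_lhs => rw [e]
        exact (norm_add_le _ _).trans (add_le_add_left ((norm_sub_le _ _).trans
          (add_le_add_left b1 _)) _)
      linarith
    · have := hT1 t ((le_max_right T0 T1).trans ht.1)
      rw [dist_zero_right] at this
      rw [norm_mul, Complex.norm_two]
      linarith
  refine ⟨k t₀ / K t₀, fun t => ?_⟩
  rw [← sub_eq_zero]
  have c1 : k' t₀ * K t₀ = k t₀ * K' t₀ := by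
    rw [hW, sub_eq_zero] at hW0; exact hW0.symm
  refine eq_zero_of_hasDerivAt_hasDerivAt (d := fun t => k t - k t₀ / K t₀ * K t)
    (d' := fun t => k' t - k t₀ / K t₀ * K' t) hV (t₀ := t₀)
    (fun t => (hk t).sub ((hK t).const_mul _))
    (fun t => ((hk' t).sub ((hK' t).const_mul _)).congr_deriv (by ring)) ?_ ?_ t
  · field_simp; ring
  · field_simp
    linear_combination c1

lemma hasDerivAt_intervalIntegral {g g' : ℝ → ℝ → ℂ} (hg : Continuous (Function.uncurry g))
    (hg' : Continuous (Function.uncurry g')) (h : ∀ t x, HasDerivAt (fun t => g t x) (g' t x) t)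
    (a b t : ℝ) : HasDerivAt (fun t => ∫ x in a..b, g t x) (∫ x in a..b, g' t x) t := by
  obtain ⟨M, hM⟩ := ((isCompact_Icc (a := t - 1) (b := t + 1)).prod
    (isCompact_uIcc (a := a) (b := b))).exists_bound_of_continuousOn hg'.continuousOn
  refine (intervalIntegral.hasDerivAt_integral_of_dominated_loc_of_deriv_le (bound := fun _ => M)
    (Icc_mem_nhds (by linarith) (by linarith) : Set.Icc (t - 1) (t + 1) ∈ 𝓝 t)
    (.of_forall fun s => ?_) ?_ ?_ (.of_forall fun x hx s hs => ?_) (by simp)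
    (.of_forall fun x _ s _ => h s x)).2
  · exact (hg.comp (by fun_prop : Continuous fun x => (s, x))).aestronglyMeasurable
  · exact (hg.comp (by fun_prop : Continuous fun x => (t, x))).intervalIntegrable _ _
  · exact (hg'.comp (by fun_prop : Continuous fun x => (t, x))).aestronglyMeasurable
  · exact hM (s, x) ⟨hs, Set.uIoc_subset_uIcc hx⟩

lemma IsStripKernel.tendsto_mul {φ : ℂ → ℂ} (hφ : IsStripKernel φ) {g : ℝ → ℂ} {C : ℝ} {N : ℕ}
    (hg : ∀ t, ‖g t‖ ≤ C * Real.exp (N * |t|)) :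
    Tendsto (fun t : ℝ => g t * φ t) atTop (𝓝 0) := by
  obtain ⟨c, hc, N', C', hb⟩ := hφ.decay
  obtain ⟨K, hK⟩ := exp_mul_sub_exp_le (α := N + 1) hc (by simp)
  have hC : 0 ≤ C := by simpa using (norm_nonneg _).trans (hg 0)
  have hC' : 0 ≤ C' := by
    have := (norm_nonneg _).trans (hb 0 (by simp [strip]))
    rw [mul_assoc] at this
    exact nonneg_of_mul_nonneg_left this (by positivity)
  have hlim : Tendsto (fun t : ℝ => C * C' * (K * Real.exp (-|t|))) atTop (𝓝 0) := by
    rw [← mul_zero (C * C'), ← mul_zero K]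
    exact ((Real.tendsto_exp_atBot.comp
      (tendsto_neg_atTop_atBot.comp tendsto_abs_atTop_atTop)).const_mul K).const_mul _
  refine squeeze_zero_norm' ?_ hlim
  filter_upwards [eventually_ge_atTop 0] with t ht
  have h1 := hb t (ofReal_mem_strip t)
  rw [Complex.ofReal_re] at h1
  have h2 := hg t
  rw [abs_of_nonneg ht] at h2
  rw [norm_mul]
  calc _ ≤ (C * Real.exp (N * t)) * (C' * 1 * Real.exp (-(c * Real.exp t))) := by
        refine mul_le_mul h2 (h1.trans ?_) (norm_nonneg _) (by positivity)
        gcongr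
        exact Real.exp_le_one_iff.2 (by have : 0 ≤ N' * t := by positivity
                                        linarith)
    _ = C * C' * (Real.exp (N * t) * Real.exp (-(c * Real.exp t))) := by ring
    _ ≤ C * C' * (Real.exp ((N + 1) * t) * Real.exp (-(c * Real.exp t))) := by
        gcongr
        linarith
    _ ≤ _ := mul_le_mul_of_nonneg_left (hK t) (by positivity)

/-! ### Maass forms in horospherical coordinates -/

/-- The point `x + i e^t`. -/
def horo (x t : ℝ) : ℂ := x + (Real.exp t : ℝ) * Complex.I

lemma horo_im_pos (x t : ℝ) : 0 < (horo x t).im := im_add_exp_pos x t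

lemma continuous_horo : Continuous (Function.uncurry horo) := by
  unfold horo Function.uncurry
  fun_prop

lemma hasDerivAt_horo_left (x t : ℝ) : HasDerivAt (fun x => horo x t) 1 x := by
  unfold horo
  exact (Complex.ofRealCLM.hasDerivAt (x := x)).add_const _

lemma hasDerivAt_horo_right (x t : ℝ) :
    HasDerivAt (fun t => horo x t) (Real.exp t • Complex.I) t := by
  unfold horo
  rw [Complex.real_smul]
  exact (((Real.hasDerivAt_exp t).ofReal_comp).mul_const _).const_add _

lemma isOpen_im_pos : IsOpen {z : ℂ | 0 < z.im} := isOpen_lt continuous_const Complex.continuous_im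

/-- The form as a function on `ℂ`. -/
def ext (f : ℍ → ℂ) (z : ℂ) : ℂ := f (ofComplex z)

lemma ext_add_one {f : ℍ → ℂ} (hf : ∀ (γ : SL(2, ℤ)) (z : ℍ), f (γ • z) = f z) (z : ℂ) :
    ext f (z + 1) = ext f z := by
  unfold ext
  by_cases hz : 0 < z.im
  · rw [← hf ModularGroup.T (ofComplex z), modular_T_smul]
    congr 1
    rw [ofComplex_apply_of_im_pos hz, ofComplex_apply_of_im_pos (by simpa using hz)]
    ext1
    simp [add_comm]
  · rw [ofComplex_apply_of_im_nonpos (not_lt.1 hz),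
      ofComplex_apply_of_im_nonpos (by simpa using not_lt.1 hz)]

lemma continuous_comp_horo {E : Type*} [TopologicalSpace E] {g : ℂ → E}
    (hg : ContinuousOn g {z : ℂ | 0 < z.im}) : Continuous fun p : ℝ × ℝ => g (horo p.1 p.2) :=
  hg.comp_continuous continuous_horo fun p => horo_im_pos p.1 p.2

/-- The Fourier coefficients of `e^{-t/2} f(x + i e^t)`. -/
def horoCoeff (f : ℍ → ℂ) (n : ℤ) (t : ℝ) : ℂ :=
  ∫ x in (0 : ℝ)..1, Complex.exp (-(2 * π * n * x * Complex.I)) *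
    (Complex.exp (-(t / 2)) * ext f (horo x t))

/-- The derivative of `horoCoeff`. -/
def horoCoeff' (f : ℍ → ℂ) (n : ℤ) (t : ℝ) : ℂ :=
  ∫ x in (0 : ℝ)..1, Complex.exp (-(2 * π * n * x * Complex.I)) *
    (Complex.exp (-(t / 2)) * (-(1 / 2) * ext f (horo x t)
      + (Real.exp t : ℂ) * fderiv ℝ (ext f) (horo x t) Complex.I))

/-! ### The differential equation of the Fourier coefficients -/

namespace IsEvenMaassCuspForm

variable {r : ℂ} {f : ℍ → ℂ}

lemma hasFDerivAt (hf : IsEvenMaassCuspForm r f) {z : ℂ} (hz : 0 < z.im) :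
    HasFDerivAt (ext f) (fderiv ℝ (ext f) z) z :=
  ((hf.smooth.differentiableOn (by simp)).differentiableAt
    (isOpen_im_pos.mem_nhds hz)).hasFDerivAt

lemma contDiffOn_fderiv (hf : IsEvenMaassCuspForm r f) :
    ContDiffOn ℝ (⊤ : ℕ∞) (fderiv ℝ (ext f)) {z : ℂ | 0 < z.im} :=
  hf.smooth.fderiv_of_isOpen isOpen_im_pos (by simp)

lemma hasFDerivAt_fderiv (hf : IsEvenMaassCuspForm r f) {z : ℂ} (hz : 0 < z.im) :
    HasFDerivAt (fderiv ℝ (ext f)) (fderiv ℝ (fderiv ℝ (ext f)) z) z :=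
  ((hf.contDiffOn_fderiv.differentiableOn (by simp)).differentiableAt
    (isOpen_im_pos.mem_nhds hz)).hasFDerivAt

lemma continuous_ext_horo (hf : IsEvenMaassCuspForm r f) :
    Continuous fun p : ℝ × ℝ => ext f (horo p.1 p.2) :=
  continuous_comp_horo hf.smooth.continuousOn

lemma continuous_fderiv_horo (hf : IsEvenMaassCuspForm r f) :
    Continuous fun p : ℝ × ℝ => fderiv ℝ (ext f) (horo p.1 p.2) :=
  continuous_comp_horo hf.contDiffOn_fderiv.continuousOn

lemma continuous_fderiv_fderiv_horo (hf : IsEvenMaassCuspForm r f) :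
    Continuous fun p : ℝ × ℝ => fderiv ℝ (fderiv ℝ (ext f)) (horo p.1 p.2) :=
  continuous_comp_horo
    (hf.contDiffOn_fderiv.fderiv_of_isOpen isOpen_im_pos (m := (⊤ : ℕ∞)) (by simp)).continuousOn

lemma hasDerivAt_ext_left (hf : IsEvenMaassCuspForm r f) (x t : ℝ) :
    HasDerivAt (fun x => ext f (horo x t)) (fderiv ℝ (ext f) (horo x t) 1) x :=
  HasFDerivAt.comp_hasDerivAt (f := fun x => horo x t) x (hf.hasFDerivAt (horo_im_pos x t))
    (hasDerivAt_horo_left x t)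

lemma hasDerivAt_ext_right (hf : IsEvenMaassCuspForm r f) (x t : ℝ) :
    HasDerivAt (fun t => ext f (horo x t))
      ((Real.exp t : ℂ) * fderiv ℝ (ext f) (horo x t) Complex.I) t := by
  have := (hf.hasFDerivAt (horo_im_pos x t)).comp_hasDerivAt t (hasDerivAt_horo_right x t)
  rwa [map_smul, Complex.real_smul] at this

lemma hasDerivAt_fderiv_left (hf : IsEvenMaassCuspForm r f) (x t : ℝ) :
    HasDerivAt (fun x => fderiv ℝ (ext f) (horo x t) 1)
      (fderiv ℝ (fderiv ℝ (ext f)) (horo x t) 1 1) x := by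
  have h := HasFDerivAt.comp_hasDerivAt (f := fun x => horo x t) x
    (hf.hasFDerivAt_fderiv (horo_im_pos x t)) (hasDerivAt_horo_left x t)
  refine (h.clm_apply (hasDerivAt_const x (1 : ℂ))).congr_deriv ?_
  rw [map_zero, add_zero]

lemma hasDerivAt_fderiv_right (hf : IsEvenMaassCuspForm r f) (x t : ℝ) :
    HasDerivAt (fun t => fderiv ℝ (ext f) (horo x t) Complex.I)
      ((Real.exp t : ℂ) * fderiv ℝ (fderiv ℝ (ext f)) (horo x t) Complex.I Complex.I) t := by
  have h := HasFDerivAt.comp_hasDerivAt (f := fun t => horo x t) t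
    (hf.hasFDerivAt_fderiv (horo_im_pos x t)) (hasDerivAt_horo_right x t)
  refine (h.clm_apply (hasDerivAt_const t Complex.I)).congr_deriv ?_
  rw [map_zero, add_zero, map_smul, smul_apply, Complex.real_smul]

lemma laplace_horo (hf : IsEvenMaassCuspForm r f) (x t : ℝ) :
    (Real.exp t : ℂ) ^ 2 * (fderiv ℝ (fderiv ℝ (ext f)) (horo x t) 1 1
      + fderiv ℝ (fderiv ℝ (ext f)) (horo x t) Complex.I Complex.I)
      = -((1 / 4 + r ^ 2) * ext f (horo x t)) := by
  have h := hf.eigen ⟨horo x t, horo_im_pos x t⟩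
  rw [InnerProductSpace.laplacian_eq_iteratedFDeriv_complexPlane] at h
  simp only [iteratedFDeriv_two_apply] at h
  have e : (⟨horo x t, horo_im_pos x t⟩ : ℍ).im = Real.exp t := by
    change (horo x t).im = _
    simp [horo, ← Complex.ofReal_exp]
  have e2 : f ⟨horo x t, horo_im_pos x t⟩ = ext f (horo x t) := by
    rw [ext, ofComplex_apply_of_im_pos (horo_im_pos x t)]
  rw [e, e2] at h
  rw [← h, neg_neg]
  rfl

lemma fderiv_add_one (hf : IsEvenMaassCuspForm r f) (z : ℂ) :
    fderiv ℝ (ext f) (z + 1) = fderiv ℝ (ext f) z := by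
  rw [← fderiv_comp_add_right]
  congr 1
  funext w
  exact ext_add_one hf.invariant w

lemma hasDerivAt_horoCoeff (hf : IsEvenMaassCuspForm r f) (n : ℤ) (t : ℝ) :
    HasDerivAt (horoCoeff f n) (horoCoeff' f n t) t := by
  have c0 := hf.continuous_ext_horo.comp continuous_swap
  have c1 := (hf.continuous_fderiv_horo.comp continuous_swap).clm_apply
    (continuous_const (y := Complex.I))
  simp only [Function.comp_def, Prod.fst_swap, Prod.snd_swap] at c0 c1
  refine hasDerivAt_intervalIntegral
    (g := fun t x => Complex.exp (-(2 * π * n * x * Complex.I)) *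
      (Complex.exp (-(t / 2)) * ext f (horo x t)))
    (g' := fun t x => Complex.exp (-(2 * π * n * x * Complex.I)) *
      (Complex.exp (-(t / 2)) * (-(1 / 2) * ext f (horo x t)
      + (Real.exp t : ℂ) * fderiv ℝ (ext f) (horo x t) Complex.I))) ?_ ?_ (fun t x => ?_) 0 1 t
  · unfold Function.uncurry; fun_prop
  · unfold Function.uncurry; fun_prop
  · have hE : HasDerivAt (fun t : ℝ => Complex.exp (-(t / 2))) _ t :=
      (((hasDerivAt_id (t : ℂ)).div_const 2).neg.cexp).comp_ofReal
    refine ((hE.mul (hf.hasDerivAt_ext_right x t)).const_mul _).congr_deriv ?_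
    simp only [Pi.neg_apply, id]
    ring

/-- Two integrations by parts at once: the integrand is the derivative of `e^{-2πinx} (f_x + 2πi n
f)`, which takes the same value at `0` and `1`. -/
lemma integral_fderiv_fderiv (hf : IsEvenMaassCuspForm r f) (n : ℤ) (t : ℝ) :
    ∫ x in (0 : ℝ)..1, Complex.exp (-(2 * π * n * x * Complex.I)) *
      (fderiv ℝ (fderiv ℝ (ext f)) (horo x t) 1 1 + (2 * π * n) ^ 2 * ext f (horo x t)) = 0 := by
  have c0 := hf.continuous_ext_horo.comp (by fun_prop : Continuous fun x : ℝ => (x, t))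
  have c1 := ((hf.continuous_fderiv_fderiv_horo.comp (by fun_prop : Continuous fun x : ℝ => (x, t))).clm_apply
    (continuous_const (y := (1 : ℂ)))).clm_apply (continuous_const (y := (1 : ℂ)))
  simp only [Function.comp_def] at c0 c1
  have hE : ∀ x : ℝ, HasDerivAt (fun x : ℝ => Complex.exp (-(2 * π * n * x * Complex.I)))
      (Complex.exp (-(2 * π * n * x * Complex.I)) * (-(2 * π * n * Complex.I))) x := fun x =>
    (((((hasDerivAt_id (x : ℂ)).const_mul (2 * π * n : ℂ)).mul_const
      Complex.I).neg.cexp).comp_ofReal).congr_deriv (by simp)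
  rw [intervalIntegral.integral_eq_sub_of_hasDerivAt
    (f := fun x : ℝ => Complex.exp (-(2 * π * n * x * Complex.I)) *
      (fderiv ℝ (ext f) (horo x t) 1 + 2 * π * n * Complex.I * ext f (horo x t)))
    (fun x _ => ?_) (Continuous.intervalIntegrable (by fun_prop) _ _)]
  · have e1 : horo 1 t = horo 0 t + 1 := by simp [horo]; ring
    have e2 : Complex.exp (-(2 * π * n * (1 : ℝ) * Complex.I)) = 1 := by
      rw [Complex.exp_eq_one_iff]
      exact ⟨-n, by push_cast; ring⟩
    rw [e1, hf.fderiv_add_one, ext_add_one hf.invariant, e2]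
    simp
  · refine ((hE x).mul ((hf.hasDerivAt_fderiv_left x t).add
      ((hf.hasDerivAt_ext_left x t).const_mul (2 * π * n * Complex.I)))).congr_deriv ?_
    simp only [Pi.add_apply]
    linear_combination (-Complex.exp (-(2 * π * n * x * Complex.I)) * (2 * π * n) ^ 2 *
      ext f (horo x t)) * Complex.I_sq

/-- The factor `e^{-t/2}` removes the first order term and contributes `1/4`, which cancels the
`1/4` of the eigenvalue. The Laplace equation trades `f_yy` for `f_xx`, and integration by parts
turns `f_xx` into `-(2πn)² f`. -/
lemma hasDerivAt_horoCoeff' (hf : IsEvenMaassCuspForm r f) (n : ℤ) (t : ℝ) :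
    HasDerivAt (horoCoeff' f n)
      (((2 * π * n : ℂ) ^ 2 * (Real.exp t : ℂ) ^ 2 - r ^ 2) * horoCoeff f n t) t := by
  have c0 := hf.continuous_ext_horo.comp continuous_swap
  have c1 := (hf.continuous_fderiv_horo.comp continuous_swap).clm_apply
    (continuous_const (y := Complex.I))
  have c2 := ((hf.continuous_fderiv_fderiv_horo.comp continuous_swap).clm_apply
    (continuous_const (y := Complex.I))).clm_apply (continuous_const (y := Complex.I))
  simp only [Function.comp_def, Prod.fst_swap, Prod.snd_swap] at c0 c1 c2
  have h := hasDerivAt_intervalIntegral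
    (g := fun t x => Complex.exp (-(2 * π * n * x * Complex.I)) *
      (Complex.exp (-(t / 2)) * (-(1 / 2) * ext f (horo x t)
      + (Real.exp t : ℂ) * fderiv ℝ (ext f) (horo x t) Complex.I)))
    (g' := fun t x => Complex.exp (-(2 * π * n * x * Complex.I)) *
      (Complex.exp (-(t / 2)) * (1 / 4 * ext f (horo x t) + (Real.exp t : ℂ) ^ 2 *
        fderiv ℝ (fderiv ℝ (ext f)) (horo x t) Complex.I Complex.I)))
    (by unfold Function.uncurry; fun_prop) (by unfold Function.uncurry; fun_prop)
    (fun t x => ?_) 0 1 t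
  · refine h.congr_deriv ?_
    have d0 := hf.continuous_ext_horo.comp (by fun_prop : Continuous fun x : ℝ => (x, t))
    have d1 := ((hf.continuous_fderiv_fderiv_horo.comp
      (by fun_prop : Continuous fun x : ℝ => (x, t))).clm_apply
      (continuous_const (y := (1 : ℂ)))).clm_apply (continuous_const (y := (1 : ℂ)))
    simp only [Function.comp_def] at d0 d1
    have hz := hf.integral_fderiv_fderiv n t
    calc _ = ∫ x in (0 : ℝ)..1, (((2 * π * n : ℂ) ^ 2 * (Real.exp t : ℂ) ^ 2 - r ^ 2) *
          (Complex.exp (-(2 * π * n * x * Complex.I)) *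
            (Complex.exp (-(t / 2)) * ext f (horo x t)))
          - (Real.exp t : ℂ) ^ 2 * Complex.exp (-(t / 2)) *
            (Complex.exp (-(2 * π * n * x * Complex.I)) *
      (fderiv ℝ (fderiv ℝ (ext f)) (horo x t) 1 1 + (2 * π * n) ^ 2 * ext f (horo x t)))) := by
          refine intervalIntegral.integral_congr fun x _ => ?_
          have := hf.laplace_horo x t
          linear_combination (Complex.exp (-(2 * π * n * x * Complex.I)) *
            Complex.exp (-(t / 2))) * this
      _ = _ := by
          rw [intervalIntegral.integral_sub (Continuous.intervalIntegrable (by fun_prop) _ _)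
            (Continuous.intervalIntegrable (by fun_prop) _ _),
            intervalIntegral.integral_const_mul, intervalIntegral.integral_const_mul, hz, mul_zero,
            sub_zero, horoCoeff]
  · have hE : HasDerivAt (fun t : ℝ => Complex.exp (-(t / 2))) _ t :=
      (((hasDerivAt_id (t : ℂ)).div_const 2).neg.cexp).comp_ofReal
    refine ((hE.mul (((hf.hasDerivAt_ext_right x t).const_mul _).add
      (((Real.hasDerivAt_exp t).ofReal_comp).mul
        (hf.hasDerivAt_fderiv_right x t)))).const_mul _).congr_deriv ?_
    simp only [Pi.neg_apply, Pi.add_apply, Pi.mul_apply, id]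
    ring

end IsEvenMaassCuspForm

/-! ### The Fourier expansion of a Maass form -/

/-- `W_r(i e^t)`, as a kernel. -/
def maassKernel (r t : ℂ) : ℂ :=
  2 * (Complex.exp ((1 / 2 : ℝ) * t) * besselKernel r (t + (Real.log (2 * π) : ℝ)))

lemma isStripKernel_maassKernel (r : ℂ) : IsStripKernel (maassKernel r) :=
  (((isStripKernel_besselKernel r).comp_add _).exp_mul _).const_mul _

lemma exists_maassKernel_ne_zero (r : ℂ) : ∃ t : ℝ, maassKernel r t ≠ 0 := by
  obtain ⟨t, ht⟩ := exists_besselKernel_ne_zero r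
  refine ⟨t - Real.log (2 * π), ?_⟩
  rw [maassKernel]
  push_cast
  rw [sub_add_cancel]
  exact mul_ne_zero two_ne_zero (mul_ne_zero (Complex.exp_ne_zero _) ht)

lemma whittaker_eq (r : ℂ) (n : ℕ+) (x t : ℝ) : whittaker r (n * x) (n * Real.exp t)
    = maassKernel r (t + (Real.log n : ℝ)) * (Real.cos (2 * π * (n * x)) : ℂ) := by
  have hn : (0 : ℝ) < (n : ℕ) := by exact_mod_cast n.pos
  have e1 : 2 * π * (n * Real.exp t) = Real.exp (t + Real.log n + Real.log (2 * π)) := by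
    rw [Real.exp_add, Real.exp_add, Real.exp_log hn, Real.exp_log Real.two_pi_pos]
    ring
  have e2 : Real.sqrt (n * Real.exp t) = Real.exp (1 / 2 * (t + Real.log n)) := by
    rw [mul_comm (1 / 2 : ℝ), Real.exp_mul, Real.exp_add, Real.exp_log hn, Real.sqrt_eq_rpow,
      mul_comm]
  rw [whittaker, e1, e2, besselK_exp, maassKernel]
  push_cast
  ring

lemma integral_cos_two_pi_mul (k : ℤ) :
    ∫ x in (0 : ℝ)..1, Real.cos (2 * π * (k * x)) = if k = 0 then 1 else 0 := by
  split_ifs with h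
  · simp [h]
  · have hk : (2 * π * k : ℝ) ≠ 0 := mul_ne_zero Real.two_pi_pos.ne' (by exact_mod_cast h)
    rw [intervalIntegral.integral_eq_sub_of_hasDerivAt
      (f := fun x => Real.sin (2 * π * (k * x)) / (2 * π * k)) (fun x _ => ?_)
      (Continuous.intervalIntegrable (by fun_prop) _ _)]
    · have : 2 * π * (k * 1) = (2 * k : ℤ) * π := by push_cast; ring
      simp only [this, Real.sin_int_mul_pi]
      simp
    · refine (((((hasDerivAt_id x).const_mul (k : ℝ)).const_mul (2 * π)).sin).div_const
        _).congr_deriv ?_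
      simp only [id]
      field_simp

lemma integral_cos_mul_cos (n m : ℕ+) : ∫ x in (0 : ℝ)..1, (Real.cos (2 * π * (n * x)) : ℂ) *
    (Real.cos (2 * π * (m * x)) : ℂ) = if n = m then 1 / 2 else 0 := by
  have e : ∀ x : ℝ, (Real.cos (2 * π * (n * x)) : ℂ) * (Real.cos (2 * π * (m * x)) : ℂ)
      = ((1 / 2 * Real.cos (2 * π * (((n : ℤ) - (m : ℤ) : ℤ) * x))
        + 1 / 2 * Real.cos (2 * π * (((n : ℤ) + (m : ℤ) : ℤ) * x)) : ℝ) : ℂ) := by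
    intro x
    rw [← Complex.ofReal_mul]
    congr 1
    push_cast
    rw [sub_mul, add_mul, mul_sub, mul_add, Real.cos_sub, Real.cos_add]
    ring
  simp_rw [e]
  rw [intervalIntegral.integral_ofReal, intervalIntegral.integral_add
    (Continuous.intervalIntegrable (by fun_prop) _ _)
    (Continuous.intervalIntegrable (by fun_prop) _ _), intervalIntegral.integral_const_mul,
    intervalIntegral.integral_const_mul, integral_cos_two_pi_mul, integral_cos_two_pi_mul]
  have h2 : ((n : ℕ) : ℤ) + (m : ℕ) ≠ 0 := by have := n.pos; omega
  have h1 : ((n : ℕ) : ℤ) - (m : ℕ) = 0 ↔ n = m := by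
    rw [sub_eq_zero]; exact_mod_cast Iff.rfl
  rw [if_neg h2]
  simp only [h1]
  split_ifs <;> simp

/-- The coefficients of a cosine series are bounded by its values. -/
lemma norm_le_of_hasSum_cos {A : ℕ+ → ℂ} {g : ℝ → ℂ} {M : ℝ}
    (h : ∀ x : ℝ, HasSum (fun n : ℕ+ => A n * (Real.cos (2 * π * (n * x)) : ℂ)) (g x))
    (hg : ∀ x, ‖g x‖ ≤ M) (m : ℕ+) : ‖A m‖ ≤ 2 * M := by
  -- At `x = 0` all cosines equal `1`, so convergence there is absolute summability of the
  -- coefficients.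
  have hA : Summable fun n => ‖A n‖ := by
    have := (h 0).summable.norm
    simpa using this
  have hcos : ∀ (n : ℕ+) (x : ℝ), ‖(Real.cos (2 * π * (n * x)) : ℂ)‖ ≤ 1 := fun n x => by
    rw [Complex.norm_real]; exact Real.abs_cos_le_one _
  have h1 := intervalIntegral.hasSum_integral_of_dominated_convergence (μ := volume) (a := 0)
    (b := 1) (F := fun (n : ℕ+) x => A n * (Real.cos (2 * π * (n * x)) : ℂ) *
      (Real.cos (2 * π * (m * x)) : ℂ))
    (f := fun x => g x * (Real.cos (2 * π * (m * x)) : ℂ)) (fun n _ => ‖A n‖)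
    (fun n => Continuous.aestronglyMeasurable (by fun_prop)) (fun n => .of_forall fun x _ => ?_)
    (.of_forall fun x _ => hA) (by simp) (.of_forall fun x _ => (h x).mul_right _)
  · simp only [mul_assoc (A _)] at h1
    simp only [intervalIntegral.integral_const_mul] at h1
    simp only [integral_cos_mul_cos] at h1
    have h2 := h1.unique (hasSum_single m fun n hn => by rw [if_neg hn, mul_zero])
    rw [if_pos rfl] at h2
    have h3 : ‖∫ x in (0 : ℝ)..1, g x * (Real.cos (2 * π * (m * x)) : ℂ)‖ ≤ M * |1 - 0| :=
      intervalIntegral.norm_integral_le_of_norm_le_const fun x _ => by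
        rw [norm_mul]
        exact (mul_le_of_le_one_right (norm_nonneg _) (hcos m x)).trans (hg x)
    rw [h2, norm_mul] at h3
    norm_num at h3
    linarith
  · rw [norm_mul, norm_mul, mul_assoc]
    exact mul_le_of_le_one_right (norm_nonneg _)
      (mul_le_one₀ (hcos n x) (norm_nonneg _) (hcos m x))

/-- The hypothesis is used at `t = τ - log n`, where the kernel has the fixed value `φ τ` and the
right-hand side is of size `n ^ N`. -/
lemma polyBounded_of_norm_mul_le {a : ℕ → ℂ} {φ : ℂ → ℂ} {τ : ℝ} (hτ : φ τ ≠ 0) {C : ℝ} {N : ℕ}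
    (h : ∀ (n : ℕ+) (t : ℝ), ‖a n * φ (t + (Real.log n : ℝ))‖ ≤ C * Real.exp (N * |t|)) :
    PolyBounded a := by
  have hC : 0 ≤ C := by simpa using (norm_nonneg _).trans (h 1 0)
  refine ⟨N, C * Real.exp (N * |τ|) / ‖φ τ‖, fun n => ?_⟩
  have hn : (0 : ℝ) < (n : ℕ) := by exact_mod_cast n.pos
  have hn1 : (1 : ℝ) ≤ (n : ℕ) := by exact_mod_cast n.one_le
  have h1 := h n (τ - Real.log n)
  rw [← Complex.ofReal_add, sub_add_cancel, norm_mul] at h1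
  have h2 : |τ - Real.log n| ≤ |τ| + Real.log n := by
    refine (abs_sub _ _).trans_eq ?_
    rw [abs_of_nonneg (Real.log_nonneg hn1)]
  have h3 : Real.exp (N * |τ - Real.log n|) ≤ Real.exp (N * |τ|) * (n : ℝ) ^ N := by
    calc _ ≤ Real.exp (N * (|τ| + Real.log n)) := by gcongr
      _ = _ := by rw [mul_add, Real.exp_add, Real.exp_nat_mul (Real.log n), Real.exp_log hn]
  have hφ : 0 < ‖φ τ‖ := norm_pos_iff.2 hτ
  rw [div_mul_eq_mul_div, le_div_iff₀ hφ, mul_assoc]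
  exact h1.trans (mul_le_mul_of_nonneg_left h3 hC)

/-! ### Growth of a Maass form and its Fourier coefficients -/

namespace IsEvenMaassCuspForm

variable {r : ℂ} {f : ℍ → ℂ}

/-- Invariance extends the growth condition at the cusp to a bound by `max (y, 1/y) ^ N` on the
whole half-plane; for `y = e^t` the maximum is `e^{|t|}`. -/
lemma exists_norm_ext_le (hf : IsEvenMaassCuspForm r f) : ∃ (C : ℝ) (N : ℕ),
    ∀ x t : ℝ, ‖ext f (horo x t)‖ ≤ C * Real.exp (N * |t|) := by
  have hfe : ∀ z : ℍ, f z = ext f z := fun z => by rw [ext, ofComplex_apply]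
  have hcont : Continuous f := by
    rw [show f = fun z : ℍ => ext f z from funext hfe]
    exact hf.smooth.continuousOn.comp_continuous continuous_coe fun z => z.im_pos
  obtain ⟨C, N, hN⟩ := hf.moderate
  have hO : f =O[atImInfty] fun z => z.im ^ (N : ℝ) := by
    refine .of_bound C ?_
    filter_upwards [(tendsto_comap (f := UpperHalfPlane.im)).eventually (eventually_ge_atTop 1)]
      with z hz
    rw [Real.rpow_natCast, Real.norm_of_nonneg (pow_nonneg z.im_pos.le _)]
    exact hN z hz
  obtain ⟨C', hC'⟩ := ModularGroup.exists_bound_of_invariant_of_isBigO hcont N.cast_nonneg hO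
    hf.invariant
  refine ⟨C', N, fun x t => ?_⟩
  have h := hC' ⟨horo x t, horo_im_pos x t⟩
  rw [hfe] at h
  refine h.trans_eq ?_
  have e : (⟨horo x t, horo_im_pos x t⟩ : ℍ).im = Real.exp t := by
    change (horo x t).im = _
    simp [horo, ← Complex.ofReal_exp]
  rw [e, one_div, ← Real.exp_neg, ← Real.exp_monotone.map_max, Real.rpow_natCast,
    ← Real.exp_nat_mul]
  rfl

lemma exists_norm_horoCoeff_le (hf : IsEvenMaassCuspForm r f) : ∃ (C : ℝ) (N : ℕ),
    ∀ (n : ℤ) (t : ℝ), ‖Complex.exp (t / 2) * horoCoeff f n t‖ ≤ C * Real.exp (N * |t|) := by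
  obtain ⟨C, N, h⟩ := hf.exists_norm_ext_le
  refine ⟨C, N, fun n t => ?_⟩
  rw [horoCoeff, ← intervalIntegral.integral_const_mul]
  refine (intervalIntegral.norm_integral_le_of_norm_le_const (C := C * Real.exp (N * |t|))
    fun x _ => ?_).trans_eq (by simp)
  have h1 : Complex.exp (t / 2) * Complex.exp (-(t / 2)) = 1 := by
    rw [← Complex.exp_add, add_neg_cancel, Complex.exp_zero]
  rw [mul_left_comm, ← mul_assoc (Complex.exp (t / 2)), h1, one_mul, norm_mul]
  have h2 : ‖Complex.exp (-(2 * π * n * x * Complex.I))‖ = 1 := by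
    have := Complex.norm_exp_ofReal_mul_I (-(2 * π * n * x))
    push_cast at this
    rwa [neg_mul] at this
  rw [h2, one_mul]
  exact h x t

/-- `K_{ir}(2π |n| e^t)` solves the same equation and decays doubly exponentially, whereas the
coefficient grows at most like a power of `e^{|t|}`. -/
lemma exists_horoCoeff_eq (hf : IsEvenMaassCuspForm r f) {n : ℤ} (hn : n ≠ 0) :
    ∃ α : ℂ, ∀ t : ℝ, Complex.exp (t / 2) * horoCoeff f n t
      = α * maassKernel r (t + (Real.log |n| : ℝ)) := by
  have hn' : (0 : ℝ) < |(n : ℝ)| := abs_pos.2 (by exact_mod_cast hn)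
  set c : ℝ := Real.log |n| + Real.log (2 * π) with hc
  obtain ⟨C, N, hb⟩ := hf.exists_norm_horoCoeff_le
  have hexp : ∀ t : ℝ, (Real.exp (t + c) : ℂ) ^ 2 = (2 * π * n : ℂ) ^ 2 * (Real.exp t : ℂ) ^ 2 := by
    intro t
    rw [hc, Real.exp_add, Real.exp_add, Real.exp_log hn', Real.exp_log Real.two_pi_pos]
    have : ((|(n : ℝ)| : ℝ) : ℂ) ^ 2 = (n : ℂ) ^ 2 := by
      rw [← Complex.ofReal_pow, sq_abs]; push_cast; rfl
    push_cast
    linear_combination (Complex.exp t ^ 2 * (2 * π) ^ 2) * this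
  have hb' : ∀ t : ℝ, ‖horoCoeff f n t‖ ≤ C * Real.exp ((N + 1 : ℕ) * |t|) := by
    intro t
    have e : horoCoeff f n t = Complex.exp (-(t / 2)) * (Complex.exp (t / 2) * horoCoeff f n t) := by
      rw [← mul_assoc, ← Complex.exp_add, neg_add_cancel, Complex.exp_zero, one_mul]
    have e1 : ‖Complex.exp (-(t / 2))‖ ≤ Real.exp |t| := by
      rw [Complex.norm_exp, Real.exp_le_exp, Complex.neg_re, Complex.div_ofNat_re,
        Complex.ofReal_re]
      linarith [neg_abs_le t, abs_nonneg t]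
    have hC : 0 ≤ C := by simpa using (norm_nonneg _).trans (hb 0 0)
    rw [e, norm_mul]
    calc _ ≤ Real.exp |t| * (C * Real.exp (N * |t|)) :=
          mul_le_mul e1 (hb n t) (norm_nonneg _) (Real.exp_pos _).le
      _ = C * (Real.exp (N * |t|) * Real.exp |t|) := by ring
      _ = _ := by rw [← Real.exp_add]; push_cast; ring_nf
  obtain ⟨t₀, ht₀⟩ := exists_besselKernel_ne_zero r
  obtain ⟨α, hα⟩ := exists_eq_mul_of_tendsto
    (V := fun t => (2 * π * n : ℂ) ^ 2 * (Real.exp t : ℂ) ^ 2 - r ^ 2)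
    (K := fun t => besselKernel r (t + c : ℝ)) (K' := fun t => besselKernel' r (t + c : ℝ))
    (by fun_prop) (hf.hasDerivAt_horoCoeff n) (hf.hasDerivAt_horoCoeff' n)
    (fun t => (hasDerivAt_besselKernel r (t + c)).comp_add_const t c)
    (fun t => by
      have := (hasDerivAt_besselKernel' r (t + c)).comp_add_const t c
      rwa [hexp t] at this)
    (by simpa using ((isStripKernel_besselKernel r).comp_add c).tendsto_mul hb')
    (by simpa using ((isStripKernel_besselKernel' r).comp_add c).tendsto_mul hb')
    ⟨t₀ - c, by simpa using ht₀⟩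
  refine ⟨α * Complex.exp (-((1 / 2 : ℝ) * (Real.log |n| : ℝ))) / 2, fun t => ?_⟩
  rw [hα t, maassKernel, hc]
  have e : Complex.exp ((1 / 2 : ℝ) * (t + (Real.log |n| : ℝ)))
      = Complex.exp (t / 2) * Complex.exp ((1 / 2 : ℝ) * (Real.log |n| : ℝ)) := by
    rw [← Complex.exp_add]; push_cast; ring_nf
  rw [e, Complex.exp_neg]
  have h0 := Complex.exp_ne_zero ((1 / 2 : ℝ) * (Real.log |n| : ℝ))
  push_cast at h0 ⊢
  field_simp
  ring_nf

end IsEvenMaassCuspForm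

/-! ### Existence of the Whittaker expansion -/

namespace IsEvenMaassCuspForm

variable {r : ℂ} {f : ℍ → ℂ}

lemma hasSum_horoCoeff (hf : IsEvenMaassCuspForm r f) (x t : ℝ)
    (hs : Summable fun n : ℤ => Complex.exp (t / 2) * horoCoeff f n t) :
    HasSum (fun n : ℤ => Complex.exp (t / 2) * horoCoeff f n t *
      Complex.exp (2 * π * n * x * Complex.I)) (ext f (horo x t)) := by
  have hper : Function.Periodic (fun x : ℝ => ext f (horo x t)) 1 := by
    intro x
    have e : horo (x + 1) t = horo x t + 1 := by simp [horo]; ring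
    simp only [e, ext_add_one hf.invariant]
  have hcont : Continuous fun x : ℝ => ext f (horo x t) :=
    hf.continuous_ext_horo.comp (by fun_prop : Continuous fun x : ℝ => (x, t))
  let F : C(AddCircle (1 : ℝ), ℂ) := ⟨hper.lift, continuous_coinduced_dom.2 hcont⟩
  have hF : ∀ x : ℝ, F (x : AddCircle (1 : ℝ)) = ext f (horo x t) := fun x => rfl
  have hco : ∀ n : ℤ, fourierCoeff F n = Complex.exp (t / 2) * horoCoeff f n t := by
    intro n
    rw [fourierCoeff_eq_intervalIntegral F n 0, horoCoeff, ← intervalIntegral.integral_const_mul]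
    simp only [zero_add, div_one, one_smul]
    refine intervalIntegral.integral_congr fun x _ => ?_
    have h1 : Complex.exp (t / 2) * Complex.exp (-(t / 2)) = 1 := by
      rw [← Complex.exp_add, add_neg_cancel, Complex.exp_zero]
    simp only [hF, smul_eq_mul, fourier_coe_apply]
    rw [mul_left_comm, ← mul_assoc (Complex.exp (t / 2)), h1, one_mul]
    congr 2
    push_cast
    ring
  have := has_pointwise_sum_fourier_series_of_summable (f := F) (by rwa [show (fourierCoeff F : ℤ → ℂ) = _ from funext hco])
    (x : AddCircle (1 : ℝ))
  rw [hF] at this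
  convert this using 2 with n
  rw [hco, smul_eq_mul, fourier_coe_apply]
  congr 2
  push_cast
  ring

lemma horoCoeff_zero (hf : IsEvenMaassCuspForm r f) (t : ℝ) : horoCoeff f 0 t = 0 := by
  have h := hf.cuspidal (Real.exp t) (Real.exp_pos t)
  rw [horoCoeff]
  simp only [Int.cast_zero, mul_zero, zero_mul, neg_zero, Complex.exp_zero, one_mul]
  rw [intervalIntegral.integral_const_mul]
  refine mul_eq_zero_of_right _ ?_
  exact h

lemma ext_neg (hf : IsEvenMaassCuspForm r f) (x t : ℝ) :
    ext f (horo (-x) t) = ext f (horo x t) := by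
  have := hf.even x (Real.exp t) (Real.exp_pos t)
  simpa only [ext, horo, Complex.ofReal_neg] using this

/-- The frequencies `n` and `-n` are multiples `α n` and `β n` of the same kernel. Averaging the
Fourier series at `x` and `-x`, which have the same sum because `f` is even, gives a cosine series
with coefficients `α n + β n`. -/
lemma exists_isMaassCoeff (hf : IsEvenMaassCuspForm r f) : ∃ a, IsMaassCoeff r f a := by
  choose α hα using fun n : ℕ+ => hf.exists_horoCoeff_eq (n := (n : ℕ)) (by exact_mod_cast n.ne_zero)
  choose β hβ using fun n : ℕ+ =>
    hf.exists_horoCoeff_eq (n := -(n : ℕ)) (by simp)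
  have hlogα : ∀ n : ℕ+, (Real.log |(((n : ℕ) : ℤ) : ℝ)| : ℝ) = Real.log n := fun n => by simp
  have hlogβ : ∀ n : ℕ+, (Real.log |((-((n : ℕ) : ℤ) : ℤ) : ℝ)| : ℝ) = Real.log n := fun n => by simp
  simp only [hlogα] at hα
  simp only [hlogβ] at hβ
  obtain ⟨C, N, hb⟩ := hf.exists_norm_horoCoeff_le
  obtain ⟨τ, hτ⟩ := exists_maassKernel_ne_zero r
  let a : ℕ → ℂ := fun n => if h : 0 < n then α ⟨n, h⟩ else 0
  let b : ℕ → ℂ := fun n => if h : 0 < n then β ⟨n, h⟩ else 0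
  have ha : ∀ n : ℕ+, a n = α n := fun n => dif_pos n.pos
  have hb' : ∀ n : ℕ+, b n = β n := fun n => dif_pos n.pos
  -- Polynomial bounds make the Fourier coefficients summable, and then the Fourier series converges
  -- to `f` at every point.
  have pa : PolyBounded a := polyBounded_of_norm_mul_le hτ fun n t => by
    rw [ha, ← hα]; exact hb _ t
  have pb : PolyBounded b := polyBounded_of_norm_mul_le hτ fun n t => by
    rw [hb', ← hβ]; exact hb _ t
  have key : ∀ {c : ℕ → ℂ}, PolyBounded c → ∀ t : ℝ,
      Summable fun n : ℕ+ => c n * maassKernel r (t + (Real.log n : ℝ)) := by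
    intro c hc t
    have := summable_twistTerm hc (isStripKernel_maassKernel r) (1 : DirichletCharacter ℂ 1)
      (ofReal_mem_strip t)
    refine this.congr fun n => ?_
    rw [twistTerm, Subsingleton.elim (((n : ℕ) : ZMod 1)) 1, map_one, mul_one]
  have hsum : ∀ t : ℝ, Summable fun n : ℤ => Complex.exp (t / 2) * horoCoeff f n t := by
    intro t
    refine Summable.of_nat_of_neg ?_ ?_
    · rw [← PNat.coe_injective.summable_iff]
      · refine (key pa t).congr fun n => ?_
        rw [Function.comp_apply, hα, ha]
      · intro n hn
        have : n = 0 := by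
          by_contra h0
          exact hn ⟨⟨n, Nat.pos_of_ne_zero h0⟩, rfl⟩
        rw [this, Nat.cast_zero, hf.horoCoeff_zero, mul_zero]
    · rw [← PNat.coe_injective.summable_iff]
      · refine (key pb t).congr fun n => ?_
        rw [Function.comp_apply, hβ, hb']
      · intro n hn
        have : n = 0 := by
          by_contra h0
          exact hn ⟨⟨n, Nat.pos_of_ne_zero h0⟩, rfl⟩
        rw [this, Nat.cast_zero, neg_zero, hf.horoCoeff_zero, mul_zero]
  refine ⟨fun n => a n + b n, by simp [a, b], fun z => ?_⟩
  obtain ⟨t, ht⟩ : ∃ t : ℝ, Real.exp t = z.im := ⟨_, Real.exp_log z.im_pos⟩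
  have hz : f z = ext f (horo z.re t) := by
    rw [ext, horo, ht]
    have : (z.re : ℂ) + z.im * Complex.I = z := Complex.re_add_im z
    rw [this, ofComplex_apply]
  have h1 := hf.hasSum_horoCoeff z.re t (hsum t)
  have h2 := hf.hasSum_horoCoeff (-z.re) t (hsum t)
  rw [hf.ext_neg] at h2
  have h3 := ((h1.add h2).div_const 2).nat_add_neg
  rw [hf.horoCoeff_zero, ← hz] at h3
  simp only [mul_zero, zero_mul, add_zero, zero_div, add_self_div_two] at h3
  rw [← PNat.coe_injective.hasSum_iff] at h3
  · refine h3.congr_fun fun n => ?_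
    rw [← ht, whittaker_eq, Function.comp_apply, hα, hβ, Complex.ofReal_cos, Complex.cos]
    simp only [ha, hb']
    push_cast
    ring_nf
  · intro n hn
    have : n = 0 := by
      by_contra h0
      exact hn ⟨⟨n, Nat.pos_of_ne_zero h0⟩, rfl⟩
    rw [this]
    simp [hf.horoCoeff_zero]

lemma isMaassCoeff (hf : IsEvenMaassCuspForm r f) : IsMaassCoeff r f (maassCoeff r f) := by
  rw [maassCoeff, dif_pos hf.exists_isMaassCoeff]
  exact hf.exists_isMaassCoeff.choose_spec

lemma hasSum_ext (hf : IsEvenMaassCuspForm r f) (x t : ℝ) :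
    HasSum (fun n : ℕ+ => maassCoeff r f n * (Real.cos (2 * π * (n * x)) : ℂ) *
      maassKernel r (t + (Real.log n : ℝ))) (ext f (horo x t)) := by
  have h := hf.isMaassCoeff.2 ⟨horo x t, horo_im_pos x t⟩
  have e1 : (⟨horo x t, horo_im_pos x t⟩ : ℍ).im = Real.exp t := by
    change (horo x t).im = _
    simp [horo, ← Complex.ofReal_exp]
  have e2 : (⟨horo x t, horo_im_pos x t⟩ : ℍ).re = x := by
    change (horo x t).re = _
    simp [horo, ← Complex.ofReal_exp]
  have e3 : f ⟨horo x t, horo_im_pos x t⟩ = ext f (horo x t) := by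
    rw [ext, ofComplex_apply_of_im_pos (horo_im_pos x t)]
  rw [e1, e2, e3] at h
  refine h.congr_fun fun n => ?_
  rw [whittaker_eq]
  ring

/-- `maassCoeff` is an arbitrary choice, so its size is read off from the expansion it satisfies. -/
lemma polyBounded_maassCoeff (hf : IsEvenMaassCuspForm r f) : PolyBounded (maassCoeff r f) := by
  obtain ⟨C, N, hb⟩ := hf.exists_norm_ext_le
  obtain ⟨τ, hτ⟩ := exists_maassKernel_ne_zero r
  refine polyBounded_of_norm_mul_le (C := 2 * C) (N := N) hτ fun n t => ?_
  rw [mul_assoc]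
  refine norm_le_of_hasSum_cos (A := fun n : ℕ+ => maassCoeff r f n *
    maassKernel r (t + (Real.log n : ℝ))) (fun x => ?_) (fun x => hb x t) n
  refine (hf.hasSum_ext x t).congr_fun fun n => ?_
  ring

end IsEvenMaassCuspForm

/-! ### Orbit data of Maass forms -/

/-- The inverse of the Mellin transform of `maassKernel`. -/
def maassInv (r w : ℂ) : ℂ := 2 * (π : ℂ) ^ (w + 1 / 2) *
  (Complex.Gamma ((w + 1 / 2 + Complex.I * r) / 2) *
    Complex.Gamma ((w + 1 / 2 - Complex.I * r) / 2))⁻¹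

lemma differentiable_maassInv (r : ℂ) : Differentiable ℂ (maassInv r) := by
  unfold maassInv
  simp only [mul_inv]
  have h : (π : ℂ) ≠ 0 := by exact_mod_cast Real.pi_pos.ne'
  have h1 : Differentiable ℂ fun w : ℂ => (π : ℂ) ^ (w + 1 / 2) := fun w =>
    (by fun_prop : DifferentiableAt ℂ (fun w : ℂ => w + 1 / 2) w).const_cpow (.inl h)
  exact (h1.const_mul 2).mul
    ((Complex.differentiable_one_div_Gamma.comp (by fun_prop :
      Differentiable ℂ fun w : ℂ => (w + 1 / 2 + Complex.I * r) / 2)).mul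
    (Complex.differentiable_one_div_Gamma.comp (by fun_prop :
      Differentiable ℂ fun w : ℂ => (w + 1 / 2 - Complex.I * r) / 2)))

lemma maassInv_mul_integral (r : ℂ) : ∃ σ : ℝ, ∀ w : ℂ, σ < w.re →
    maassInv r w * ∫ t : ℝ, maassKernel r t * Complex.exp (w * t) = 1 := by
  obtain ⟨σ, hσ⟩ := integral_besselKernel r
  refine ⟨max σ |r.im|, fun w hw => ?_⟩
  have hre : (w + 1 / 2).re = w.re + 1 / 2 := by
    rw [Complex.add_re]; norm_num
  have h1 := hσ (w + 1 / 2) (by rw [hre]; linarith [le_max_left σ |r.im|])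
  have hr : |r.im| < (w + 1 / 2).re := by rw [hre]; linarith [le_max_right σ |r.im|]
  have hr' := abs_lt.1 hr
  have g1 : Complex.Gamma ((w + 1 / 2 + Complex.I * r) / 2) ≠ 0 :=
    Complex.Gamma_ne_zero_of_re_pos (by
      rw [Complex.div_ofNat_re, Complex.add_re, Complex.I_mul_re]; linarith)
  have g2 : Complex.Gamma ((w + 1 / 2 - Complex.I * r) / 2) ≠ 0 :=
    Complex.Gamma_ne_zero_of_re_pos (by
      rw [Complex.div_ofNat_re, Complex.sub_re, Complex.I_mul_re]; linarith)
  have e : ∫ t : ℝ, maassKernel r t * Complex.exp (w * t)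
      = 2 * Complex.exp (-((w + 1 / 2) * (Real.log (2 * π) : ℝ))) *
        ∫ t : ℝ, besselKernel r t * Complex.exp ((w + 1 / 2) * t) := by
    rw [← integral_add_right_eq_self (fun t : ℝ => besselKernel r t *
      Complex.exp ((w + 1 / 2) * t)) (Real.log (2 * π)), ← integral_const_mul]
    congr 1 with t
    rw [maassKernel]
    have : Complex.exp ((w + 1 / 2) * (t + Real.log (2 * π) : ℝ))
        = Complex.exp ((w + 1 / 2) * (Real.log (2 * π) : ℝ)) *
          (Complex.exp ((1 / 2 : ℝ) * t) * Complex.exp (w * t)) := by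
      rw [← Complex.exp_add, ← Complex.exp_add]; push_cast; ring_nf
    rw [this, Complex.exp_neg]
    have h0 := Complex.exp_ne_zero ((w + 1 / 2) * (Real.log (2 * π) : ℝ))
    push_cast at h0 ⊢
    field_simp
  have hpi : (π : ℂ) ≠ 0 := by exact_mod_cast Real.pi_pos.ne'
  -- The shift by `log (2π)` in the kernel cancels the power of `2` in the Bessel transform and
  -- leaves a power of `π`.
  have e2 : Complex.exp (-((w + 1 / 2) * (Real.log (2 * π) : ℝ))) * (2 ^ (w + 1 / 2) *
      (π : ℂ) ^ (w + 1 / 2)) = 1 := by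
    rw [Complex.cpow_def_of_ne_zero two_ne_zero, Complex.cpow_def_of_ne_zero hpi,
      ← Complex.exp_add, ← Complex.exp_add, Real.log_mul two_ne_zero Real.pi_pos.ne']
    rw [Complex.exp_eq_one_iff]
    refine ⟨0, ?_⟩
    push_cast
    rw [Complex.ofReal_log Real.pi_pos.le, Complex.ofReal_log zero_le_two]
    push_cast
    ring
  rw [e, maassInv]
  set Γ₁ := Complex.Gamma ((w + 1 / 2 + Complex.I * r) / 2)
  set Γ₂ := Complex.Gamma ((w + 1 / 2 - Complex.I * r) / 2)
  have h3 : (Γ₁ * Γ₂)⁻¹ * (Γ₁ * Γ₂) = 1 := inv_mul_cancel₀ (mul_ne_zero g1 g2)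
  linear_combination ((π : ℂ) ^ (w + 1 / 2) * (Γ₁ * Γ₂)⁻¹ *
      Complex.exp (-((w + 1 / 2) * (Real.log (2 * π) : ℝ)))) * h1 + e2 * (Γ₁ * Γ₂)⁻¹ * (Γ₁ * Γ₂)
      + h3

/-- The kernel for the derivative of a Maass form. -/
def maassKernelOdd (r t : ℂ) : ℂ :=
  2 * π * Complex.I * (Complex.exp ((1 : ℝ) * t) * maassKernel r t)

lemma isStripKernel_maassKernelOdd (r : ℂ) : IsStripKernel (maassKernelOdd r) :=
  ((isStripKernel_maassKernel r).exp_mul 1).const_mul _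

/-- The additional factor `e^t` in the odd kernel shifts `w` by `1`. -/
def maassInvOdd (r w : ℂ) : ℂ := maassInv r (w + 1) / (2 * π * Complex.I)

lemma maassInvOdd_mul_integral (r : ℂ) : ∃ σ : ℝ, ∀ w : ℂ, σ < w.re →
    maassInvOdd r w * ∫ t : ℝ, maassKernelOdd r t * Complex.exp (w * t) = 1 := by
  obtain ⟨σ, hσ⟩ := maassInv_mul_integral r
  refine ⟨σ, fun w hw => ?_⟩
  have h := hσ (w + 1) (by rw [Complex.add_re, Complex.one_re]; linarith)
  have e : ∀ t : ℝ, maassKernelOdd r t * Complex.exp (w * t)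
      = 2 * π * Complex.I * (maassKernel r t * Complex.exp ((w + 1) * t)) := by
    intro t
    rw [maassKernelOdd, add_mul, Complex.exp_add]
    push_cast
    ring
  have h0 : (2 * π * Complex.I : ℂ) ≠ 0 := Complex.two_pi_I_ne_zero
  simp_rw [e]
  rw [integral_const_mul, maassInvOdd, div_mul_eq_mul_div, mul_left_comm, mul_div_cancel_left₀ _ h0, h]

lemma lift_zero_nMat_aMat (f : ℍ → ℂ) (x t : ℝ) :
    lift 0 f (nMat x * aMat t) = ext f (horo x t) := by
  rw [lift_nMat_aMat]
  simp [ext, horo]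

/-- Conjugation by `a(t)` stretches the unipotent group by `e^t`, so `∂₁` at `n(x) a(t)` is `e^t
∂/∂x`. -/
lemma nMat_mul_aMat_mul_nMat (x t s : ℝ) :
    nMat x * aMat t * nMat s = nMat (x + Real.exp t * s) * aMat t := by
  ext i j
  rw [coe_nMat_mul_aMat, Matrix.SpecialLinearGroup.coe_mul, coe_nMat_mul_aMat, coe_nMat,
    Matrix.mul_fin_two]
  have : Real.exp t * Real.exp (-(t / 2)) = Real.exp (t / 2) := by
    rw [← Real.exp_add]; ring_nf
  fin_cases i <;> fin_cases j <;> simp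
  rw [add_mul, mul_right_comm, this]
  ring

lemma ext_cusp {f : ℍ → ℂ} (hf : ∀ (γ : SL(2, ℤ)) (z : ℍ), f (γ • z) = f z) {q : ℕ} [NeZero q]
    {j j' : ℤ} (h : (q : ℤ) ∣ j * j' + 1) {w : ℂ} (hw : 0 < w.im) :
    ext f ((j / q : ℝ) + w) = ext f ((j' / q : ℝ) - 1 / ((q : ℂ) ^ 2 * w)) := by
  obtain ⟨m, hm⟩ := h
  have hdet : (q : ℤ) * m - j * j' = 1 := by linarith
  rw [ext, ← hf (cuspMat j j' m q hdet), cuspMat_smul hdet hw, ext]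

/-! ### Orbit data for even and odd characters -/

namespace IsEvenMaassCuspForm

variable {r : ℂ} {f : ℍ → ℂ}

lemma lift_cusp (hf : IsEvenMaassCuspForm r f) {q : ℕ} [NeZero q] {j j' : ℤ} (t : ℝ)
    (h : (q : ℤ) ∣ j * j' + 1) : lift 0 f (nMat (j / q) * aMat t)
      = 1 * lift 0 f (nMat (j' / q) * aMat (-(2 * Real.log q) - t)) := by
  have hw : 0 < ((Real.exp t : ℝ) * Complex.I : ℂ).im := by
    rw [Complex.im_ofReal_mul, Complex.I_im, mul_one]; exact Real.exp_pos t
  rw [lift_zero_nMat_aMat, lift_zero_nMat_aMat, one_mul, horo, horo, ext_cusp hf.invariant h hw,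
    cusp_sub_inv]

lemma orbitData_even (hf : IsEvenMaassCuspForm r f) : OrbitData (lift 0 f) (maassCoeff r f)
    (maassKernel r) (maassInv r) (fun _ χ => χ.IsPrimitive ∧ χ (-1) = (-1) ^ 0) where
  kernel := isStripKernel_maassKernel r
  coeff := hf.polyBounded_maassCoeff
  diff := differentiable_maassInv r
  mellin := maassInv_mul_integral r
  prim _ _ h := h.1
  inv _ χ h := by
    rw [DirichletCharacter.isPrimitive_def, DirichletCharacter.conductor_inv, inv_apply_neg_one]
    exact h
  series _ _ χ h t := by
    refine orbitSum_series (Ψ := fun x => (Real.cos (2 * π * x) : ℂ)) (fun x t => ?_)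
      (fun n => sum_char_mul_cos h.1 (h.2.trans (pow_zero _)) n) t
    rw [lift_zero_nMat_aMat]
    exact hf.hasSum_ext x t
  feq _ _ χ _ := orbitSum_feq χ (ω := 1) (by simp) fun _ _ t h => hf.lift_cusp t h

lemma partial1_lift (hf : IsEvenMaassCuspForm r f) (x t : ℝ) :
    partial1 (lift 0 f) (nMat x * aMat t)
      = (Real.exp t : ℂ) * fderiv ℝ (ext f) (horo x t) 1 := by
  rw [partial1]
  simp only [nMat_mul_aMat_mul_nMat, lift_zero_nMat_aMat]
  have h1 : HasDerivAt (fun s : ℝ => x + Real.exp t * s) (Real.exp t * 1) 0 :=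
    ((hasDerivAt_id (0 : ℝ)).const_mul _).const_add x
  have h2 := hf.hasDerivAt_ext_left (x + Real.exp t * 0) t
  have h3 := HasDerivAt.scomp (h := fun s : ℝ => x + Real.exp t * s) (0 : ℝ) h2 h1
  rw [mul_zero, add_zero, mul_one, Complex.real_smul] at h3
  exact h3.deriv

/-- The relation `f(j/q + w) = f(j'/q - 1/(q² w))` is differentiated along `w = s + i e^t` at `s =
0`. There the map has the real derivative `-1 / (q² e^{2t})`, so horizontal directions stay
horizontal and are reversed; multiplying by `e^t` gives the new height and the sign `-1`. -/
lemma fderiv_cusp (hf : IsEvenMaassCuspForm r f) {q : ℕ} [NeZero q] {j j' : ℤ} (t : ℝ)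
    (h : (q : ℤ) ∣ j * j' + 1) : partial1 (lift 0 f) (nMat (j / q) * aMat t)
      = -1 * partial1 (lift 0 f) (nMat (j' / q) * aMat (-(2 * Real.log q) - t)) := by
  have hq : (q : ℂ) ≠ 0 := by exact_mod_cast NeZero.ne q
  have hE : ((Real.exp t : ℝ) : ℂ) ≠ 0 := by exact_mod_cast (Real.exp_pos t).ne'
  have hw : ∀ s : ℝ, 0 < ((s : ℂ) + (Real.exp t : ℝ) * Complex.I).im := fun s =>
    im_add_exp_pos s t
  rw [hf.partial1_lift, hf.partial1_lift]
  have e : (fun s : ℝ => ext f (horo (j / q + s) t)) = fun s : ℝ =>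
      ext f ((j' / q : ℝ) - 1 / ((q : ℂ) ^ 2 * (s + (Real.exp t : ℝ) * Complex.I))) := by
    funext s
    rw [← ext_cusp hf.invariant h (hw s), horo]
    congr 1
    push_cast
    ring
  have d1 : HasDerivAt (fun s : ℝ => ext f (horo (j / q + s) t))
      (fderiv ℝ (ext f) (horo (j / q) t) 1) 0 := by
    have := (hf.hasDerivAt_ext_left (j / q + 0) t).comp_const_add (j / q : ℝ) 0
    rwa [add_zero] at this
  set c : ℝ := -((q : ℝ) ^ 2 * Real.exp t ^ 2)⁻¹ with hc
  have d2 : HasDerivAt (fun s : ℝ => ((j' / q : ℝ) : ℂ) - 1 / ((q : ℂ) ^ 2 *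
      (s + (Real.exp t : ℝ) * Complex.I))) (c : ℂ) 0 := by
    have h0 : ((q : ℂ) ^ 2 * (((0 : ℝ) : ℂ) + (Real.exp t : ℝ) * Complex.I)) ≠ 0 := by
      simp [hq, Complex.exp_ne_zero]
    have := (((((hasDerivAt_id ((0 : ℝ) : ℂ)).add_const ((Real.exp t : ℝ) * Complex.I)).const_mul
      ((q : ℂ) ^ 2)).fun_inv h0).const_sub ((j' / q : ℝ) : ℂ)).comp_ofReal
    simp only [id, ← one_div] at this
    refine this.congr_deriv ?_
    rw [hc]
    push_cast at h0 ⊢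
    rw [zero_add] at h0 ⊢
    have hI := Complex.I_ne_zero
    push_cast at hE
    field_simp
    rw [Complex.I_sq, neg_neg]
  have hpt : ((j' / q : ℝ) : ℂ) - 1 / ((q : ℂ) ^ 2 * (((0 : ℝ) : ℂ) + (Real.exp t : ℝ) *
      Complex.I)) = horo (j' / q) (-(2 * Real.log q) - t) := by
    rw [Complex.ofReal_zero, zero_add, cusp_sub_inv, horo]
  have d3 := HasFDerivAt.comp_hasDerivAt (f := fun s : ℝ => ((j' / q : ℝ) : ℂ) - 1 / ((q : ℂ) ^ 2 *
      (s + (Real.exp t : ℝ) * Complex.I))) (0 : ℝ)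
    (hf.hasFDerivAt (by rw [hpt]; exact horo_im_pos _ _)) d2
  rw [hpt] at d3
  rw [e] at d1
  have h4 := d1.unique d3
  have h5 : fderiv ℝ (ext f) (horo (j' / q) (-(2 * Real.log q) - t)) (c : ℂ)
      = c * fderiv ℝ (ext f) (horo (j' / q) (-(2 * Real.log q) - t)) 1 := by
    rw [← Complex.real_smul, ← map_smul, Complex.real_smul, mul_one]
  rw [h4, h5, exp_neg_two_log_sub, hc]
  push_cast at hE ⊢
  field_simp

/-- The cosine series is differentiated term by term: the factor `-2π n e^t` goes into the odd
kernel as `2πi · i · e^{t + log n}`. -/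
lemma hasSum_partial1 (hf : IsEvenMaassCuspForm r f) (x t : ℝ) :
    HasSum (fun n : ℕ+ => maassCoeff r f n * (Complex.I * (Real.sin (2 * π * (n * x)) : ℂ)) *
      maassKernelOdd r (t + (Real.log n : ℝ))) (partial1 (lift 0 f) (nMat x * aMat t)) := by
  have hsum : Summable fun n : ℕ+ => ‖maassCoeff r f n * maassKernelOdd r (t + (Real.log n : ℝ))‖ := by
    have := (summable_twistTerm hf.polyBounded_maassCoeff (isStripKernel_maassKernelOdd r)
      (1 : DirichletCharacter ℂ 1) (ofReal_mem_strip t)).norm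
    refine this.congr fun n => ?_
    rw [twistTerm, Subsingleton.elim (((n : ℕ) : ZMod 1)) 1, map_one, mul_one]
  have hE : (Real.exp t : ℂ) ≠ 0 := by exact_mod_cast (Real.exp_pos t).ne'
  have hb : ∀ (n : ℕ+) (x : ℝ), ‖(Real.exp t : ℂ)⁻¹ * (maassCoeff r f n * (Complex.I *
      (Real.sin (2 * π * (n * x)) : ℂ)) * maassKernelOdd r (t + (Real.log n : ℝ)))‖
      ≤ ‖(Real.exp t : ℂ)⁻¹‖ * ‖maassCoeff r f n * maassKernelOdd r (t + (Real.log n : ℝ))‖ := by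
    intro n x
    rw [norm_mul]
    refine mul_le_mul_of_nonneg_left ?_ (norm_nonneg _)
    rw [mul_right_comm, norm_mul _ (Complex.I * _), norm_mul Complex.I, Complex.norm_I, one_mul,
      Complex.norm_real]
    exact mul_le_of_le_one_right (norm_nonneg _) (Real.abs_sin_le_one _)
  have hd := hasDerivAt_tsum (g := fun (n : ℕ+) (x : ℝ) => maassCoeff r f n *
      (Real.cos (2 * π * (n * x)) : ℂ) * maassKernel r (t + (Real.log n : ℝ)))
    (g' := fun (n : ℕ+) (x : ℝ) => (Real.exp t : ℂ)⁻¹ * (maassCoeff r f n * (Complex.I *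
      (Real.sin (2 * π * (n * x)) : ℂ)) * maassKernelOdd r (t + (Real.log n : ℝ))))
    (hsum.mul_left _) (fun n x => ?_) hb (hf.hasSum_ext x t).summable x
  · have h1 : HasDerivAt (fun x => ext f (horo x t)) _ x :=
      hd.congr_of_eventuallyEq (.of_forall fun x => (hf.hasSum_ext x t).tsum_eq.symm)
    have h2 : Summable fun n : ℕ+ => (Real.exp t : ℂ)⁻¹ * (maassCoeff r f n * (Complex.I *
        (Real.sin (2 * π * (n * x)) : ℂ)) * maassKernelOdd r (t + (Real.log n : ℝ))) :=
      Summable.of_norm_bounded (hsum.mul_left _) fun n => hb n x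
    have h3 := h2.hasSum
    rw [h1.unique (hf.hasDerivAt_ext_left x t)] at h3
    rw [hf.partial1_lift]
    refine (h3.mul_left (Real.exp t : ℂ)).congr_fun fun n => ?_
    rw [mul_inv_cancel_left₀ hE]
  · have hn' : (0 : ℝ) < (n : ℕ) := by exact_mod_cast n.pos
    have h1 : HasDerivAt (fun x : ℝ => (Real.cos (2 * π * (n * x)) : ℂ)) _ x :=
      ((((hasDerivAt_id x).const_mul (n : ℝ)).const_mul (2 * π)).cos).ofReal_comp
    refine ((h1.const_mul _).mul_const _).congr_deriv ?_
    have e1 : Complex.exp ((1 : ℝ) * (t + (Real.log n : ℝ))) = n * (Real.exp t : ℝ) := by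
      rw [Complex.ofReal_one, one_mul, ← Complex.ofReal_add, ← Complex.ofReal_exp, Real.exp_add,
        Real.exp_log hn']
      push_cast; ring
    rw [maassKernelOdd, e1]
    simp only [id]
    push_cast at hE ⊢
    field_simp
    rw [Complex.I_sq]
    ring

lemma orbitData_odd (hf : IsEvenMaassCuspForm r f) :
    OrbitData (partial1 (lift 0 f)) (maassCoeff r f)
      (maassKernelOdd r) (maassInvOdd r) (fun _ χ => χ.IsPrimitive ∧ χ (-1) = (-1) ^ 1) where
  kernel := isStripKernel_maassKernelOdd r
  coeff := hf.polyBounded_maassCoeff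
  diff := by
    unfold maassInvOdd
    exact ((differentiable_maassInv r).comp (by fun_prop : Differentiable ℂ fun w : ℂ => w + 1)
      ).div_const _
  mellin := maassInvOdd_mul_integral r
  prim _ _ h := h.1
  inv _ χ h := by
    rw [DirichletCharacter.isPrimitive_def, DirichletCharacter.conductor_inv, inv_apply_neg_one]
    exact h
  series _ _ χ h t := orbitSum_series (Ψ := fun x => Complex.I * (Real.sin (2 * π * x) : ℂ))
    (fun x t => hf.hasSum_partial1 x t) (fun n => sum_char_mul_sin h.1 (h.2.trans (pow_one _)) n) t
  feq _ _ χ _ := orbitSum_feq χ (ω := -1) (by simp) fun _ _ t h => hf.fderiv_cusp t h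

lemma maassCoeff_eq (r : ℂ) (f : ℍ → ℂ) (n : ℕ+) :
    maassCoeff r f n = maassCoeff r f n * ((n : ℕ) : ℂ) ^ (((0 : ℤ) : ℂ) / 2) := by
  simp

theorem isTwistedL_twistedL (hf : IsEvenMaassCuspForm r f) {q : ℕ} [NeZero q]
    {χ : DirichletCharacter ℂ q} (hχ : χ.IsPrimitive) :
    IsTwistedL (maassCoeff r f) 0 χ (twistedL (maassCoeff r f) 0 χ) := by
  have h1 : χ (-1) * χ (-1) = 1 := by rw [← map_mul]; simp
  rcases mul_self_eq_one_iff.1 h1 with h | h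
  · exact hf.orbitData_even.isTwistedL_twistedL (maassCoeff_eq r f) ⟨hχ, by rw [h, pow_zero]⟩
  · exact hf.orbitData_odd.isTwistedL_twistedL (maassCoeff_eq r f) ⟨hχ, by rw [h, pow_one]⟩

theorem reducesToOrbitSums (hf : IsEvenMaassCuspForm r f) (s : ℂ) {δ : ℕ} (hδ : δ ≤ 1) :
    ReducesToOrbitSums (lift 0 f) (partial1^[δ] (lift 0 f))
      ![s, r, (Complex.Gamma ((s + δ + Complex.I * r) / 2) *
        Complex.Gamma ((s + δ - Complex.I * r) / 2))⁻¹] s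
      (fun _ χ => χ.IsPrimitive ∧ χ (-1) = (-1) ^ δ)
      (fun _ χ => twistedL (maassCoeff r f) 0 χ⁻¹ s) := by
  generalize hc : ![s, r, (Complex.Gamma ((s + δ + Complex.I * r) / 2) *
        Complex.Gamma ((s + δ - Complex.I * r) / 2))⁻¹] = c
  have hc0 : c 0 = s := by rw [← hc]; rfl
  have hc2 : c 2 = (Complex.Gamma ((s + δ + Complex.I * r) / 2) *
        Complex.Gamma ((s + δ - Complex.I * r) / 2))⁻¹ := by rw [← hc]; rfl
  have hpi : (π : ℂ) ≠ 0 := by exact_mod_cast Real.pi_pos.ne'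
  have h4 : (2 * (π / 2) : ℂ) = (π : ℝ) := by ring
  let P : Expr := .mul (.nat 2) .halfPi
  have hP : ∀ m, P.Ok c m ∧ P.eval c m = (π : ℝ) := by
    intro m
    obtain ⟨h1, h2⟩ := Expr.ok_halfPi c m
    refine ⟨⟨trivial, h1, trivial⟩, ?_⟩
    simp only [P, Expr.eval, BinOp.eval, h2]
    rw [← h4]
    norm_num
  have hslit := Complex.ofReal_mem_slitPlane.2 Real.pi_pos
  interval_cases δ
  · refine hf.orbitData_even.reducesToOrbitSums_twistedL (maassCoeff_eq r f) hc0
      -- This is `2 π^s` times the inverse Gamma factors.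
      (.mul (.mul (.nat 2) (.exp (.mul (.const 0) (.log P)))) (.const 2)) fun m => ?_
    obtain ⟨h1, h2⟩ := hP m
    refine ⟨?_, ?_⟩
    · simp only [Expr.Ok, Expr.eval, UnOp.Ok, BinOp.Ok, h1, h2, hslit, and_self]
    · simp only [Expr.eval, UnOp.eval, h2, BinOp.eval, maassInv, hc0, hc2]
      rw [sub_add_cancel, Complex.cpow_def_of_ne_zero hpi]
      push_cast
      ring_nf
  · refine hf.orbitData_odd.reducesToOrbitSums_twistedL (maassCoeff_eq r f) hc0
      -- The same with `s + 1` in the exponent of `π`, divided by the `2πi` of the odd kernel; `.lit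
      -- 0 1` is `i`.
      (.div (.mul (.mul (.nat 2) (.exp (.mul (.add (.const 0) (.nat 1)) (.log P)))) (.const 2))
        (.mul (.mul (.nat 2) P) (.lit 0 1))) fun m => ?_
    obtain ⟨h1, h2⟩ := hP m
    refine ⟨?_, ?_⟩
    · simp only [Expr.Ok, Expr.eval, UnOp.Ok, BinOp.Ok, h1, h2, hslit, and_self, true_and,
        BinOp.eval]
      norm_num
    · simp only [Expr.eval, UnOp.eval, h2, BinOp.eval, maassInvOdd, maassInv, hc0, hc2]
      norm_num
      rw [Complex.cpow_def_of_ne_zero hpi]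
      ring_nf

end IsEvenMaassCuspForm

end TwistedL

end

theorem mainTheorem2 :
    -- holomorphic cusp forms of weight `k`
    (∀ (k : ℤ) (f : CuspForm 𝒮ℒ k),
      (∀ (q : ℕ) [NeZero q] (χ : DirichletCharacter ℂ q), χ.IsPrimitive →
        TwistedL.IsTwistedL (fun n => (qExpansion 1 f).coeff n) k χ
          (TwistedL.twistedL (fun n => (qExpansion 1 f).coeff n) k χ)) ∧
      ∀ s : ℂ,
        TwistedL.ReducesToOrbitSums (TwistedL.lift k f) (TwistedL.lift k f)
          ![s, (k : ℂ), (Complex.Gamma (s + ((k : ℂ) - 1) / 2))⁻¹] s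
          (fun _ χ => χ.IsPrimitive)
          (fun _ χ => TwistedL.twistedL (fun n => (qExpansion 1 f).coeff n) k χ⁻¹ s)) ∧
    -- even Maass cusp forms, `χ(-1) = (-1)^δ`; for odd `χ` the sums are those of `∂₂^l ∂₁ f̃`
    (∀ (r : ℂ) (f : ℍ → ℂ), TwistedL.IsEvenMaassCuspForm r f →
      (∀ (q : ℕ) [NeZero q] (χ : DirichletCharacter ℂ q), χ.IsPrimitive →
        TwistedL.IsTwistedL (TwistedL.maassCoeff r f) 0 χ
          (TwistedL.twistedL (TwistedL.maassCoeff r f) 0 χ)) ∧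
      ∀ (s : ℂ) (δ : ℕ), δ ≤ 1 →
        TwistedL.ReducesToOrbitSums (TwistedL.lift 0 f)
          (TwistedL.partial1^[δ] (TwistedL.lift 0 f))
          ![s, r, (Complex.Gamma ((s + δ + Complex.I * r) / 2) *
            Complex.Gamma ((s + δ - Complex.I * r) / 2))⁻¹] s
          (fun _ χ => χ.IsPrimitive ∧ χ (-1) = (-1) ^ δ)
          (fun _ χ => TwistedL.twistedL (TwistedL.maassCoeff r f) 0 χ⁻¹ s)) := by
  refine ⟨fun k f => TwistedL.isTwistedL_and_reducesToOrbitSums_holo f, fun r f hf => ⟨fun q _ χ hχ => ?_, fun s δ hδ => ?_⟩⟩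
  · exact TwistedL.IsEvenMaassCuspForm.isTwistedL_twistedL hf hχ
  · exact TwistedL.IsEvenMaassCuspForm.reducesToOrbitSums hf s hδ
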